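/- **Theorem 6.6.** Let $q\in\{0,1,2,\dots\}\cup\{\infty\}$ and let $V=\mathbb H^{\infty,q}$ be the quaternionic vector space with basis $L=\{\dots,v_{-2},v_{-1};v_1,v_2,\dots,v_q\}$ (all $v_j$, $j>0$, if $q=\infty$) and $\mathbb H$-hermitian form $h$ with $h(v_i,v_j)=\delta_{ij}$ for $i<0$ and $h(v_i,v_j)=-\delta_{ij}$ for $i>0$. Let $V_+=\mathrm{Span}\{v_i: i<0\}$ and $V_-=\mathrm{Span}\{v_i: i>0\}$. Let $G=SL(\infty+q;\mathbb H)=\varinjlim SL(S;\mathbb H)$, where $S$ runs over the finite subsets of $L$ and $SL(S;\mathbb H)$ fixes $L\setminus S$ pointwise and acts on $\mathrm{Span}(S)$ with reduced norm $1$. Let $G_0=Sp(\infty,q)=\{g\in G: g \text{ preserves } h\}$ and $K_0=Sp(\infty)\times Sp(q)=\{g\in G_0: gV_\pm=V_\pm\}$. "Subspace" means $\mathbb H$-subspace. A set of subspaces is *weakly compatible* with $L$ if there is a basis of $V$, containing all but finitely many elements of $L$, such that every subspace in the set is spanned by elements of that basis; a subspace $W$ is weakly compatible with $L$ if $\{0,W,V\}$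 is. A *generalized flag* is a chain of subspaces in which every member has an immediate predecessor or an immediate successor, and such that every $0\ne v\in V$ lies in $F''\setminus F'$ for some immediate neighbours $F'\subset F''$ of the chain. Generalized flags $\mathcal F,\mathcal F'$ are *$L$-commensurable* if both are weakly compatible with $L$ and there are a bijection $\varphi:\mathcal F\to\mathcal F'$ and a finite dimensional $U\subset V$ with $F\subset\varphi(F)+U$, $\varphi(F)\subset F+U$ and $\dim(F\cap U)=\dim(\varphi(F)\cap U)$ for all $F\in\mathcal F$. The quaternionic flag manifold $\mathfrak X_{\mathcal F,L}$ is the set of all generalized flags $L$-commensurable to $\mathcal F$; it is a single $G$-orbit. Let $\mathcal B^+_L$ (resp. $\mathcal B^-_L$) be the set of all maximal positive (resp. negative) definite subspaces $W\subset V$ that are weakly compatible with $L$ and for which $W\cap V_+$ (resp. $W\cap V_-$) has finite codimension both in $W$ and in $V_+$ (resp. $V_-$). All homogeneous spaces $G/H$ of $G$ carry the direct limit (ind-manifold) structure: smooth maps from $\mathbb R^n$ to $G/H$ are the maps that locally lift to smooth maps into some $SL(S;\mathbb H)$, up to a translation of the base point; a map between (subsets, or products of subsets, of) such spaces is smooth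 if it preserves such smooth families, and the topology is the finest for which these families are continuous. Let $\mathcal F$ be a generalized flag weakly compatible with $L$ that contains a subspace other than $0$ and $V$, and let $D$ be a $G_0$-orbit in $\mathfrak X_{\mathcal F,L}$ that is open. A *base cycle* in $D$ is an orbit $Y=K_0(\mathcal F^{(0)})$ where $\mathcal F^{(0)}\in D$ and $F=(F\cap V_+)\oplus(F\cap V_-)$ for all $F\in\mathcal F^{(0)}$. For a base cycle $Y$, the *cycle space* $\mathcal M_D$ is the topological component of $Y$ in $\{gY : g\in G,\ gY\subset D\}\subset G/G_Y$, where $G_Y=\{g\in G: gY=Y\}$. Then: 1. $\mathcal B^+_L$ is the set of all positive definite $G$-translates of $V_+$, and $\mathcal B^-_L$ is the set of all negative definite $G$-translates of $V_-$ (with smooth structures as subsets of $G/\mathrm{Stab}_G(V_\pm)$), and $\mathcal B^+_L$ and $\mathcal B^-_L$ are diffeomorphic. 2. $D$ contains a base cycle, and for every base cycle $Y$ in $D$ and every $\mathcal F^{(1)}\in D$: (a) if every $F\in\mathcal F^{(1)}$, $F\neq V$, is positive definite, then $\mathcal M_D$ is diffeomorphic to $\mathcal B^+_L$; (b) if every $F\in\mathcal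 F^{(1)}$, $F\neq V$, is negative definite, then $\mathcal M_D$ is diffeomorphic to $\mathcal B^-_L$; (c) if some $F\in\mathcal F^{(1)}$, $F\neq V$, is indefinite (takes positive and negative values of $h(x,x)$), then $\mathcal M_D$ is diffeomorphic to $\mathcal B^+_L\times\mathcal B^-_L$. -/

import Mathlib

open scoped Quaternion Pointwise ContDiff

noncomputable section

namespace QuatCycle

/-! ### The quaternionic space of signature `(∞, q)` -/

/-- The index set of the basis `L = {…, v₋₂, v₋₁; v₁, v₂, …, v_q}`, where `q ≤ ∞`.
The positive vector `v₋ₖ₋₁` has index `inl k`, the negative vector `vₖ₊₁` has index `inr k`. -/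
abbrev Idx (q : ℕ∞) : Type := ℕ ⊕ {j : ℕ // (j : ℕ∞) < q}

/-- The quaternionic vector space with basis `L` (a left vector space over `ℍ`). -/
abbrev V (q : ℕ∞) : Type := Idx q →₀ ℍ[ℝ]

/-- The group of all invertible `ℍ`-linear transformations of `V q`. -/
abbrev GLV (q : ℕ∞) : Type := V q ≃ₗ[ℍ[ℝ]] V q

/-- The quaternionic subspaces. -/
abbrev Sub (q : ℕ∞) : Type := Submodule ℍ[ℝ] (V q)

variable {q : ℕ∞}

/-- The basis vectors. -/
def vec (i : Idx q) : V q := Finsupp.single i 1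

/-- `+1` at the positive indices and `-1` at the negative ones. -/
def sgn : Idx q → ℝ := Sum.elim (fun _ => 1) (fun _ => -1)

/-- The `ℍ`-hermitian form `h`, with `h(vᵢ, vⱼ) = ± δᵢⱼ`. -/
def herm (x y : V q) : ℍ[ℝ] := x.sum fun i a => sgn i • (a * star (y i))

/-- The span of the positive basis vectors. -/
def Vpos (q : ℕ∞) : Sub q := Submodule.span ℍ[ℝ] (Set.range fun k => vec (Sum.inl k))

/-- The span of the negative basis vectors. -/
def Vneg (q : ℕ∞) : Sub q := Submodule.span ℍ[ℝ] (Set.range fun k => vec (Sum.inr k))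

/-- `W` is positive definite. -/
def PosDef (W : Sub q) : Prop := ∀ x ∈ W, x ≠ 0 → 0 < (herm x x).re

/-- `W` is negative definite. -/
def NegDef (W : Sub q) : Prop := ∀ x ∈ W, x ≠ 0 → (herm x x).re < 0

/-- `W` is indefinite. -/
def Indef (W : Sub q) : Prop :=
  (∃ x ∈ W, 0 < (herm x x).re) ∧ ∃ y ∈ W, (herm y y).re < 0

/-! ### The groups -/

/-- The span of the basis vectors with index in the finite set `S`. -/
def spanOf (S : Finset (Idx q)) : Sub q := Finsupp.supported ℍ[ℝ] ℍ[ℝ] (S : Set (Idx q))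

/-- The real-linear endomorphism of the span of `S` induced by an `ℍ`-linear map preserving it. -/
def realRestrict (S : Finset (Idx q)) (g : GLV q) (hg : ∀ x, g x ∈ spanOf S ↔ x ∈ spanOf S) :
    spanOf S →ₗ[ℝ] spanOf S :=
  LinearMap.restrictScalars ℝ
    (LinearMap.restrict (g : V q →ₗ[ℍ[ℝ]] V q) fun x hx => (hg x).2 hx)

/-- The group `SL(S; ℍ)`: the transformations which fix every basis vector outside the finite
set `S` and act on the span of `S` with reduced norm `1`.  The determinant of the underlying
real-linear map is the square of the reduced norm, and the reduced norm is positive. -/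
def levelSL (S : Finset (Idx q)) : Subgroup (GLV q) where
  carrier := {g | (∀ i ∉ S, g (vec i) = vec i) ∧
    ∃ hg : ∀ x, g x ∈ spanOf S ↔ x ∈ spanOf S, LinearMap.det (A := ℝ) (M := spanOf S) (realRestrict S g hg) = 1}
  one_mem' := by
    refine ⟨fun i _ => rfl, fun x => Iff.rfl, ?_⟩
    exact LinearMap.det_id
  mul_mem' := by
    rintro a b ⟨ha, ha', hda⟩ ⟨hb, hb', hdb⟩
    refine ⟨fun i hi => ?_, fun x => (ha' (b x)).trans (hb' x), ?_⟩
    · rw [LinearEquiv.mul_apply, hb i hi, ha i hi]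
    · refine (LinearMap.det_comp (A := ℝ) (M := spanOf S) (realRestrict S a ha') (realRestrict S b hb')).trans ?_
      rw [hda, hdb, one_mul]
  inv_mem' := by
    rintro a ⟨ha, ha', hda⟩
    have hi : ∀ x, a (a⁻¹ x) = x := fun x => a.apply_symm_apply x
    have hg : ∀ x, a⁻¹ x ∈ spanOf S ↔ x ∈ spanOf S := fun x => by
      rw [← ha' (a⁻¹ x), hi]
    refine ⟨fun i hi' => ?_, hg, ?_⟩
    · apply a.injective
      rw [hi, ha i hi']
    · have h1 : realRestrict S a ha' ∘ₗ realRestrict S a⁻¹ hg = LinearMap.id := by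
        ext x : 2
        exact hi x
      have h2 := LinearMap.det_comp (A := ℝ) (M := spanOf S) (realRestrict S a ha') (realRestrict S a⁻¹ hg)
      rw [h1, LinearMap.det_id, hda, one_mul] at h2
      exact h2.symm

theorem mem_spanOf {S : Finset (Idx q)} {x : V q} : x ∈ spanOf S ↔ ∀ i ∉ S, x i = 0 := by
  simp [spanOf, Finsupp.mem_supported']

theorem apply_eq_self_of_disjoint {S : Finset (Idx q)} {g : GLV q}
    (hg : ∀ i ∉ S, g (vec i) = vec i) {x : V q} (hx : ∀ i ∈ S, x i = 0) : g x = x := by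
  have h1 : x = x.sum fun i a => a • (vec i : V q) := by
    conv_lhs => rw [← Finsupp.sum_single x]
    simp [vec]
  conv_lhs => rw [h1]
  conv_rhs => rw [h1]
  rw [Finsupp.sum, map_sum]
  refine Finset.sum_congr rfl fun i hi => ?_
  rw [map_smul, hg i]
  intro hS
  exact (Finsupp.mem_support_iff.1 hi) (hx i hS)

theorem levelSL_mono {S T : Finset (Idx q)} (h : S ⊆ T) : levelSL S ≤ levelSL T := by
  classical
  rintro g ⟨h1, h2, h3⟩
  have hST : spanOf S ≤ spanOf T := Finsupp.supported_mono (by exact_mod_cast h)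
  have hDT : spanOf (T \ S) ≤ spanOf T :=
    Finsupp.supported_mono (by exact_mod_cast Finset.sdiff_subset)
  have hgD : ∀ x ∈ spanOf (T \ S), g x = x := fun x hx =>
    apply_eq_self_of_disjoint h1 fun i hi => mem_spanOf.1 hx i (by simp [hi])
  have hsplit : ∀ x ∈ spanOf T, ∃ a ∈ spanOf S, ∃ b ∈ spanOf (T \ S), a + b = x := by
    intro x hx
    refine ⟨x.filter (· ∈ S), mem_spanOf.2 fun i hi => Finsupp.filter_apply_neg _ _ hi,
      x.filter (fun i => ¬ i ∈ S), mem_spanOf.2 fun i hi => ?_,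
      Finsupp.filter_add_filter_not x (· ∈ S)⟩
    by_cases hS : i ∈ S
    · exact Finsupp.filter_apply_neg _ _ (by simpa using hS)
    · rw [Finsupp.filter_apply_pos (fun i => ¬ i ∈ S) x hS]
      exact mem_spanOf.1 hx i fun hT => hi (Finset.mem_sdiff.2 ⟨hT, hS⟩)
  have hgT : ∀ x, x ∈ spanOf T → g x ∈ spanOf T := by
    intro x hx
    obtain ⟨a, ha, b, hb, rfl⟩ := hsplit x hx
    rw [map_add, hgD b hb]
    exact add_mem (hST ((h2 a).2 ha)) (hDT hb)
  have hgT' : ∀ x, g x ∈ spanOf T ↔ x ∈ spanOf T := by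
    refine fun x => ⟨fun hx => ?_, hgT x⟩
    obtain ⟨a, ha, b, hb, hab⟩ := hsplit _ hx
    have : x = g.symm a + b := by
      apply g.injective
      rw [map_add, hgD b hb, g.apply_symm_apply, hab]
    rw [this]
    exact add_mem (hST ((h2 _).1 (by rwa [g.apply_symm_apply]))) (hDT hb)
  refine ⟨fun i hi => h1 i fun hS => hi (h hS), hgT', ?_⟩
  let f : (spanOf S × spanOf (T \ S)) →ₗ[ℝ] spanOf T :=
    { toFun := fun p => ⟨p.1.1 + p.2.1, add_mem (hST p.1.2) (hDT p.2.2)⟩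
      map_add' := fun p r => Subtype.ext (by simp; abel)
      map_smul' := fun c p => Subtype.ext (by simp) }
  have hf : Function.Bijective f := by
    refine ⟨?_, ?_⟩
    · rintro ⟨⟨a, ha⟩, ⟨b, hb⟩⟩ ⟨⟨c, hc⟩, ⟨d, hd⟩⟩ hp
      have hab : a + b = c + d := congrArg Subtype.val hp
      have hac : a = c := by
        ext1 i
        by_cases hS : i ∈ S
        · have := DFunLike.congr_fun hab i
          rw [Finsupp.add_apply, Finsupp.add_apply, mem_spanOf.1 hb i (by simp [hS]),
            mem_spanOf.1 hd i (by simp [hS]), add_zero, add_zero] at this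
          exact this
        · rw [mem_spanOf.1 ha i hS, mem_spanOf.1 hc i hS]
      subst hac
      have hbd := add_left_cancel hab
      subst hbd
      rfl
    · rintro ⟨x, hx⟩
      obtain ⟨a, ha, b, hb, rfl⟩ := hsplit x hx
      exact ⟨(⟨a, ha⟩, ⟨b, hb⟩), rfl⟩
  let e := LinearEquiv.ofBijective f hf
  have hconj : realRestrict T g hgT' ∘ₗ e.toLinearMap =
      e.toLinearMap ∘ₗ
        LinearMap.prodMap (realRestrict S g h2) LinearMap.id := by
    refine LinearMap.ext fun p => Subtype.ext ?_
    change g (p.1.1 + p.2.1) = g p.1.1 + p.2.1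
    rw [map_add, hgD _ p.2.2]
  have hfin : ∀ U : Finset (Idx q), Module.Finite ℝ (spanOf U) := by
    intro U
    have : Module.Finite ℍ[ℝ] (spanOf U) :=
      Module.Finite.equiv (Finsupp.supportedEquivFinsupp (R := ℍ[ℝ]) (M := ℍ[ℝ]) (U : Set (Idx q))).symm
    exact Module.Finite.trans (R := ℝ) ℍ[ℝ] (spanOf U)
  have hfree : ∀ U : Finset (Idx q), Module.Free ℝ (spanOf U) := fun U =>
    Module.Free.of_divisionRing ℝ (spanOf U)
  have := hfree S
  have := hfree (T \ S)
  have := hfin S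
  have := hfin (T \ S)
  have hdet := LinearMap.det_conj (A := ℝ) (M := spanOf S × spanOf (T \ S)) (N := spanOf T)
    (LinearMap.prodMap (realRestrict S g h2) LinearMap.id) e
  have hT : realRestrict T g hgT' = e.toLinearMap ∘ₗ
      LinearMap.prodMap (realRestrict S g h2) LinearMap.id ∘ₗ
        e.symm.toLinearMap := by
    rw [← LinearMap.comp_assoc, ← hconj]
    refine LinearMap.ext fun p => ?_
    change _ = realRestrict T g hgT' (e (e.symm p))
    rw [e.apply_symm_apply]
  rw [hT]
  refine hdet.trans ?_
  refine (LinearMap.det_prodMap (R := ℝ) (M := spanOf S) (M' := spanOf (T \ S)) _ _).trans ?_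
  rw [h3, one_mul]
  exact LinearMap.det_id

/-- The direct limit group `G = SL(∞ + q; ℍ) = ⋃ SL(S; ℍ)`. -/
def G (q : ℕ∞) : Subgroup (GLV q) where
  carrier := {g | ∃ S, g ∈ levelSL S}
  one_mem' := ⟨∅, one_mem _⟩
  mul_mem' := by
    classical
    rintro a b ⟨S, ha⟩ ⟨T, hb⟩
    exact ⟨S ∪ T, mul_mem (levelSL_mono Finset.subset_union_left ha)
      (levelSL_mono Finset.subset_union_right hb)⟩
  inv_mem' := by
    rintro a ⟨S, ha⟩
    exact ⟨S, inv_mem ha⟩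

/-- The real group `G₀ = Sp(∞, q)`, the subgroup of `G` preserving the hermitian form. -/
def G₀ (q : ℕ∞) : Subgroup (GLV q) where
  carrier := {g | g ∈ G q ∧ ∀ x y, herm (g x) (g y) = herm x y}
  one_mem' := ⟨one_mem _, fun _ _ => rfl⟩
  mul_mem' := by
    rintro a b ⟨ha, ha'⟩ ⟨hb, hb'⟩
    exact ⟨mul_mem ha hb, fun x y => (ha' (b x) (b y)).trans (hb' x y)⟩
  inv_mem' := by
    rintro a ⟨ha, ha'⟩
    refine ⟨inv_mem ha, fun x y => ?_⟩
    have hi : ∀ x, a (a⁻¹ x) = x := fun x => a.apply_symm_apply x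
    rw [← ha' (a⁻¹ x) (a⁻¹ y), hi, hi]

/-- The maximal lim-compact subgroup `K₀ = Sp(∞) × Sp(q)` of `G₀`, which consists of the
elements of `G₀` preserving the two summands of `V = V₊ ⊕ V₋`. -/
def K₀ (q : ℕ∞) : Subgroup (GLV q) :=
  G₀ q ⊓ MulAction.stabilizer (GLV q) (Vpos q) ⊓ MulAction.stabilizer (GLV q) (Vneg q)

/-! ### Generalized flags and flag manifolds -/

/-- Sets of quaternionic subspaces, among them the generalized flags. -/
abbrev Chain (q : ℕ∞) : Type := Set (Sub q)

/-- `F''` is the immediate successor of `F'` in `C`. -/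
def ImmSucc (C : Chain q) (F' F'' : Sub q) : Prop :=
  F' ∈ C ∧ F'' ∈ C ∧ F' < F'' ∧ ∀ F ∈ C, ¬ (F' < F ∧ F < F'')

/-- Generalized flags. -/
structure IsGenFlag (C : Chain q) : Prop where
  chain : IsChain (· ≤ ·) C
  adjacent : ∀ F ∈ C, (∃ F'', ImmSucc C F F'') ∨ ∃ F', ImmSucc C F' F
  cover : ∀ v : V q, v ≠ 0 → ∃ F' F'', ImmSucc C F' F'' ∧ v ∈ F'' ∧ v ∉ F'

/-- `B` is an `ℍ`-basis of `V q`. -/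
def IsBasis (B : Set (V q)) : Prop :=
  LinearIndepOn ℍ[ℝ] id B ∧ Submodule.span ℍ[ℝ] B = ⊤

/-- `C` is compatible with the basis `B`: every member of `C` is spanned by a subset of `B`.
(For a generalized flag this says that there is a strict weak order on `B` for which the pairs
of neighbours in `C` are the pairs of the span of the `β ≺ α` and the span of the `β` which
do not succeed `α`.) -/
def Compatible (B : Set (V q)) (C : Chain q) : Prop :=
  ∀ F ∈ C, Submodule.span ℍ[ℝ] (B ∩ (F : Set (V q))) = F

/-- `C` is weakly compatible with `L`: it is compatible with a basis which contains all but
finitely many of the elements of `L`. -/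
def WeaklyCompatible (C : Chain q) : Prop :=
  ∃ B : Set (V q), IsBasis B ∧ (Set.range (vec (q := q)) \ B).Finite ∧ Compatible B C

/-- `L`-commensurability. -/
def Commensurable (C C' : Chain q) : Prop :=
  WeaklyCompatible C ∧ WeaklyCompatible C' ∧
    ∃ (φ : C ≃ C') (U : Sub q), Module.Finite ℍ[ℝ] U ∧ ∀ F : C,
      (F : Sub q) ≤ (φ F : Sub q) ⊔ U ∧ (φ F : Sub q) ≤ (F : Sub q) ⊔ U ∧
        Module.finrank ℍ[ℝ] ((F : Sub q) ⊓ U : Sub q) =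
          Module.finrank ℍ[ℝ] ((φ F : Sub q) ⊓ U : Sub q)

/-- The quaternionic flag manifold of all generalized flags `L`-commensurable to `C`. -/
def flagManifold (C : Chain q) : Set (Chain q) := {C' | IsGenFlag C' ∧ Commensurable C C'}

/-! ### Smooth structures

A direct limit of finite dimensional manifolds is regarded as a diffeological space: its plots
are the maps from `ℝⁿ` which locally are smooth maps into one of the finite dimensional manifolds.
A map between such direct limits is smooth if it is smooth on the finite dimensional manifolds,
that is, if it maps plots to plots, and the direct limit topology is the D-topology. -/

/-- A family of elements of `G` is smooth on `w` if it takes its values in one of the finite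
dimensional Lie groups `SL(S; ℍ)` and has smooth matrix entries. -/
def SmoothFamily {n : ℕ} (γ : EuclideanSpace ℝ (Fin n) → GLV q)
    (w : Set (EuclideanSpace ℝ (Fin n))) : Prop :=
  ∃ S : Finset (Idx q), (∀ y ∈ w, γ y ∈ levelSL S) ∧
    ∀ i j, ContDiffOn ℝ ∞ (fun y => γ y (vec i) j) w

/-- For an action of `G` on `X`, the diffeology of `X` as the disjoint union of the homogeneous
spaces `G • x = G / Gₓ`: the plots are the maps which locally are of the form `y ↦ γ(y) • x` with
a smooth family `γ` in `G`. -/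
@[reducible]
def orbitDiffeology (q : ℕ∞) (X : Type*) [MulAction (GLV q) X] : DiffeologicalSpace X :=
  .ofCorePlotsOn
    { isPlotOn := fun {n u} _ p => ∀ y ∈ u, ∃ w, IsOpen w ∧ y ∈ w ∧ w ⊆ u ∧
        ∃ (γ : EuclideanSpace ℝ (Fin n) → GLV q) (x : X), SmoothFamily γ w ∧
          ∀ z ∈ w, p z = γ z • x
      isPlotOn_congr := by
        have key : ∀ {n : ℕ} {u : Set (EuclideanSpace ℝ (Fin n))}
            {p r : EuclideanSpace ℝ (Fin n) → X}, Set.EqOn p r u →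
            (∀ y ∈ u, ∃ w, IsOpen w ∧ y ∈ w ∧ w ⊆ u ∧
              ∃ (γ : EuclideanSpace ℝ (Fin n) → GLV q) (x : X), SmoothFamily γ w ∧
                ∀ z ∈ w, p z = γ z • x) →
            ∀ y ∈ u, ∃ w, IsOpen w ∧ y ∈ w ∧ w ⊆ u ∧
              ∃ (γ : EuclideanSpace ℝ (Fin n) → GLV q) (x : X), SmoothFamily γ w ∧
                ∀ z ∈ w, r z = γ z • x := by
          intro n u p r h hp y hy
          obtain ⟨w, hw, hyw, hwu, γ, x, hγ, hx⟩ := hp y hy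
          exact ⟨w, hw, hyw, hwu, γ, x, hγ, fun z hz => (h (hwu hz)).symm.trans (hx z hz)⟩
        intro n u _ p r h
        exact ⟨key h, key h.symm⟩
      isPlot_const := fun x y _ => ⟨Set.univ, isOpen_univ, trivial, le_rfl, fun _ => 1, x,
        ⟨∅, fun _ _ => one_mem _, fun _ _ => contDiffOn_const⟩, fun _ _ => (one_smul _ x).symm⟩
      isPlotOn_reparam := by
        intro n m u v hu hv p f h hp hf y hy
        obtain ⟨w, hw, hyw, hwu, γ, x, ⟨S, hS, hγ⟩, hx⟩ := hp (f y) (h hy)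
        refine ⟨v ∩ f ⁻¹' w, hf.continuousOn.isOpen_inter_preimage hv hw, ⟨hy, hyw⟩,
          Set.inter_subset_left, γ ∘ f, x, ⟨S, fun z hz => hS _ hz.2, fun i j => ?_⟩,
          fun z hz => hx _ hz.2⟩
        exact (hγ i j).comp (hf.mono Set.inter_subset_left) fun z hz => hz.2
      locality := by
        intro n u hu p hp y hy
        obtain ⟨v, hv, hyv, hpv⟩ := hp y hy
        obtain ⟨w, hw, hyw, hwv, γ, x, ⟨S, hS, hγ⟩, hx⟩ := hpv y hyv
        exact ⟨w ∩ u, hw.inter hu, ⟨hyw, hy⟩, Set.inter_subset_right, γ, x,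
          ⟨S, fun z hz => hS z hz.1, fun i j => (hγ i j).mono Set.inter_subset_left⟩,
          fun z hz => hx z hz.1⟩ }

/-- The subspace diffeology. -/
@[reducible]
def subDiffeology {X : Type*} (d : DiffeologicalSpace X) (s : Set X) : DiffeologicalSpace s where
  plots n := {p | Subtype.val ∘ p ∈ d.plots n}
  constant_plots x := d.constant_plots x.1
  plot_reparam hp hf := d.plot_reparam hp hf
  locality h := d.locality h

/-- The product diffeology. -/
@[reducible]
def prodDiffeology {X Y : Type*} (d : DiffeologicalSpace X) (d' : DiffeologicalSpace Y) :
    DiffeologicalSpace (X × Y) where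
  plots n := {p | Prod.fst ∘ p ∈ d.plots n ∧ Prod.snd ∘ p ∈ d'.plots n}
  constant_plots x := ⟨d.constant_plots x.1, d'.constant_plots x.2⟩
  plot_reparam hp hf := ⟨d.plot_reparam hp.1 hf, d'.plot_reparam hp.2 hf⟩
  locality h :=
    ⟨d.locality fun x => by
      obtain ⟨u, hu, hx, hp⟩ := h x
      exact ⟨u, hu, hx, fun h1 h2 => (hp h1 h2).1⟩,
    d'.locality fun x => by
      obtain ⟨u, hu, hx, hp⟩ := h x
      exact ⟨u, hu, hx, fun h1 h2 => (hp h1 h2).2⟩⟩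

/-- There is a diffeomorphism from `X` to `Y`. -/
def Diffeomorphic {X Y : Type*} (d : DiffeologicalSpace X) (d' : DiffeologicalSpace Y) : Prop :=
  ∃ e : X ≃ Y, Diffeology.DSmooth e ∧ Diffeology.DSmooth e.symm

/-! ### Bounded symmetric domains -/

/-- `W ∩ W'` has finite codimension in `W`. -/
def FiniteCodimIn (W W' : Sub q) : Prop :=
  ∃ U : Sub q, Module.Finite ℍ[ℝ] U ∧ W ≤ (W ⊓ W') ⊔ U

/-- The positive bounded symmetric domain `B⁺`: the maximal positive definite subspaces, weakly
compatible with `L`, whose intersection with `V₊` has finite codimension in both. -/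
def Bpos (q : ℕ∞) : Set (Sub q) :=
  {W | Maximal PosDef W ∧ FiniteCodimIn W (Vpos q) ∧ FiniteCodimIn (Vpos q) W ∧
    WeaklyCompatible {⊥, W, ⊤}}

/-- The negative bounded symmetric domain `B⁻`: the maximal negative definite subspaces, weakly
compatible with `L`, whose intersection with `V₋` has finite codimension in both. -/
def Bneg (q : ℕ∞) : Set (Sub q) :=
  {W | Maximal NegDef W ∧ FiniteCodimIn W (Vneg q) ∧ FiniteCodimIn (Vneg q) W ∧
    WeaklyCompatible {⊥, W, ⊤}}

/-- The smooth structure of `B⁺` as a subset of the homogeneous space `G • V₊ = G / P`. -/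
@[reducible]
def BposDiffeology (q : ℕ∞) : DiffeologicalSpace (Bpos q) :=
  subDiffeology (orbitDiffeology q (Sub q)) (Bpos q)

/-- The smooth structure of `B⁻` as a subset of the homogeneous space `G • V₋ = G / Pᵒᵖᵖ`. -/
@[reducible]
def BnegDiffeology (q : ℕ∞) : DiffeologicalSpace (Bneg q) :=
  subDiffeology (orbitDiffeology q (Sub q)) (Bneg q)

/-! ### Cycle spaces -/

/-- `D` is an open `G₀`-orbit in the flag manifold of `C`.  (The flag manifold is a single
`G`-orbit, so it is open in the disjoint union of all `G`-orbits.) -/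
def IsFlagDomain (C : Chain q) (D : Set (Chain q)) : Prop :=
  (∃ C₁ ∈ flagManifold C, D = MulAction.orbit (G₀ q) C₁) ∧
    @IsOpen (Chain q) (orbitDiffeology q (Chain q)).dTopology D

/-- `C` fits the decomposition `V = V₊ ⊕ V₋`. -/
def Splits (C : Chain q) : Prop := ∀ F ∈ C, F = (F ⊓ Vpos q) ⊔ (F ⊓ Vneg q)

/-- `Y` is the base cycle of `D`, the `K₀`-orbit of a member of `D` which fits the
decomposition `V = V₊ ⊕ V₋`. -/
def IsBaseCycle (D Y : Set (Chain q)) : Prop :=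
  ∃ C ∈ D, Splits C ∧ Y = MulAction.orbit (K₀ q) C

/-- The set of all `G`-translates of `Y` which are contained in `D`. -/
def translatesIn (D Y : Set (Chain q)) : Set (Set (Chain q)) :=
  {Z | (∃ g ∈ G q, Z = g • Y) ∧ Z ⊆ D}

/-- The cycle space of `D` with base cycle `Y`: the topological component of `Y` in the set of
all `G`-translates of `Y` contained in `D`, as a subset of `G • Y = G / G_Y`. -/
def cycleSpace (D Y : Set (Chain q)) : Set (Set (Chain q)) :=
  @connectedComponentIn (Set (Chain q)) (orbitDiffeology q (Set (Chain q))).dTopology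
    (translatesIn D Y) Y

/-- The smooth structure of the cycle space as a subset of the homogeneous space `G / G_Y`. -/
@[reducible]
def cycleSpaceDiffeology (D Y : Set (Chain q)) : DiffeologicalSpace (cycleSpace D Y) :=
  subDiffeology (orbitDiffeology q (Set (Chain q))) (cycleSpace D Y)

end QuatCycle

end

noncomputable section

namespace QuatCycle

variable {q : ℕ∞}

/-! ### The hermitian form -/

/-! The three candidates for the cycle space are diffeomorphic to each other, so it is enough to
show that the cycle space is one of them. A point of the domain of sign `ε` is the graph of a unique
finitely supported matrix `V_ε → V_{-ε}` (`matDomain_diffeomorphic`), and the matrices with definite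
graph form a star-shaped domain. Multiplying a matrix `Z` by `gauge Z`, which grows along rays and
explodes at the boundary, maps this domain diffeomorphically onto all finitely supported matrices
(`diffeomorphic_of_radialData`, `bs_diffeomorphic`). Transposition identifies the matrix positions
for the two signs. The set of positions is empty or countably infinite, hence in bijection with two
copies of itself, and so the product of the two domains is again diffeomorphic to either factor.

For the cycle space itself, every element of `G` moves only a finite dimensional coordinate space.
Consequently `g • F ≤ F` already gives equality (`smul_eq_of_le`), and an element of `G` which
preserves a chain preserves each member. Members of a flag in an open orbit are nondegenerate
(`nondeg_of_isOpen`), so Gram–Schmidt along the chain and Sylvester's law of inertia conjugate the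
flag by `G₀` to one spanned by basis vectors. This gives a base cycle, and any base cycle `Y` passes
through such a coordinate flag `C`.

If `g` keeps both summands definite, then `g • Y` stays in the orbit `D` (`smul_cycle_subset`).
These translates form a connected set. It is also relatively open and closed in the set of all
translates contained in `D`: if `g • Y` lies in `D` and `g • V_ε` is merely semidefinite, it is
definite, since otherwise some translate of a member of `C` would be degenerate (`def_of_semidef`).
This identifies the cycle space (`cycleSpace_eq`).

It remains to see how much of the pair `g • V_±` is recorded by `g • Y`. If some member of `C`
contains a basis vector of sign `ε` and omits one of sign `-ε` (`Sep ε C`), then `g • Y` determines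
`g • V_ε` (`smul_Vs_of_sep`). If there is no such member for the sign `-ε`, every member is
comparable with `V_ε`, and `g • Y` depends on `g • V_ε` alone (`smul_cycle_of_not_sep`). The
resulting bijections with one domain or with the product are smooth both ways because graph
coordinates depend smoothly on `g` (`exists_chart`, `exists_prod_chart`). -/

theorem sgn_eq_or (i : Idx q) : sgn i = 1 ∨ sgn i = -1 := by
  rcases i with i | i
  · exact Or.inl rfl
  · exact Or.inr rfl

theorem sgn_ne_zero (i : Idx q) : sgn i ≠ 0 := by
  rcases sgn_eq_or i with h | h <;> rw [h] <;> norm_num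

theorem herm_eq_sum {x : V q} {S : Finset (Idx q)} (hS : ∀ i ∉ S, x i = 0) (y : V q) :
    herm x y = ∑ i ∈ S, sgn i • (x i * star (y i)) := by
  unfold herm
  refine Finsupp.sum_of_support_subset x (fun i hi => ?_) _ (by simp)
  by_contra h
  exact Finsupp.mem_support_iff.1 hi (hS i h)

theorem herm_eq_sum' {y : V q} {S : Finset (Idx q)} (hS : ∀ i ∉ S, y i = 0) (x : V q) :
    herm x y = ∑ i ∈ S, sgn i • (x i * star (y i)) := by
  classical
  rw [herm_eq_sum (S := S ∪ x.support) (fun i hi => by simp at hi; exact hi.2)]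
  symm
  refine Finset.sum_subset Finset.subset_union_left fun i _ hi => ?_
  rw [hS i hi]; simp

theorem herm_add_left (x x' y : V q) : herm (x + x') y = herm x y + herm x' y := by
  unfold herm
  refine Finsupp.sum_add_index' (by simp) fun i a b => by rw [add_mul, smul_add]

theorem herm_smul_left (a : ℍ[ℝ]) (x y : V q) : herm (a • x) y = a * herm x y := by
  rw [herm_eq_sum (x := a • x) (S := x.support) (fun i hi => by simp at hi; simp [hi]),
    herm_eq_sum (x := x) (S := x.support) (fun i hi => by simpa using hi), Finset.mul_sum]
  refine Finset.sum_congr rfl fun i _ => ?_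
  simp [mul_assoc]

theorem star_herm (x y : V q) : star (herm x y) = herm y x := by
  classical
  rw [herm_eq_sum (x := x) (S := x.support) (fun i hi => by simpa using hi),
    herm_eq_sum' (y := x) (S := x.support) (fun i hi => by simpa using hi), star_sum]
  refine Finset.sum_congr rfl fun i _ => ?_
  simp

theorem herm_add_right (x y y' : V q) : herm x (y + y') = herm x y + herm x y' := by
  rw [← star_herm, herm_add_left, star_add, star_herm, star_herm]

theorem herm_smul_right (a : ℍ[ℝ]) (x y : V q) : herm x (a • y) = herm x y * star a := by
  rw [← star_herm, herm_smul_left, star_mul, star_herm]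

theorem herm_zero_left (y : V q) : herm 0 y = 0 := by simp [herm]

theorem herm_zero_right (x : V q) : herm x 0 = 0 := by simp [herm]

theorem herm_neg_left (x y : V q) : herm (-x) y = -herm x y := by
  rw [← neg_one_smul ℍ[ℝ] x, herm_smul_left]; simp

theorem herm_neg_right (x y : V q) : herm x (-y) = -herm x y := by
  rw [← star_herm, herm_neg_left, star_neg, star_herm]

theorem herm_sub_left (x x' y : V q) : herm (x - x') y = herm x y - herm x' y := by
  rw [sub_eq_add_neg, herm_add_left, herm_neg_left, sub_eq_add_neg]

theorem herm_sub_right (x y y' : V q) : herm x (y - y') = herm x y - herm x y' := by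
  rw [sub_eq_add_neg, herm_add_right, herm_neg_right, sub_eq_add_neg]

theorem herm_sum_left {α : Type*} (s : Finset α) (f : α → V q) (y : V q) :
    herm (∑ a ∈ s, f a) y = ∑ a ∈ s, herm (f a) y := by
  classical
  induction s using Finset.induction_on with
  | empty => simp [herm_zero_left]
  | insert a s ha ih => rw [Finset.sum_insert ha, Finset.sum_insert ha, herm_add_left, ih]

theorem herm_sum_right {α : Type*} (s : Finset α) (f : α → V q) (x : V q) :
    herm x (∑ a ∈ s, f a) = ∑ a ∈ s, herm x (f a) := by
  classical
  induction s using Finset.induction_on with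
  | empty => simp [herm_zero_right]
  | insert a s ha ih => rw [Finset.sum_insert ha, Finset.sum_insert ha, herm_add_right, ih]

theorem herm_vec_right (x : V q) (i : Idx q) : herm x (vec i) = sgn i • x i := by
  classical
  rw [herm_eq_sum' (S := {i}) (fun j hj => ?_)]
  · simp [vec]
  · simp at hj; simp [vec, Ne.symm hj]

theorem herm_vec_left (x : V q) (i : Idx q) : herm (vec i) x = sgn i • star (x i) := by
  rw [← star_herm, herm_vec_right]; simp

theorem vec_apply_self (i : Idx q) : vec i i = 1 := by simp [vec]

theorem vec_apply_ne {i j : Idx q} (h : i ≠ j) : vec i j = 0 := by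
  simp [vec, h]

theorem vec_ne_zero (i : Idx q) : (vec i : V q) ≠ 0 := by simp [vec]

theorem herm_self (x : V q) : herm x x = ((herm x x).re : ℍ[ℝ]) :=
  (Quaternion.star_eq_self.1 (star_herm x x))

theorem herm_re_comm (x y : V q) : (herm x y).re = (herm y x).re := by
  rw [← star_herm]; simp

theorem eq_zero_of_herm {x : V q} (h : ∀ i, herm x (vec i) = 0) : x = 0 := by
  ext1 i
  have := h i
  rw [herm_vec_right] at this
  simpa [sgn_ne_zero] using this

theorem mul_star_self_re (a : ℍ[ℝ]) : (a * star a).re = Quaternion.normSq a := rfl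

theorem herm_self_re_sum {x : V q} {S : Finset (Idx q)} (hS : ∀ i ∉ S, x i = 0) :
    (herm x x).re = ∑ i ∈ S, sgn i * Quaternion.normSq (x i) := by
  rw [herm_eq_sum hS]
  have : ∀ s : Finset (Idx q), (∑ i ∈ s, sgn i • (x i * star (x i))).re =
      ∑ i ∈ s, sgn i * Quaternion.normSq (x i) := by
    classical
    intro s
    induction s using Finset.induction_on with
    | empty => simp
    | insert a s ha ih =>
      rw [Finset.sum_insert ha, Finset.sum_insert ha, Quaternion.re_add, ih, Quaternion.re_smul]
      rfl
  exact this S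

/-- If `Re (a * c) = 0` for all `c`, then `a = 0`. -/
theorem eq_zero_of_re_mul {a : ℍ[ℝ]} (h : ∀ c, (a * c).re = 0) : a = 0 := by
  have := h (star a)
  rw [mul_star_self_re] at this
  exact Quaternion.normSq_eq_zero.1 this

theorem herm_add_self_re (x y : V q) :
    (herm (x + y) (x + y)).re = (herm x x).re + 2 * (herm x y).re + (herm y y).re := by
  rw [herm_add_left, herm_add_right, herm_add_right]
  simp only [Quaternion.re_add]
  rw [herm_re_comm y x]; ring

theorem herm_smul_smul_re (a : ℍ[ℝ]) (x : V q) :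
    (herm (a • x) (a • x)).re = Quaternion.normSq a * (herm x x).re := by
  rw [herm_smul_left, herm_smul_right, ← mul_assoc]
  generalize hr : (herm x x).re = r
  have : herm x x = (r : ℍ[ℝ]) := by rw [herm_self x, hr]
  rw [this, ← Quaternion.coe_commutes, mul_assoc, Quaternion.self_mul_star, ← Quaternion.coe_mul,
    Quaternion.re_coe, mul_comm]

/-! ### The two summands -/

/-- The span of the basis vectors of sign `ε`. -/
def Vs (q : ℕ∞) (ε : ℝ) : Sub q := Finsupp.supported ℍ[ℝ] ℍ[ℝ] {i | sgn i = ε}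

theorem mem_Vs {ε : ℝ} {x : V q} : x ∈ Vs q ε ↔ ∀ i, sgn i ≠ ε → x i = 0 := by
  simp [Vs, Finsupp.mem_supported']

theorem vec_mem_Vs {ε : ℝ} {i : Idx q} (h : sgn i = ε) : vec i ∈ Vs q ε := by
  rw [mem_Vs]
  intro j hj
  exact vec_apply_ne (by rintro rfl; exact hj h)

theorem Vpos_eq : Vpos q = Vs q 1 := by
  unfold Vpos Vs
  rw [Finsupp.supported_eq_span_single]
  congr 1
  ext x
  constructor
  · rintro ⟨k, rfl⟩
    exact ⟨Sum.inl k, rfl, rfl⟩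
  · rintro ⟨i | i, hi, rfl⟩
    · exact ⟨i, rfl⟩
    · simp [sgn] at hi; norm_num at hi

theorem Vneg_eq : Vneg q = Vs q (-1) := by
  unfold Vneg Vs
  rw [Finsupp.supported_eq_span_single]
  congr 1
  ext x
  constructor
  · rintro ⟨k, rfl⟩
    exact ⟨Sum.inr k, rfl, rfl⟩
  · rintro ⟨i | i, hi, rfl⟩
    · simp [sgn] at hi; norm_num at hi
    · exact ⟨i, rfl⟩

/-- The projection to the span of the basis vectors of sign `ε`. -/
def pr (q : ℕ∞) (ε : ℝ) : V q →ₗ[ℍ[ℝ]] V q where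
  toFun x := x.filter fun i => sgn i = ε
  map_add' _ _ := Finsupp.filter_add
  map_smul' _ _ := Finsupp.filter_smul

theorem pr_apply (ε : ℝ) (x : V q) (i : Idx q) [Decidable (sgn i = ε)] :
    pr q ε x i = if sgn i = ε then x i else 0 := by
  classical
  change x.filter (fun i => sgn i = ε) i = _
  rw [Finsupp.filter_apply]
  congr

theorem pr_mem (ε : ℝ) (x : V q) : pr q ε x ∈ Vs q ε := by
  classical
  rw [mem_Vs]; intro i hi; rw [pr_apply, if_neg hi]

theorem pr_of_mem {ε : ℝ} {x : V q} (h : x ∈ Vs q ε) : pr q ε x = x := by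
  classical
  ext1 i
  rw [pr_apply]
  split_ifs with hi
  · rfl
  · exact (mem_Vs.1 h i hi).symm

/-- `ε` is a sign. -/
def IsSign (ε : ℝ) : Prop := ε = 1 ∨ ε = -1

theorem isSign_one : IsSign 1 := Or.inl rfl
theorem isSign_neg_one : IsSign (-1) := Or.inr rfl

theorem IsSign.neg {ε : ℝ} (h : IsSign ε) : IsSign (-ε) := by
  rcases h with rfl | rfl
  · exact Or.inr rfl
  · exact Or.inl (by norm_num)

theorem IsSign.mul_self {ε : ℝ} (h : IsSign ε) : ε * ε = 1 := by
  rcases h with rfl | rfl <;> norm_num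

theorem IsSign.ne_neg {ε : ℝ} (h : IsSign ε) : ε ≠ -ε := by
  rcases h with rfl | rfl <;> norm_num

theorem IsSign.sgn_or {ε : ℝ} (h : IsSign ε) (i : Idx q) : sgn i = ε ∨ sgn i = -ε := by
  rcases h with rfl | rfl
  · exact sgn_eq_or i
  · rw [neg_neg]; exact (sgn_eq_or i).symm

theorem IsSign.sgn_ne_iff {ε : ℝ} (h : IsSign ε) (i : Idx q) : sgn i ≠ ε ↔ sgn i = -ε := by
  constructor
  · exact fun h' => (h.sgn_or i).resolve_left h'
  · intro h' h''; exact h.ne_neg (h''.symm.trans h')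

theorem pr_add_pr {ε : ℝ} (h : IsSign ε) (x : V q) : pr q ε x + pr q (-ε) x = x := by
  classical
  ext1 i
  rw [Finsupp.add_apply, pr_apply, pr_apply]
  rcases h.sgn_or i with hi | hi
  · rw [if_pos hi, if_neg (by rw [hi]; exact h.ne_neg), add_zero]
  · rw [if_pos hi, if_neg (by rw [hi]; exact h.ne_neg.symm), zero_add]

theorem herm_Vs_Vs {ε : ℝ} (h : IsSign ε) {x y : V q} (hx : x ∈ Vs q ε) (hy : y ∈ Vs q (-ε)) :
    herm x y = 0 := by
  rw [herm_eq_sum (S := x.support) (fun i hi => by simpa using hi)]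
  refine Finset.sum_eq_zero fun i _ => ?_
  rcases h.sgn_or i with hi | hi
  · rw [mem_Vs.1 hy i (by rw [hi]; exact h.ne_neg)]; simp
  · rw [mem_Vs.1 hx i (by rw [hi]; exact h.ne_neg.symm)]; simp

theorem Vs_inf {ε : ℝ} (h : IsSign ε) {x : V q} (hx : x ∈ Vs q ε) (hy : x ∈ Vs q (-ε)) : x = 0 := by
  ext1 i
  rcases h.sgn_or i with hi | hi
  · exact mem_Vs.1 hy i (by rw [hi]; exact h.ne_neg)
  · exact mem_Vs.1 hx i (by rw [hi]; exact h.ne_neg.symm)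

theorem pr_neg_of_mem {ε : ℝ} (h : IsSign ε) {x : V q} (hx : x ∈ Vs q ε) : pr q (-ε) x = 0 := by
  have := pr_add_pr h x
  rw [pr_of_mem hx] at this
  simpa using this

/-- `W` is definite of sign `ε`. -/
def Def (ε : ℝ) (W : Sub q) : Prop := ∀ x ∈ W, x ≠ 0 → 0 < ε * (herm x x).re

theorem def_one {W : Sub q} : Def 1 W ↔ PosDef W := by simp [Def, PosDef]

theorem def_neg_one {W : Sub q} : Def (-1) W ↔ NegDef W := by simp [Def, NegDef]

theorem def_Vs {ε : ℝ} (h : IsSign ε) : Def ε (Vs q ε) := by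
  intro x hx hx0
  rw [herm_self_re_sum (S := x.support) (fun i hi => by simpa using hi), Finset.mul_sum]
  refine Finset.sum_pos (fun i hi => ?_) (by simpa [Finsupp.support_nonempty_iff] using hx0)
  have hxi : x i ≠ 0 := by simpa using hi
  have hi : sgn i = ε := by by_contra h'; exact hxi (mem_Vs.1 hx i h')
  rw [hi, ← mul_assoc, h.mul_self, one_mul]
  exact lt_of_le_of_ne Quaternion.normSq_nonneg (Ne.symm (by simpa using hxi))

theorem Def.nonneg {ε : ℝ} {W : Sub q} (h : Def ε W) {x : V q} (hx : x ∈ W) :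
    0 ≤ ε * (herm x x).re := by
  by_cases h0 : x = 0
  · rw [h0, herm_zero_left]; simp
  · exact (h x hx h0).le

theorem Def.eq_zero {ε : ℝ} {W : Sub q} (h : Def ε W) {x : V q} (hx : x ∈ W)
    (h' : ε * (herm x x).re ≤ 0) : x = 0 := by
  by_contra h0
  exact absurd (h x hx h0) (not_lt.2 h')

/-! ### Endomorphisms at a finite level -/

/-- `T` fixes the basis vectors outside `S` and preserves the span of `S`. -/
def AtLevel (S : Finset (Idx q)) (T : V q →ₗ[ℍ[ℝ]] V q) : Prop :=
  (∀ i ∉ S, T (vec i) = vec i) ∧ ∀ x ∈ spanOf S, T x ∈ spanOf S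

/-- Two linear maps agreeing on basis vectors agree. -/
theorem lin_ext {T T' : V q →ₗ[ℍ[ℝ]] V q} (h : ∀ i, T (vec i) = T' (vec i)) : T = T' := by
  refine Finsupp.lhom_ext fun i a => ?_
  have : (Finsupp.single i a : V q) = a • vec i := by simp [vec]
  rw [this, map_smul, map_smul, h]

theorem vec_mem_spanOf {S : Finset (Idx q)} {i : Idx q} (h : i ∈ S) : vec i ∈ spanOf S :=
  mem_spanOf.2 fun j hj => vec_apply_ne (by rintro rfl; exact hj h)

theorem spanOf_mono {S T : Finset (Idx q)} (h : S ⊆ T) : spanOf S ≤ spanOf T :=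
  fun _ hx => mem_spanOf.2 fun i hi => mem_spanOf.1 hx i fun h' => hi (h h')

theorem eq_sum_vec {S : Finset (Idx q)} {x : V q} (hx : ∀ i ∉ S, x i = 0) :
    x = ∑ i ∈ S, x i • vec i := by
  classical
  ext1 j
  rw [Finsupp.finsetSum_apply]
  by_cases hj : j ∈ S
  · rw [Finset.sum_eq_single j]
    · simp [vec_apply_self]
    · intro i _ hij; simp [vec_apply_ne hij]
    · exact fun h => absurd hj h
  · rw [hx j hj, Finset.sum_eq_zero]
    intro i hi
    rw [Finsupp.smul_apply, vec_apply_ne (by rintro rfl; exact hj hi), smul_zero]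

/-- The part of `x` in the span of `S`. -/
def res (S : Finset (Idx q)) (x : V q) : V q := ∑ i ∈ S, x i • vec i

theorem res_apply [DecidableEq (Idx q)] (S : Finset (Idx q)) (x : V q) (i : Idx q) :
    res S x i = if i ∈ S then x i else 0 := by
  unfold res
  rw [Finsupp.finsetSum_apply]
  split_ifs with h
  · rw [Finset.sum_eq_single i]
    · simp [vec_apply_self]
    · intro j _ hij; simp [vec_apply_ne hij]
    · exact fun h' => absurd h h'
  · refine Finset.sum_eq_zero fun j hj => ?_
    rw [Finsupp.smul_apply, vec_apply_ne (by rintro rfl; exact h hj), smul_zero]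

theorem res_mem (S : Finset (Idx q)) (x : V q) : res S x ∈ spanOf S := by
  classical
  exact mem_spanOf.2 fun i hi => by rw [res_apply, if_neg hi]

theorem sub_res_apply {S : Finset (Idx q)} (x : V q) {i : Idx q} (hi : i ∈ S) :
    (x - res S x) i = 0 := by
  classical
  rw [Finsupp.sub_apply, res_apply, if_pos hi, sub_self]

theorem apply_of_disjoint {S : Finset (Idx q)} {T : V q →ₗ[ℍ[ℝ]] V q}
    (hT : ∀ i ∉ S, T (vec i) = vec i) {x : V q} (hx : ∀ i ∈ S, x i = 0) : T x = x := by
  conv_lhs => rw [eq_sum_vec (S := x.support) (x := x) (fun i hi => by simpa using hi)]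
  conv_rhs => rw [eq_sum_vec (S := x.support) (x := x) (fun i hi => by simpa using hi)]
  rw [map_sum]
  refine Finset.sum_congr rfl fun i hi => ?_
  rw [map_smul, hT i]
  intro hS
  exact (Finsupp.mem_support_iff.1 hi) (hx i hS)

namespace AtLevel
variable {S S' : Finset (Idx q)} {T T' : V q →ₗ[ℍ[ℝ]] V q}

theorem apply_eq (h : AtLevel S T) (x : V q) : T x = T (res S x) + (x - res S x) := by
  conv_lhs => rw [← add_sub_cancel (res S x) x]
  rw [map_add, apply_of_disjoint h.1 fun i hi => sub_res_apply x hi]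

theorem apply_coord (h : AtLevel S T) (x : V q) {i : Idx q} (hi : i ∉ S) : T x i = x i := by
  rw [h.apply_eq x, Finsupp.add_apply, Finsupp.sub_apply,
    mem_spanOf.1 (h.2 _ (res_mem S x)) i hi, mem_spanOf.1 (res_mem S x) i hi]
  simp

theorem sub_mem (h : AtLevel S T) (x : V q) : T x - x ∈ spanOf S :=
  mem_spanOf.2 fun i hi => by rw [Finsupp.sub_apply, h.apply_coord x hi, sub_self]

theorem mono (h : AtLevel S T) (hS : S ⊆ S') : AtLevel S' T := by
  refine ⟨fun i hi => h.1 i fun h' => hi (hS h'), fun x hx => ?_⟩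
  have := add_mem hx (spanOf_mono hS (h.sub_mem x))
  rwa [add_sub_cancel] at this

theorem of_vec (h : ∀ i ∉ S, T (vec i) = vec i) (h' : ∀ i ∈ S, T (vec i) ∈ spanOf S) :
    AtLevel S T := by
  refine ⟨h, fun x hx => ?_⟩
  rw [eq_sum_vec (S := S) (mem_spanOf.1 hx), map_sum]
  exact sum_mem fun i hi => by rw [map_smul]; exact Submodule.smul_mem _ _ (h' i hi)

end AtLevel

instance finite_spanOf (S : Finset (Idx q)) : Module.Finite ℍ[ℝ] (spanOf S) :=
  Module.Finite.equiv (Finsupp.supportedEquivFinsupp (R := ℍ[ℝ]) (M := ℍ[ℝ]) (S : Set (Idx q))).symm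

theorem finrank_spanOf (S : Finset (Idx q)) : Module.finrank ℍ[ℝ] (spanOf S) = S.card := by
  refine (LinearEquiv.finrank_eq
    (Finsupp.supportedEquivFinsupp (R := ℍ[ℝ]) (M := ℍ[ℝ]) (S : Set (Idx q)))).trans ?_
  rw [Module.finrank_finsupp_self]
  simp

instance finite_real_spanOf (S : Finset (Idx q)) : Module.Finite ℝ (spanOf S) :=
  Module.Finite.trans (R := ℝ) ℍ[ℝ] (spanOf S)

theorem exists_preimage_of_injOn {K M : Type*} [DivisionRing K] [AddCommGroup M] [Module K M]
    (W : Submodule K M) [Module.Finite K W] (T : M →ₗ[K] M) (h : ∀ x ∈ W, T x ∈ W)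
    (hi : ∀ x ∈ W, T x = 0 → x = 0) {y : M} (hy : y ∈ W) : ∃ x ∈ W, T x = y := by
  have hinj : Function.Injective (T.restrict h) := by
    rw [injective_iff_map_eq_zero]
    rintro ⟨x, hx⟩ h0
    exact Subtype.ext (hi x hx (congrArg Subtype.val h0))
  obtain ⟨⟨x, hx⟩, hxy⟩ := LinearMap.surjective_of_injective hinj ⟨y, hy⟩
  exact ⟨x, hx, congrArg Subtype.val hxy⟩

/-- `-N` is nilpotent, so its characteristic polynomial is a power of `X`; the determinant of `1 +
N` is the value of that polynomial at `1`. -/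
theorem det_one_add_of_sq_zero {M : Type*} [AddCommGroup M] [Module ℝ M] [Module.Finite ℝ M]
    (N T : M →ₗ[ℝ] M) (hT : ∀ x, T x = x + N x) (hN : ∀ x, N (N x) = 0) : LinearMap.det T = 1 := by
  have hM : IsNilpotent (-N : Module.End ℝ M) := ⟨2, by
    rw [neg_sq, sq]
    exact LinearMap.ext hN⟩
  have h1 := hM.charpoly_eq_X_pow_finrank
  have h2 : LinearMap.det (algebraMap ℝ (Module.End ℝ M) 1 - (-N)) = (-N).charpoly.eval 1 := by
    rw [LinearMap.eval_charpoly]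
  rw [h1] at h2
  have h3 : T = algebraMap ℝ (Module.End ℝ M) 1 - (-N) := by
    refine LinearMap.ext fun x => ?_
    simp [hT]
  rw [h3, h2]; simp

/-- An injective endomorphism at a finite level is bijective. -/
theorem AtLevel.bijective {S : Finset (Idx q)} {T : V q →ₗ[ℍ[ℝ]] V q} (h : AtLevel S T)
    (hi : ∀ x ∈ spanOf S, T x = 0 → x = 0) : Function.Bijective T := by
  constructor
  · rw [injective_iff_map_eq_zero]
    intro x hx
    refine hi x (mem_spanOf.2 fun i hi' => ?_) hx
    rw [← h.apply_coord x hi', hx]; rfl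
  · intro y
    obtain ⟨x, hx, h1⟩ := exists_preimage_of_injOn (spanOf S) T h.2 hi (res_mem S y)
    refine ⟨x + (y - res S y), ?_⟩
    rw [map_add, apply_of_disjoint h.1 fun i hi' => sub_res_apply y hi', h1, add_sub_cancel]

theorem levelSL_atLevel {S : Finset (Idx q)} {g : GLV q} (h : g ∈ levelSL S) :
    AtLevel S (g : V q →ₗ[ℍ[ℝ]] V q) := ⟨h.1, fun x hx => (h.2.choose x).2 hx⟩

theorem atLevel_iff {S : Finset (Idx q)} {g : GLV q} (h : AtLevel S (g : V q →ₗ[ℍ[ℝ]] V q)) (x : V q) :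
    g x ∈ spanOf S ↔ x ∈ spanOf S := by
  have h1 : g x - x ∈ spanOf S := h.sub_mem x
  constructor
  · intro h2
    have := sub_mem h2 h1
    rwa [sub_sub_cancel] at this
  · exact h.2 x

theorem atLevel_inv {S : Finset (Idx q)} {g : GLV q} (h : AtLevel S (g : V q →ₗ[ℍ[ℝ]] V q)) :
    AtLevel S ((g⁻¹ : GLV q) : V q →ₗ[ℍ[ℝ]] V q) := by
  have hi : ∀ x, g (g⁻¹ x) = x := fun x => g.apply_symm_apply x
  refine ⟨fun i hi' => ?_, fun x hx => ?_⟩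
  · apply g.injective
    change g (g⁻¹ (vec i)) = g (vec i)
    rw [hi]; exact (h.1 i hi').symm
  · refine (atLevel_iff h _).1 ?_
    change g (g⁻¹ x) ∈ _
    rwa [hi]

/-! ### Members of `SL` -/

theorem mem_levelSL_of_sq_zero {S : Finset (Idx q)} {g : GLV q} (N : V q →ₗ[ℍ[ℝ]] V q)
    (hg : ∀ x, g x = x + N x) (hN : ∀ x, N (N x) = 0) (h : AtLevel S (g : V q →ₗ[ℍ[ℝ]] V q)) :
    g ∈ levelSL S := by
  refine ⟨h.1, atLevel_iff h, ?_⟩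
  have hNS : ∀ x ∈ spanOf S, N x ∈ spanOf S := fun x hx => by
    have := h.sub_mem x
    change g x - x ∈ _ at this
    rwa [hg, add_sub_cancel_left] at this
  have h1 : ∀ x : spanOf S, realRestrict S g (atLevel_iff h) x =
      x + LinearMap.restrictScalars ℝ (N.restrict hNS) x := fun x => Subtype.ext (hg x)
  have h2 : ∀ x : spanOf S, LinearMap.restrictScalars ℝ (N.restrict hNS)
      (LinearMap.restrictScalars ℝ (N.restrict hNS) x) = 0 := fun x => Subtype.ext (hN x)
  exact det_one_add_of_sq_zero (M := spanOf S) _ _ h1 h2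

/-- Restricting scalars to `ℂ ⊂ ℍ` makes `T` complex linear, and the real determinant of a
complex-linear map is the squared modulus of its complex determinant. -/
theorem det_nonneg_of_quaternionic {M : Type*} [AddCommGroup M] [Module ℍ[ℝ] M] [Module ℝ M]
    [IsScalarTower ℝ ℍ[ℝ] M] [Module.Finite ℝ M] (T : M →ₗ[ℝ] M)
    (hT : ∀ (a : ℍ[ℝ]) x, T (a • x) = a • T x) : 0 ≤ LinearMap.det T := by
  let _ : Module ℂ M := Module.compHom M Quaternion.ofComplex.toRingHom
  have hs : ∀ (z : ℂ) (x : M), z • x = (Quaternion.ofComplex z) • x := fun _ _ => rfl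
  have : IsScalarTower ℝ ℂ M := ⟨fun r z x => by
    rw [hs, hs, map_smul, smul_assoc]⟩
  have : Module.Finite ℂ M := Module.Finite.of_restrictScalars_finite ℝ ℂ M
  let T' : M →ₗ[ℂ] M :=
    { toFun := T
      map_add' := T.map_add
      map_smul' := fun z x => by simp only [hs, hT, RingHom.id_apply] }
  have h1 : T = LinearMap.restrictScalars ℝ T' := rfl
  rw [h1, LinearMap.det_restrictScalars, Algebra.norm_complex_eq]
  exact Complex.normSq_nonneg _

/-- The Gram matrix of `B` is unchanged by `T`; comparing determinants and cancelling that of the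
Gram matrix leaves the square of `det T`. -/
theorem det_sq_of_isometry {M : Type*} [AddCommGroup M] [Module ℝ M] [Module.Finite ℝ M]
    (B : LinearMap.BilinForm ℝ M) (hB : ∀ x, (∀ y, B x y = 0) → x = 0)
    (hs : ∀ x y, B x y = B y x) (T : M →ₗ[ℝ] M)
    (hT : ∀ x y, B (T x) (T y) = B x y) : LinearMap.det T * LinearMap.det T = 1 := by
  classical
  let b := Module.finBasis ℝ M
  have h1 : B.comp T T = B := by ext x y; exact hT x y
  have h2 := congrArg Matrix.det (LinearMap.BilinForm.toMatrix_comp b b B T T)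
  rw [h1, Matrix.det_mul, Matrix.det_mul, Matrix.det_transpose, LinearMap.det_toMatrix] at h2
  have h3 : (LinearMap.BilinForm.toMatrix b B).det ≠ 0 := by
    rw [← LinearMap.BilinForm.nondegenerate_iff_det_ne_zero]
    exact ⟨hB, fun y h => hB y fun x => by rw [hs]; exact h x⟩
  have h4 : (LinearMap.BilinForm.toMatrix b B).det * (LinearMap.det T * LinearMap.det T - 1) = 0 := by
    linear_combination -h2
  rcases mul_eq_zero.1 h4 with h | h
  · exact absurd h h3
  · linarith

/-- The real part of the hermitian form, restricted to a real subspace. -/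
def reHerm (S : Finset (Idx q)) : LinearMap.BilinForm ℝ (spanOf S) :=
  LinearMap.mk₂ ℝ (fun x y => (herm x.1 y.1).re)
    (fun x x' y => by
      change (herm (x.1 + x'.1) y.1).re = _
      rw [herm_add_left]; rfl)
    (fun c x y => by
      have : ((c • x : spanOf S) : V q) = (c : ℍ[ℝ]) • x.1 := by
        ext1 i; exact (Quaternion.coe_mul_eq_smul _ _).symm
      rw [this, herm_smul_left, Quaternion.coe_mul_eq_smul]; rfl)
    (fun x y y' => by
      change (herm x.1 (y.1 + y'.1)).re = _
      rw [herm_add_right]; rfl)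
    (fun c x y => by
      have : ((c • y : spanOf S) : V q) = (c : ℍ[ℝ]) • y.1 := by
        ext1 i; exact (Quaternion.coe_mul_eq_smul _ _).symm
      rw [this, herm_smul_right, Quaternion.star_coe, ← Quaternion.coe_commutes,
        Quaternion.coe_mul_eq_smul]; rfl)

/-- The condition on the reduced norm is automatic for isometries: the real determinant is
nonnegative by quaternionic linearity and squares to `1` by invariance of the real part of the form.
-/
theorem isometry_mem_G₀ {S : Finset (Idx q)} {g : GLV q} (h : AtLevel S (g : V q →ₗ[ℍ[ℝ]] V q))
    (hg : ∀ x y, herm (g x) (g y) = herm x y) : g ∈ G₀ q := by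
  refine ⟨⟨S, h.1, atLevel_iff h, ?_⟩, hg⟩
  have h1 : 0 ≤ LinearMap.det (A := ℝ) (M := spanOf S) (realRestrict S g (atLevel_iff h)) :=
    det_nonneg_of_quaternionic (M := spanOf S) _ fun a x => Subtype.ext (map_smul g a x.1)
  have h2 : LinearMap.det (A := ℝ) (M := spanOf S) (realRestrict S g (atLevel_iff h)) *
      LinearMap.det (A := ℝ) (M := spanOf S) (realRestrict S g (atLevel_iff h)) = 1 := by
    refine det_sq_of_isometry (M := spanOf S) (reHerm S) (fun x hx => ?_)
      (fun x y => herm_re_comm x.1 y.1) _ fun x y => ?_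
    · refine Subtype.ext (eq_zero_of_herm fun i => ?_)
      by_cases hi : i ∈ S
      · refine eq_zero_of_re_mul fun c => ?_
        have := hx ⟨star c • vec i, Submodule.smul_mem _ _ (vec_mem_spanOf hi)⟩
        change (herm x.1 (star c • vec i)).re = 0 at this
        rwa [herm_smul_right, star_star] at this
      · rw [herm_vec_right, mem_spanOf.1 x.2 i hi, smul_zero]
    · change (herm (g x.1) (g y.1)).re = (herm x.1 y.1).re
      rw [hg]
  nlinarith

/-! ### Actions on subspaces and chains -/

theorem mem_smul_iff {g : GLV q} {F : Sub q} {x : V q} : x ∈ g • F ↔ g⁻¹ x ∈ F := by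
  have hi : ∀ x, g (g⁻¹ x) = x := fun x => g.apply_symm_apply x
  have hi' : ∀ x, g⁻¹ (g x) = x := fun x => g.symm_apply_apply x
  rw [Submodule.mem_smul_pointwise_iff_exists]
  constructor
  · rintro ⟨y, hy, rfl⟩
    change g⁻¹ (g y) ∈ F
    rwa [hi']
  · intro h
    exact ⟨_, h, hi x⟩

theorem inv_apply_self (g : GLV q) (x : V q) : g⁻¹ (g x) = x := g.symm_apply_apply x
theorem apply_inv_self (g : GLV q) (x : V q) : g (g⁻¹ x) = x := g.apply_symm_apply x

theorem apply_mem_smul {g : GLV q} {F : Sub q} {x : V q} : g x ∈ g • F ↔ x ∈ F := by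
  rw [mem_smul_iff, inv_apply_self]

theorem smul_le_smul_iff' {g : GLV q} {F F' : Sub q} : g • F ≤ g • F' ↔ F ≤ F' := by
  constructor
  · intro h x hx
    exact apply_mem_smul.1 (h (apply_mem_smul.2 hx))
  · intro h x hx
    rw [mem_smul_iff] at hx ⊢
    exact h hx

theorem smul_top' (g : GLV q) : g • (⊤ : Sub q) = ⊤ :=
  top_le_iff.1 fun _ _ => mem_smul_iff.2 trivial

theorem smul_bot' (g : GLV q) : g • (⊥ : Sub q) = ⊥ := by
  ext x
  rw [mem_smul_iff, Submodule.mem_bot, Submodule.mem_bot]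
  exact g⁻¹.map_eq_zero_iff

/-- Reduces the equality of infinite dimensional subspaces to a comparison inside the finite
dimensional span of `S`. -/
theorem eq_of_le_of_level {S : Finset (Idx q)} {F F' : Sub q} (h : F ≤ F')
    (h' : F' ⊓ spanOf S ≤ F) (hS : ∀ x ∈ F', ∃ y ∈ F, x - y ∈ spanOf S) : F = F' := by
  refine le_antisymm h fun x hx => ?_
  obtain ⟨y, hy, hxy⟩ := hS x hx
  have := add_mem (h' ⟨sub_mem hx (h hy), hxy⟩) hy
  rwa [sub_add_cancel] at this

theorem eq_of_le_of_finrank {K M : Type*} [DivisionRing K] [AddCommGroup M] [Module K M]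
    (A B : Submodule K M) [Module.Finite K B] (h : A ≤ B)
    (h' : Module.finrank K B ≤ Module.finrank K A) : A = B :=
  Submodule.eq_of_le_of_finrank_le h h'

theorem finite_of_le {K M : Type*} [DivisionRing K] [AddCommGroup M] [Module K M]
    (A B : Submodule K M) [Module.Finite K B] (h : A ≤ B) : Module.Finite K A :=
  Submodule.finiteDimensional_of_le h

theorem finrank_map_eq' {K M : Type*} [DivisionRing K] [AddCommGroup M] [Module K M]
    (e : M ≃ₗ[K] M) (A : Submodule K M) :
    Module.finrank K (A.map (e : M →ₗ[K] M)) = Module.finrank K A :=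
  LinearEquiv.finrank_map_eq e A

instance finite_inf_spanOf (F : Sub q) (S : Finset (Idx q)) :
    Module.Finite ℍ[ℝ] (F ⊓ spanOf S : Sub q) := finite_of_le _ (spanOf S) inf_le_right

theorem smul_inf_spanOf {S : Finset (Idx q)} {g : GLV q} (h : AtLevel S (g : V q →ₗ[ℍ[ℝ]] V q))
    (F : Sub q) : g • F ⊓ spanOf S = (F ⊓ spanOf S).map (g : V q →ₗ[ℍ[ℝ]] V q) := by
  ext x
  rw [Submodule.mem_inf, mem_smul_iff, Submodule.mem_map]
  constructor
  · rintro ⟨h1, h2⟩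
    refine ⟨g⁻¹ x, ⟨h1, (atLevel_iff h _).1 ?_⟩, apply_inv_self g x⟩
    rwa [apply_inv_self]
  · rintro ⟨y, ⟨h1, h2⟩, rfl⟩
    refine ⟨?_, h.2 _ h2⟩
    change g⁻¹ (g y) ∈ F
    rwa [inv_apply_self]

theorem finrank_smul_inf {S : Finset (Idx q)} {g : GLV q} (h : AtLevel S (g : V q →ₗ[ℍ[ℝ]] V q))
    (F : Sub q) : Module.finrank ℍ[ℝ] (g • F ⊓ spanOf S : Sub q) =
      Module.finrank ℍ[ℝ] (F ⊓ spanOf S : Sub q) := by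
  rw [smul_inf_spanOf h]
  exact finrank_map_eq' _ _

/-- An element of `G` which maps a subspace into itself maps it onto itself. -/
theorem smul_eq_of_le {g : GLV q} (hg : g ∈ G q) {F : Sub q} (h : g • F ≤ F) : g • F = F := by
  obtain ⟨S, hS⟩ := hg
  have hl := levelSL_atLevel hS
  -- Dimension count inside the span of `S`; elsewhere `g x` differs from `x` only by a vector of
  -- that span.
  have h1 : g • F ⊓ spanOf S = F ⊓ spanOf S :=
    eq_of_le_of_finrank _ _ (inf_le_inf_right _ h) (finrank_smul_inf hl F).ge
  refine eq_of_le_of_level (S := S) h (h1 ▸ inf_le_left) fun x hx => ⟨g x, apply_mem_smul.2 hx, ?_⟩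
  have := hl.sub_mem x
  rw [← neg_sub]
  exact neg_mem this

theorem smul_eq_of_ge {g : GLV q} (hg : g ∈ G q) {F : Sub q} (h : F ≤ g • F) : g • F = F := by
  have : g⁻¹ • F = F := smul_eq_of_le (inv_mem hg) (by
    have := smul_le_smul_iff' (g := g⁻¹).2 h
    rwa [inv_smul_smul] at this)
  conv_lhs => rw [← this]
  rw [smul_inv_smul]

/-- An element of `G` preserving a chain preserves each member of the chain. -/
theorem smul_eq_of_smul_chain {g : GLV q} (hg : g ∈ G q) {C : Chain q} (hC : IsChain (· ≤ ·) C)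
    (h : g • C = C) {F : Sub q} (hF : F ∈ C) : g • F = F := by
  have : g • F ∈ C := by rw [← h]; exact Set.smul_mem_smul_set hF
  rcases hC.total this hF with h | h
  · exact smul_eq_of_le hg h
  · exact smul_eq_of_ge hg h

/-- Elements of `G` which agree on a chain agree on its members. -/
theorem smul_eq_smul_of_chain {g g' : GLV q} (hg : g ∈ G q) (hg' : g' ∈ G q) {C : Chain q}
    (hC : IsChain (· ≤ ·) C) (h : g • C = g' • C) {F : Sub q} (hF : F ∈ C) : g • F = g' • F := by
  have h1 := smul_eq_of_smul_chain (g := g'⁻¹ * g) (mul_mem (inv_mem hg') hg) hC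
    (by rw [mul_smul, h, inv_smul_smul]) hF
  rw [mul_smul, inv_smul_eq_iff] at h1
  exact h1

theorem G₀_le : G₀ q ≤ G q := fun _ h => h.1

theorem K₀_le : K₀ q ≤ G₀ q := fun _ h => h.1.1

theorem mem_K₀ {g : GLV q} : g ∈ K₀ q ↔ g ∈ G₀ q ∧ ∀ ε, IsSign ε → g • Vs q ε = Vs q ε := by
  change (g ∈ G₀ q ∧ g • Vpos q = Vpos q) ∧ g • Vneg q = Vneg q ↔ _
  rw [Vpos_eq, Vneg_eq]
  constructor
  · rintro ⟨⟨h, h1⟩, h2⟩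
    refine ⟨h, ?_⟩
    rintro ε (rfl | rfl)
    · exact h1
    · exact h2
  · rintro ⟨h, h1⟩
    exact ⟨⟨h, h1 1 isSign_one⟩, h1 (-1) isSign_neg_one⟩

theorem K₀_mem_Vs {k : GLV q} (hk : k ∈ K₀ q) {ε : ℝ} (hε : IsSign ε) {x : V q}
    (hx : x ∈ Vs q ε) : k x ∈ Vs q ε := by
  rw [← (mem_K₀.1 hk).2 ε hε]; exact apply_mem_smul.2 hx

theorem K₀_herm {k : GLV q} (hk : k ∈ K₀ q) (x y : V q) : herm (k x) (k y) = herm x y :=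
  (K₀_le hk).2 x y

/-- An isometry in `G₀` mapping each basis vector into the summand of its sign is in `K₀`. -/
theorem mem_K₀_of_vec {g : GLV q} (hg : g ∈ G₀ q) (h : ∀ i, g (vec i) ∈ Vs q (sgn i)) :
    g ∈ K₀ q := by
  refine mem_K₀.2 ⟨hg, fun ε hε => smul_eq_of_le hg.1 fun x hx => ?_⟩
  obtain ⟨y, hy, rfl⟩ := (Submodule.mem_smul_pointwise_iff_exists _ _ _).1 hx
  change g y ∈ _
  rw [eq_sum_vec (S := y.support) (x := y) (fun i hi => by simpa using hi), map_sum]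
  refine sum_mem fun i hi => ?_
  rw [map_smul]
  refine Submodule.smul_mem _ _ ?_
  have : sgn i = ε := by
    by_contra h'
    exact (Finsupp.mem_support_iff.1 hi) (mem_Vs.1 hy i h')
  rw [← this]; exact h i

/-! ### Subspaces which are coordinate subspaces outside a finite set of indices -/

/-- `F` is the sum of a subspace of the span of `T` and of a span of basis vectors. -/
def Lev (T : Finset (Idx q)) (F : Sub q) : Prop := ∀ x ∈ F, ∀ i ∉ T, x i ≠ 0 → vec i ∈ F

/-- `F` is spanned by elements of `L`. -/
def Coord (F : Sub q) : Prop := ∀ x ∈ F, ∀ i, x i ≠ 0 → vec i ∈ F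

theorem Coord.lev {F : Sub q} (h : Coord F) (T : Finset (Idx q)) : Lev T F :=
  fun x hx i _ => h x hx i

theorem Lev.mono {T T' : Finset (Idx q)} (h : T ⊆ T') {F : Sub q} (hF : Lev T F) : Lev T' F :=
  fun x hx i hi => hF x hx i fun h' => hi (h h')

theorem Lev.sub_res_mem {T : Finset (Idx q)} {F : Sub q} (h : Lev T F) {x : V q} (hx : x ∈ F) :
    x - res T x ∈ F := by
  classical
  rw [eq_sum_vec (S := x.support \ T) (x := x - res T x)]
  · refine sum_mem fun i hi => Submodule.smul_mem _ _ ?_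
    simp only [Finset.mem_sdiff, Finsupp.mem_support_iff] at hi
    exact h x hx i hi.2 hi.1
  · intro i hi
    by_cases hT : i ∈ T
    · exact sub_res_apply x hT
    · have : x i = 0 := by simpa [hT] using hi
      rw [Finsupp.sub_apply, res_apply, if_neg hT, this, sub_zero]

theorem Lev.res_mem {T : Finset (Idx q)} {F : Sub q} (h : Lev T F) {x : V q} (hx : x ∈ F) :
    res T x ∈ F := by
  have := sub_mem hx (h.sub_res_mem hx)
  rwa [sub_sub_cancel] at this

theorem Lev.smul {T : Finset (Idx q)} {F : Sub q} (h : Lev T F) {g : GLV q}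
    (hg : AtLevel T (g : V q →ₗ[ℍ[ℝ]] V q)) : Lev T (g • F) := by
  intro x hx i hi hxi
  rw [mem_smul_iff] at hx
  have h1 : g⁻¹ x i = x i := (atLevel_inv hg).apply_coord x hi
  have h2 := h _ hx i hi (by rwa [h1])
  rw [← apply_mem_smul (g := g)] at h2
  have h3 : g (vec i) = vec i := hg.1 i hi
  rwa [h3] at h2

theorem lev_bot (T : Finset (Idx q)) : Lev T (⊥ : Sub q) := by
  intro x hx i _ hxi
  rw [(Submodule.mem_bot _).1 hx] at hxi
  exact absurd rfl hxi

theorem lev_top (T : Finset (Idx q)) : Lev T (⊤ : Sub q) := fun _ _ _ _ _ => trivial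

theorem coord_Vs (ε : ℝ) : Coord (Vs q ε) := by
  intro x hx i hxi
  refine vec_mem_Vs ?_
  by_contra h
  exact hxi (mem_Vs.1 hx i h)

theorem exists_support_finset (s : Set (V q)) (hs : s.Finite) :
    ∃ T : Finset (Idx q), ∀ x ∈ s, x ∈ spanOf T := by
  classical
  refine ⟨hs.toFinset.biUnion fun x => x.support, fun x hx => mem_spanOf.2 fun i hi => ?_⟩
  by_contra h
  exact hi (Finset.mem_biUnion.2 ⟨x, hs.mem_toFinset.2 hx, Finsupp.mem_support_iff.2 h⟩)

theorem exists_mem_spanOf_finset (B : Set (V q)) (s : Set (V q)) (hs : s.Finite)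
    (h : ∀ x ∈ s, x ∈ Submodule.span ℍ[ℝ] B) :
    ∃ B₀ : Finset (V q), (B₀ : Set (V q)) ⊆ B ∧ ∀ x ∈ s, x ∈ Submodule.span ℍ[ℝ] (B₀ : Set (V q)) := by
  classical
  have : ∀ x : V q, ∃ t : Finset (V q), x ∈ s → (t : Set (V q)) ⊆ B ∧ x ∈ Submodule.span ℍ[ℝ] (t : Set (V q)) := by
    intro x
    by_cases hx : x ∈ s
    · obtain ⟨t, ht, hxt⟩ := Submodule.mem_span_finite_of_mem_span (h x hx)
      exact ⟨t, fun _ => ⟨ht, hxt⟩⟩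
    · exact ⟨∅, fun h => absurd h hx⟩
  choose t ht using this
  refine ⟨hs.toFinset.biUnion t, ?_, fun x hx => ?_⟩
  · intro y hy
    simp only [Finset.coe_biUnion, Set.mem_iUnion] at hy
    obtain ⟨x, hx, hy⟩ := hy
    exact (ht x (by simpa using hx)).1 hy
  · refine Submodule.span_mono ?_ (ht x hx).2
    intro y hy
    simp only [Finset.coe_biUnion, Set.mem_iUnion]
    exact ⟨x, by simpa using hx, hy⟩

/-- The finitely many elements of `L` missing from the basis `B` lie in the span of a finite `B₀ ⊆
B`. So `B₀` together with `B ∩ L` spans `V`, and by independence it is all of `B`. Outside the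
supports of the vectors in `B₀`, the basis consists of elements of `L`. -/
theorem WeaklyCompatible.exists_lev {C : Chain q} (h : WeaklyCompatible C) :
    ∃ T : Finset (Idx q), ∀ F ∈ C, Lev T F := by
  classical
  obtain ⟨B, ⟨hB1, hB2⟩, hfin, hC⟩ := h
  obtain ⟨B₀, hB₀, hspan⟩ := exists_mem_spanOf_finset B _ hfin fun x _ => by rw [hB2]; trivial
  have htop : Submodule.span ℍ[ℝ] ((B₀ : Set (V q)) ∪ (B ∩ Set.range vec)) = ⊤ := by
    refine top_le_iff.1 fun x _ => ?_
    rw [eq_sum_vec (S := x.support) (x := x) (fun i hi => by simpa using hi)]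
    refine sum_mem fun i _ => Submodule.smul_mem _ _ ?_
    by_cases hi : vec i ∈ B
    · exact Submodule.subset_span (Or.inr ⟨hi, i, rfl⟩)
    · exact Submodule.span_mono Set.subset_union_left (hspan _ ⟨⟨i, rfl⟩, hi⟩)
  -- An element of `B` outside this spanning subset would be a combination of other basis elements.
  have hBsub : B ⊆ (B₀ : Set (V q)) ∪ (B ∩ Set.range vec) := by
    intro b hb
    by_contra hb'
    have hsub : (B₀ : Set (V q)) ∪ (B ∩ Set.range vec) ⊆ B \ {b} := by
      rintro y hy
      refine ⟨?_, by rintro rfl; exact hb' hy⟩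
      rcases hy with hy | hy
      · exact hB₀ hy
      · exact hy.1
    have h1 : b ∈ Submodule.span ℍ[ℝ] (id '' (B \ {b})) := by
      rw [Set.image_id]
      exact Submodule.span_mono hsub (by rw [htop]; trivial)
    have h2 : LinearIndepOn ℍ[ℝ] id (insert b (B \ {b})) := by
      rwa [Set.insert_sdiff_singleton, Set.insert_eq_of_mem hb]
    exact ((linearIndepOn_insert (by simp)).1 h2).2 h1
  obtain ⟨T₁, hT₁⟩ := exists_support_finset (B₀ : Set (V q)) B₀.finite_toSet
  refine ⟨T₁, fun F hF => ?_⟩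
  rintro x hx i hi
  have key : ∀ y ∈ Submodule.span ℍ[ℝ] (B ∩ (F : Set (V q))), y i ≠ 0 → vec i ∈ F := by
    intro y hy
    refine Submodule.span_induction ?_ ?_ ?_ ?_ hy
    · rintro b ⟨hb, hbF⟩ hbi
      rcases hBsub hb with hb0 | ⟨-, j, rfl⟩
      · exact absurd (mem_spanOf.1 (hT₁ b hb0) i hi) hbi
      · have : j = i := by by_contra hji; exact hbi (vec_apply_ne hji)
        rwa [← this]
    · intro h; exact absurd rfl h
    · intro y z _ _ hy hz hyz
      by_cases h0 : y i = 0
      · refine hz fun h1 => hyz ?_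
        rw [Finsupp.add_apply, h0, h1, add_zero]
      · exact hy h0
    · intro a y _ hy hay
      refine hy fun h0 => hay ?_
      rw [Finsupp.smul_apply, h0, smul_zero]
  exact key x (by rw [hC F hF]; exact hx)

/-! ### Constructing isometries -/

theorem isometry_of_vec (φ : V q →ₗ[ℍ[ℝ]] V q)
    (h : ∀ i j, herm (φ (vec i)) (φ (vec j)) = herm (vec i) (vec j)) (x y : V q) :
    herm (φ x) (φ y) = herm x y := by
  rw [eq_sum_vec (S := x.support) (x := x) (fun i hi => by simpa using hi),
    eq_sum_vec (S := y.support) (x := y) (fun i hi => by simpa using hi), map_sum, map_sum]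
  simp only [herm_sum_left, herm_sum_right, map_smul, herm_smul_left, herm_smul_right, h]

theorem herm_vec_vec_self (i : Idx q) : herm (vec i) (vec i) = (sgn i : ℍ[ℝ]) := by
  rw [herm_vec_right, vec_apply_self, ← Quaternion.coe_mul_eq_smul, mul_one]

theorem herm_vec_vec_ne {i j : Idx q} (h : i ≠ j) : herm (vec i) (vec j) = 0 := by
  rw [herm_vec_right, vec_apply_ne h, smul_zero]

theorem exists_G₀_of_isometry {T : Finset (Idx q)} {φ : V q →ₗ[ℍ[ℝ]] V q} (hl : AtLevel T φ)
    (hiso : ∀ x y, herm (φ x) (φ y) = herm x y) :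
    ∃ g ∈ G₀ q, AtLevel T (g : V q →ₗ[ℍ[ℝ]] V q) ∧ ∀ x, g x = φ x := by
  have hbij := hl.bijective fun x _ hx => eq_zero_of_herm fun i => by
    rw [← hiso, hx, herm_zero_left]
  let g : GLV q := LinearEquiv.ofBijective φ hbij
  have hg : (g : V q →ₗ[ℍ[ℝ]] V q) = φ := rfl
  exact ⟨g, isometry_mem_G₀ (S := T) (by rw [hg]; exact hl) hiso, by rw [hg]; exact hl, fun _ => rfl⟩

/-- The vectors of `L` outside `T` are kept fixed; they are orthogonal to the span of `T`, so only
the relations among the `e i` matter. -/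
theorem exists_isometry {T : Finset (Idx q)} (e : Idx q → V q) (he : ∀ i ∈ T, e i ∈ spanOf T)
    (hself : ∀ i ∈ T, herm (e i) (e i) = (sgn i : ℍ[ℝ]))
    (hne : ∀ i ∈ T, ∀ j ∈ T, i ≠ j → herm (e i) (e j) = 0) :
    ∃ g ∈ G₀ q, AtLevel T (g : V q →ₗ[ℍ[ℝ]] V q) ∧ ∀ i ∈ T, g (vec i) = e i := by
  classical
  let φ : V q →ₗ[ℍ[ℝ]] V q := Finsupp.linearCombination ℍ[ℝ] fun i => if i ∈ T then e i else vec i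
  have hφ : ∀ i, φ (vec i) = if i ∈ T then e i else vec i := fun i => by
    simp only [φ, vec, Finsupp.linearCombination_single, one_smul]
  have hl : AtLevel T φ := .of_vec (fun i hi => by rw [hφ, if_neg hi])
    fun i hi => by rw [hφ, if_pos hi]; exact he i hi
  have hiso : ∀ x y, herm (φ x) (φ y) = herm x y := by
    refine isometry_of_vec φ fun i j => ?_
    rw [hφ, hφ]
    by_cases hi : i ∈ T
    · by_cases hj : j ∈ T
      · rw [if_pos hi, if_pos hj]
        by_cases hij : i = j
        · subst hij; rw [hself i hi, herm_vec_vec_self]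
        · rw [hne i hi j hj hij, herm_vec_vec_ne hij]
      · rw [if_pos hi, if_neg hj, herm_vec_right, mem_spanOf.1 (he i hi) j hj, smul_zero,
          herm_vec_vec_ne (by rintro rfl; exact hj hi)]
    · by_cases hj : j ∈ T
      · rw [if_neg hi, if_pos hj, herm_vec_left, mem_spanOf.1 (he j hj) i hi, star_zero, smul_zero,
          herm_vec_vec_ne (by rintro rfl; exact hi hj)]
      · rw [if_neg hi, if_neg hj]
  obtain ⟨g, hg, hgl, hgφ⟩ := exists_G₀_of_isometry hl hiso
  exact ⟨g, hg, hgl, fun i hi => (hgφ _).trans ((hφ i).trans (if_pos hi))⟩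

/-! ### Orthonormal bases adapted to a chain -/

/-- `E` is orthonormal with respect to the indefinite form. -/
def Orthon (E : Finset (V q)) : Prop :=
  ∀ e ∈ E, (herm e e = 1 ∨ herm e e = -1) ∧ ∀ e' ∈ E, e' ≠ e → herm e e' = 0

theorem card_le_of_independent {α : Type*} (A : Finset α) (f : α → V q) (S : Finset (Idx q))
    (hf : ∀ a ∈ A, f a ∈ spanOf S)
    (hli : ∀ c : α → ℍ[ℝ], ∑ a ∈ A, c a • f a = 0 → ∀ a ∈ A, c a = 0) : A.card ≤ S.card := by
  classical
  have h : LinearIndependent ℍ[ℝ] (fun a : A => f a) := by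
    rw [Fintype.linearIndependent_iff]
    intro c hc a
    have := hli (fun a => if h : a ∈ A then c ⟨a, h⟩ else 0) (by
      rw [← hc, ← Finset.sum_coe_sort A]
      exact Finset.sum_congr rfl fun b _ => by simp) a a.2
    simpa using this
  have h' : LinearIndependent ℍ[ℝ] (fun a : A => (⟨f a, hf a a.2⟩ : spanOf S)) :=
    LinearIndependent.of_comp (spanOf S).subtype h
  have := h'.fintype_card_le_finrank
  rwa [finrank_spanOf, Fintype.card_coe] at this

namespace Orthon
variable {E : Finset (V q)}

theorem ne_zero (h : Orthon E) {e : V q} (he : e ∈ E) : herm e e ≠ 0 := by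
  rcases (h e he).1 with h | h <;> rw [h] <;> simp

theorem sum_herm (h : Orthon E) (c : V q → ℍ[ℝ]) {e : V q} (he : e ∈ E) :
    herm (∑ a ∈ E, c a • a) e = c e * herm e e := by
  rw [herm_sum_left, Finset.sum_eq_single e]
  · rw [herm_smul_left]
  · intro b hb hbe
    rw [herm_smul_left, (h b hb).2 e he (Ne.symm hbe), mul_zero]
  · exact fun h => absurd he h

theorem independent (h : Orthon E) (c : V q → ℍ[ℝ]) (hc : ∑ a ∈ E, c a • a = 0) :
    ∀ a ∈ E, c a = 0 := by
  intro a ha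
  have := h.sum_herm c ha
  rw [hc, herm_zero_left] at this
  exact (mul_eq_zero.1 this.symm).resolve_right (h.ne_zero ha)

theorem card_le (h : Orthon E) {S : Finset (Idx q)} (hE : ∀ e ∈ E, e ∈ spanOf S) :
    E.card ≤ S.card :=
  card_le_of_independent E id S hE h.independent

theorem insert [DecidableEq (V q)] (h : Orthon E) {e : V q} (he : herm e e = 1 ∨ herm e e = -1)
    (he' : ∀ e' ∈ E, herm e e' = 0) : Orthon (insert e E) := by
  intro a ha'
  rcases Finset.mem_insert.1 ha' with rfl | ha
  · refine ⟨he, fun b hb hba => ?_⟩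
    exact he' b ((Finset.mem_insert.1 hb).resolve_left hba)
  · refine ⟨(h a ha).1, fun b hb hba => ?_⟩
    rcases Finset.mem_insert.1 hb with hbe | hb
    · rw [← star_herm, hbe, he' a ha, star_zero]
    · exact (h a ha).2 b hb hba

/-- The difference of `w` and its projection to the span of `E`. -/
theorem exists_sub (h : Orthon E) (w : V q) :
    ∃ p ∈ Submodule.span ℍ[ℝ] (E : Set (V q)), (∀ e ∈ E, herm (w - p) e = 0) ∧
      ∀ U : Sub q, (∀ e ∈ E, herm w e ≠ 0 → e ∈ U) → p ∈ U := by
  -- Since `herm a a` is `1` or `-1`, it is its own inverse, and multiplication by it replaces the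
  -- division in the projection formula.
  refine ⟨∑ a ∈ E, (herm w a * herm a a) • a, sum_mem fun a ha =>
    Submodule.smul_mem _ _ (Submodule.subset_span ha), fun e he => ?_, fun U hU => ?_⟩
  · rw [herm_sub_left, h.sum_herm (fun a => herm w a * herm a a) he]
    rcases (h e he).1 with h | h <;> rw [h] <;> simp
  · refine sum_mem fun a ha => ?_
    by_cases h0 : herm w a = 0
    · rw [h0, zero_mul, zero_smul]; exact zero_mem _
    · exact Submodule.smul_mem _ _ (hU a ha h0)

end Orthon

/-- Gram–Schmidt along a chain: enlarge an orthonormal set one vector at a time, always inside the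
smallest member not yet spanned. `hQ` supplies the next vector and `Q` records an extra property
wanted of all vectors. Orthonormal sets are independent, so this stops. -/
theorem exists_adapted {T : Finset (Idx q)} {𝒲 : Set (Sub q)} (hc : IsChain (· ≤ ·) 𝒲)
    (hT : ∀ W ∈ 𝒲, W ≤ spanOf T) (Q : V q → Prop)
    (hQ : ∀ E : Finset (V q), Orthon E → (∀ e ∈ E, Q e) → ∀ W ∈ 𝒲, (∀ e ∈ E, e ∈ W) →
      Submodule.span ℍ[ℝ] (E : Set (V q)) ≠ W → ∃ e ∈ W, Q e ∧ (herm e e = 1 ∨ herm e e = -1) ∧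
        ∀ e' ∈ E, herm e e' = 0) :
    ∃ E : Finset (V q), Orthon E ∧ (∀ e ∈ E, e ∈ spanOf T) ∧ (∀ e ∈ E, Q e) ∧
      ∀ W ∈ 𝒲, Submodule.span ℍ[ℝ] ((E : Set (V q)) ∩ W) = W := by
  classical
  -- `n` bounds how many vectors can still be adjoined. The invariant is that each member of the
  -- chain is either spanned by its part of `E` or contains all of `E`.
  have key : ∀ n (E : Finset (V q)), Orthon E → (∀ e ∈ E, e ∈ spanOf T) → (∀ e ∈ E, Q e) →
      (∀ W ∈ 𝒲, Submodule.span ℍ[ℝ] ((E : Set (V q)) ∩ W) = W ∨ ∀ e ∈ E, e ∈ W) →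
      T.card ≤ E.card + n → ∃ E : Finset (V q), Orthon E ∧ (∀ e ∈ E, e ∈ spanOf T) ∧
        (∀ e ∈ E, Q e) ∧ ∀ W ∈ 𝒲, Submodule.span ℍ[ℝ] ((E : Set (V q)) ∩ W) = W := by
    intro n
    induction n with
    | zero | succ n ih =>
      intro E hE hET hEQ hEW hcard
      by_cases hdone : ∀ W ∈ 𝒲, Submodule.span ℍ[ℝ] ((E : Set (V q)) ∩ W) = W
      · exact ⟨E, hE, hET, hEQ, hdone⟩
      push Not at hdone
      let bad : Set (Sub q) := {W | W ∈ 𝒲 ∧ Submodule.span ℍ[ℝ] ((E : Set (V q)) ∩ W) ≠ W}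
      have hne : bad.Nonempty := hdone
      -- By minimality of the dimension, every other unfinished member contains `W`, so a vector
      -- adjoined in `W` preserves the invariant.
      obtain ⟨W, hW, hmin⟩ := WellFounded.has_min
        (InvImage.wf (fun W : Sub q => Module.finrank ℍ[ℝ] W) Nat.lt_wfRel.wf) bad hne
      have hEsub : ∀ e ∈ E, e ∈ W := (hEW W hW.1).resolve_left hW.2
      have hspan : Submodule.span ℍ[ℝ] (E : Set (V q)) ≠ W := by
        have h2 := hW.2
        rwa [Set.inter_eq_left.2 (fun e he => hEsub e he)] at h2
      obtain ⟨e, heW, heQ, hee, heE⟩ := hQ E hE hEQ W hW.1 hEsub hspan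
      have hnot : e ∉ E := by
        intro he
        exact hE.ne_zero he (heE e he)
      have hE' : Orthon (insert e E) := hE.insert hee heE
      have hET' : ∀ x ∈ insert e E, x ∈ spanOf T := by
        intro x hx
        rcases Finset.mem_insert.1 hx with rfl | hx
        · exact hT W hW.1 heW
        · exact hET x hx
      have hcard' := hE'.card_le hET'
      rw [Finset.card_insert_of_notMem hnot] at hcard'
      -- In the case `zero` there is no room left in the span of `T`, so the cardinalities
      -- contradict each other; in the case `succ` the induction hypothesis applies.
      first
        | omega
        | refine ih (insert e E) hE' hET' ?_ ?_ ?_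
          · intro x hx
            rcases Finset.mem_insert.1 hx with rfl | hx
            · exact heQ
            · exact hEQ x hx
          · intro W' hW'
            by_cases hW'b : Submodule.span ℍ[ℝ] ((E : Set (V q)) ∩ W') = W'
            · left
              refine le_antisymm (Submodule.span_le.2 Set.inter_subset_right) ?_
              conv_lhs => rw [← hW'b]
              refine Submodule.span_mono (Set.inter_subset_inter_left _ ?_)
              intro x hx
              exact Finset.mem_insert_of_mem hx
            · right
              have hle : W ≤ W' := by
                rcases hc.total hW.1 hW' with h | h
                · exact h
                · by_contra hn
                  have : Module.Finite ℍ[ℝ] W := finite_of_le _ _ (hT W hW.1)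
                  refine hmin W' ⟨hW', hW'b⟩ ?_
                  exact Submodule.finrank_lt_finrank_of_lt (lt_of_le_not_ge h hn)
              intro x hx
              rcases Finset.mem_insert.1 hx with rfl | hx
              · exact hle heW
              · exact hle (hEsub x hx)
          · rw [Finset.card_insert_of_notMem hnot]; omega
  exact key T.card ∅ (by simp [Orthon]) (by simp) (by simp) (fun W _ => Or.inr (by simp)) (by simp)

/-- The hermitian form is nondegenerate on `F`. -/
def Nondeg (F : Sub q) : Prop := ∀ x ∈ F, (∀ y ∈ F, herm x y = 0) → x = 0

theorem exists_normalized {e : V q} (h : (herm e e).re ≠ 0) :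
    ∃ c : ℝ, c ≠ 0 ∧ (herm ((c : ℍ[ℝ]) • e) ((c : ℍ[ℝ]) • e) = 1 ∨
      herm ((c : ℍ[ℝ]) • e) ((c : ℍ[ℝ]) • e) = -1) := by
  have key : ∀ c : ℝ, herm ((c : ℍ[ℝ]) • e) ((c : ℍ[ℝ]) • e) = ((c * c * (herm e e).re : ℝ) : ℍ[ℝ]) := by
    intro c
    rw [herm_self, herm_smul_smul_re, Quaternion.normSq_coe, sq]
  have hpos : 0 < |(herm e e).re| := abs_pos.2 h
  refine ⟨(√|(herm e e).re|)⁻¹, by positivity, ?_⟩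
  rw [key]
  have h1 : (√|(herm e e).re|)⁻¹ * (√|(herm e e).re|)⁻¹ * (herm e e).re = 1 ∨
      (√|(herm e e).re|)⁻¹ * (√|(herm e e).re|)⁻¹ * (herm e e).re = -1 := by
    rw [← mul_inv, Real.mul_self_sqrt hpos.le]
    rcases lt_or_gt_of_ne h with h' | h'
    · right; rw [abs_of_neg h']; field_simp
    · left; rw [abs_of_pos h']; field_simp
  rcases h1 with h1 | h1 <;> rw [h1] <;> simp

/-- A subspace on which all vectors are isotropic is totally isotropic. -/
theorem herm_eq_zero_of_isotropic {W : Sub q} (h : ∀ x ∈ W, (herm x x).re = 0) {x y : V q}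
    (hx : x ∈ W) (hy : y ∈ W) : herm x y = 0 := by
  refine eq_zero_of_re_mul fun c => ?_
  have h1 := herm_add_self_re x (star c • y)
  rw [h _ (add_mem hx (Submodule.smul_mem _ _ hy)), h _ hx, h _ (Submodule.smul_mem _ _ hy),
    herm_smul_right, star_star] at h1
  linarith

/-- Let `P` be the orthogonal complement of `E` in `W`. If it had only isotropic vectors, it would
be totally isotropic; being orthogonal to `E` as well, it would lie in the radical of `W`. Then `E`
would span `W`. -/
theorem Nondeg.exists_next {W : Sub q} (hW : Nondeg W) {E : Finset (V q)} (hE : Orthon E)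
    (hEW : ∀ e ∈ E, e ∈ W) (hne : Submodule.span ℍ[ℝ] (E : Set (V q)) ≠ W) :
    ∃ e ∈ W, (herm e e = 1 ∨ herm e e = -1) ∧ ∀ e' ∈ E, herm e e' = 0 := by
  have hle : Submodule.span ℍ[ℝ] (E : Set (V q)) ≤ W := Submodule.span_le.2 hEW
  let P : Sub q :=
    { carrier := {x | x ∈ W ∧ ∀ e ∈ E, herm x e = 0}
      add_mem' := fun {a b} ha hb => ⟨add_mem ha.1 hb.1, fun e he => by
        rw [herm_add_left, ha.2 e he, hb.2 e he, add_zero]⟩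
      zero_mem' := ⟨zero_mem _, fun e _ => herm_zero_left e⟩
      smul_mem' := fun c x hx => ⟨Submodule.smul_mem _ _ hx.1, fun e he => by
        rw [herm_smul_left, hx.2 e he, mul_zero]⟩ }
  by_cases hiso : ∀ x ∈ P, (herm x x).re = 0
  · exfalso
    apply hne
    refine le_antisymm hle fun w hw => ?_
    obtain ⟨p, hp, hpe, -⟩ := hE.exists_sub w
    have hwp : w - p ∈ P := ⟨sub_mem hw (hle hp), hpe⟩
    have hspan : ∀ x ∈ P, ∀ s ∈ Submodule.span ℍ[ℝ] (E : Set (V q)), herm x s = 0 := by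
      intro x hx s hs
      refine Submodule.span_induction (fun e he => hx.2 e he) (herm_zero_right x) ?_ ?_ hs
      · intro a b _ _ ha hb; rw [herm_add_right, ha, hb, add_zero]
      · intro c a _ ha; rw [herm_smul_right, ha, zero_mul]
    have h0 : w - p = 0 := by
      refine hW _ hwp.1 fun y hy => ?_
      obtain ⟨p', hp', hpe', -⟩ := hE.exists_sub y
      have hyp : y - p' ∈ P := ⟨sub_mem hy (hle hp'), hpe'⟩
      rw [← sub_add_cancel y p', herm_add_right, hspan _ hwp _ hp',
        herm_eq_zero_of_isotropic hiso hwp hyp, add_zero]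
    rw [sub_eq_zero.1 h0]; exact hp
  · push Not at hiso
    obtain ⟨x, hx, hxx⟩ := hiso
    obtain ⟨c, -, hc⟩ := exists_normalized hxx
    have hcx : (c : ℍ[ℝ]) • x ∈ P := Submodule.smul_mem _ _ hx
    exact ⟨_, hcx.1, hc, hcx.2⟩

/-! ### Conjugating flags to coordinate flags -/

/-- A vector supported in `T` pairs with `y` only through the part of `y` in the span of `T`, and
that part is again in `F`. -/
theorem Lev.inf_nondeg {T : Finset (Idx q)} {F : Sub q} (h : Lev T F) (hN : Nondeg F) :
    Nondeg (F ⊓ spanOf T) := by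
  intro x hx hxy
  refine hN x hx.1 fun y hy => ?_
  rw [← add_sub_cancel (res T y) y, herm_add_right, hxy _ ⟨h.res_mem hy, QuatCycle.res_mem T y⟩,
    herm_eq_sum (mem_spanOf.1 hx.2), zero_add]
  exact Finset.sum_eq_zero fun _ hi => by rw [sub_res_apply y hi]; simp

theorem nondeg_top : Nondeg (⊤ : Sub q) := fun _ _ h => eq_zero_of_herm fun _ => h _ trivial

theorem exists_injOn_of_card_le {α β : Type*} [Nonempty β] {A : Finset α} {B : Finset β}
    (h : A.card ≤ B.card) :
    ∃ f : α → β, (∀ a ∈ A, f a ∈ B) ∧ ∀ a ∈ A, ∀ a' ∈ A, f a = f a' → a = a' := by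
  classical
  have : Fintype.card A ≤ Fintype.card B := by simpa using h
  obtain ⟨e⟩ := Function.Embedding.nonempty_of_card_le this
  refine ⟨fun a => if h : a ∈ A then (e ⟨a, h⟩ : β) else Classical.arbitrary β, fun a ha => ?_,
    fun a ha a' ha' hh => ?_⟩
  · simp [ha]
  · simp only [ha, ha', dite_true] at hh
    exact congrArg Subtype.val (e.injective (Subtype.ext hh))

/-- The inequality in Sylvester's law of inertia. On the span of the vectors of sign `ε` the
projection to `V_ε` is injective: a vector in its kernel lies in `V_{-ε}`, where the form has the
opposite sign. -/
theorem Orthon.card_filter_le {T : Finset (Idx q)} {E : Finset (V q)} (hE : Orthon E)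
    (hET : ∀ e ∈ E, e ∈ spanOf T) {ε : ℝ} (hε : IsSign ε) [DecidablePred fun e : V q => herm e e = (ε : ℍ[ℝ])]
    [DecidablePred fun i : Idx q => sgn i = ε] :
    (E.filter fun e => herm e e = (ε : ℍ[ℝ])).card ≤ (T.filter fun i => sgn i = ε).card := by
  classical
  have hsub : Orthon (E.filter fun e => herm e e = (ε : ℍ[ℝ])) := fun e he =>
    ⟨(hE e (Finset.mem_filter.1 he).1).1, fun e' he' =>
      (hE e (Finset.mem_filter.1 he).1).2 e' (Finset.mem_filter.1 he').1⟩
  refine card_le_of_independent _ (fun e => pr q ε e) _ (fun e he => mem_spanOf.2 fun i hi => ?_) fun c hc => ?_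
  · rw [pr_apply]
    split_ifs with h
    · refine mem_spanOf.1 (hET e (Finset.mem_filter.1 he).1) i fun hi' => hi ?_
      exact Finset.mem_filter.2 ⟨hi', h⟩
    · rfl
  · refine hsub.independent c ?_
    set v := ∑ a ∈ E.filter fun e => herm e e = (ε : ℍ[ℝ]), c a • a with hv
    have h1 : pr q ε v = 0 := by rw [hv, map_sum, ← hc]; simp only [map_smul]
    have h2 : v ∈ Vs q (-ε) := by
      rw [← pr_add_pr hε v, h1, zero_add]; exact pr_mem _ _
    refine (def_Vs hε.neg).eq_zero h2 ?_
    have h3 : herm v v = ∑ a ∈ E.filter fun e => herm e e = (ε : ℍ[ℝ]),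
        ((ε * Quaternion.normSq (c a) : ℝ) : ℍ[ℝ]) := by
      conv_lhs => rw [hv, herm_sum_left]
      refine Finset.sum_congr rfl fun a ha => ?_
      rw [herm_smul_left, ← star_herm, hsub.sum_herm c ha, (Finset.mem_filter.1 ha).2, star_mul,
        Quaternion.star_coe, ← mul_assoc, ← Quaternion.coe_commutes, mul_assoc,
        Quaternion.self_mul_star, ← Quaternion.coe_mul]
    have h4 : ∀ s : Finset (V q), (∑ a ∈ s, ((ε * Quaternion.normSq (c a) : ℝ) : ℍ[ℝ])) =
        ((∑ a ∈ s, ε * Quaternion.normSq (c a) : ℝ) : ℍ[ℝ]) := fun s =>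
      (map_sum (algebraMap ℝ ℍ[ℝ]) _ _).symm
    rw [h3, h4, Quaternion.re_coe, ← Finset.mul_sum, ← mul_assoc, neg_mul, hε.mul_self]
    have : 0 ≤ ∑ a ∈ E.filter fun e => herm e e = (ε : ℍ[ℝ]), Quaternion.normSq (c a) :=
      Finset.sum_nonneg fun a _ => Quaternion.normSq_nonneg
    linarith

/-- An adapted orthonormal set spanning the span of `T` has as many vectors of each sign as `T` has
indices, so an isometry carries the basis vectors to it; pulling back along this isometry makes the
chain a coordinate chain. The property `Q` is passed on to the images of the basis vectors so that
the isometry can also be taken in `K₀`. -/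
theorem exists_coord_of_next {C : Chain q} (hC : IsChain (· ≤ ·) C) {T : Finset (Idx q)}
    (hT : ∀ F ∈ C, Lev T F) (Q : V q → Prop)
    (hQ : ∀ E : Finset (V q), Orthon E → (∀ e ∈ E, Q e) → ∀ F : Sub q, F ∈ C ∨ F = ⊤ →
      (∀ e ∈ E, e ∈ F ⊓ spanOf T) → Submodule.span ℍ[ℝ] (E : Set (V q)) ≠ F ⊓ spanOf T →
        ∃ e ∈ F ⊓ spanOf T, Q e ∧ (herm e e = 1 ∨ herm e e = -1) ∧ ∀ e' ∈ E, herm e e' = 0) :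
    ∃ g ∈ G₀ q, AtLevel T (g : V q →ₗ[ℍ[ℝ]] V q) ∧ (∀ i ∈ T, Q (g (vec i))) ∧
      ∀ F ∈ C, Coord (g⁻¹ • F) := by
  classical
  let 𝒲 : Set (Sub q) := {W | ∃ F : Sub q, (F ∈ C ∨ F = ⊤) ∧ W = F ⊓ spanOf T}
  have hc : IsChain (· ≤ ·) 𝒲 := by
    rintro _ ⟨F, hF, rfl⟩ _ ⟨F', hF', rfl⟩ -
    have : F ≤ F' ∨ F' ≤ F := by
      rcases hF with hF | rfl
      · rcases hF' with hF' | rfl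
        · exact hC.total hF hF'
        · exact Or.inl le_top
      · exact Or.inr le_top
    exact this.imp (fun h => inf_le_inf_right _ h) fun h => inf_le_inf_right _ h
  obtain ⟨E, hE, hET, hEQ, hEW⟩ := exists_adapted hc
    (by rintro _ ⟨F, _, rfl⟩; exact inf_le_right) Q (by
      rintro E hE hEQ _ ⟨F, hF, rfl⟩ h1 h2; exact hQ E hE hEQ F hF h1 h2)
  have hspan : Submodule.span ℍ[ℝ] (E : Set (V q)) = spanOf T := by
    have := hEW (spanOf T) ⟨⊤, Or.inr rfl, by rw [top_inf_eq]⟩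
    rwa [Set.inter_eq_left.2 (fun e he => hET e he)] at this
  have hcardE : T.card ≤ E.card := by
    have := finrank_span_finset_le_card (R := ℍ[ℝ]) E
    unfold Set.finrank at this
    rwa [hspan, finrank_spanOf] at this
  have hp := hE.card_filter_le hET isSign_one
  have hn := hE.card_filter_le hET isSign_neg_one
  have hTs : (T.filter fun i => sgn i = 1).card + (T.filter fun i => sgn i = -1).card = T.card := by
    rw [← Finset.card_filter_add_card_filter_not (s := T) fun i => sgn i = 1]
    congr 2
    refine Finset.filter_congr fun i _ => ?_
    exact (isSign_one.sgn_ne_iff i).symm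
  have hEs : (E.filter fun e => herm e e = ((1 : ℝ) : ℍ[ℝ])).card +
      (E.filter fun e => herm e e = ((-1 : ℝ) : ℍ[ℝ])).card = E.card := by
    rw [← Finset.card_filter_add_card_filter_not (s := E) fun e => herm e e = ((1 : ℝ) : ℍ[ℝ])]
    congr 2
    refine Finset.filter_congr fun e he => ?_
    have hne : ((-1 : ℝ) : ℍ[ℝ]) ≠ ((1 : ℝ) : ℍ[ℝ]) := by
      intro h; have := Quaternion.coe_injective h; norm_num at this
    constructor
    · intro h; rw [h]; exact hne
    · intro h
      rcases (hE e he).1 with h' | h'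
      · exact absurd (by rw [h']; simp) h
      · rw [h']; simp
  -- The two inertia inequalities add up to `E.card ≤ T.card`, while `E` spans; hence both are
  -- equalities.
  obtain ⟨f, hf, hfi⟩ := exists_injOn_of_card_le (A := T.filter fun i => sgn i = 1)
    (B := E.filter fun e => herm e e = ((1 : ℝ) : ℍ[ℝ])) (by omega)
  obtain ⟨f', hf', hfi'⟩ := exists_injOn_of_card_le (A := T.filter fun i => sgn i = -1)
    (B := E.filter fun e => herm e e = ((-1 : ℝ) : ℍ[ℝ])) (by omega)
  let e : Idx q → V q := fun i => if sgn i = 1 then f i else f' i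
  have he : ∀ i ∈ T, e i ∈ E ∧ herm (e i) (e i) = (sgn i : ℍ[ℝ]) := by
    intro i hi
    rcases sgn_eq_or i with h | h
    · have := Finset.mem_filter.1 (hf i (Finset.mem_filter.2 ⟨hi, h⟩))
      simp only [e, if_pos h]
      exact ⟨this.1, by rw [this.2, h]⟩
    · have := Finset.mem_filter.1 (hf' i (Finset.mem_filter.2 ⟨hi, h⟩))
      have h' : ¬ sgn i = 1 := by rw [h]; norm_num
      simp only [e, if_neg h']
      exact ⟨this.1, by rw [this.2, h]⟩
  have hinj : ∀ i ∈ T, ∀ j ∈ T, e i = e j → i = j := by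
    intro i hi j hj hij
    have h1 : sgn i = sgn j := by
      have h2 := (he i hi).2
      rw [hij, (he j hj).2] at h2
      exact (Quaternion.coe_injective h2).symm
    rcases sgn_eq_or i with h | h
    · have hj' := h1.symm.trans h
      simp only [e, if_pos h, if_pos hj'] at hij
      exact hfi i (Finset.mem_filter.2 ⟨hi, h⟩) j (Finset.mem_filter.2 ⟨hj, hj'⟩) hij
    · have hj' := h1.symm.trans h
      have hi1 : ¬ sgn i = 1 := by rw [h]; norm_num
      have hj1 : ¬ sgn j = 1 := by rw [hj']; norm_num
      simp only [e, if_neg hi1, if_neg hj1] at hij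
      exact hfi' i (Finset.mem_filter.2 ⟨hi, h⟩) j (Finset.mem_filter.2 ⟨hj, hj'⟩) hij
  obtain ⟨g, hg, hgl, hge⟩ := exists_isometry e (fun i hi => hET _ (he i hi).1) (fun i hi => (he i hi).2)
    fun i hi j hj hij => (hE _ (he i hi).1).2 _ (he j hj).1 fun h => hij (hinj i hi j hj h.symm)
  refine ⟨g, hg, hgl, fun i hi => by rw [hge i hi]; exact hEQ _ (he i hi).1, fun F hF => ?_⟩
  intro x hx i hxi
  rw [mem_smul_iff, inv_inv] at hx ⊢
  by_cases hi : i ∈ T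
  · rw [hge i hi]
    -- If `e i` is not in `F`, it is orthogonal to the members of `E` which span `F ⊓ spanOf T`,
    -- against the nonzero coefficient `x i`.
    by_contra hnot
    have h1 : herm (g x) (e i) ≠ 0 := by
      rw [← hge i hi, hg.2, herm_vec_right]
      exact smul_ne_zero (sgn_ne_zero i) hxi
    apply h1
    have hmem : res T (g x) ∈ F ⊓ spanOf T := ⟨(hT F hF).res_mem hx, res_mem _ _⟩
    have h2 : herm (g x) (e i) = herm (res T (g x)) (e i) := by
      conv_lhs => rw [← add_sub_cancel (res T (g x)) (g x), herm_add_left]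
      rw [herm_eq_sum' (x := g x - res T (g x)) (mem_spanOf.1 (hET _ (he i hi).1)),
        Finset.sum_eq_zero, add_zero]
      intro j hj; rw [sub_res_apply _ hj]; simp
    rw [h2]
    rw [← hEW (F ⊓ spanOf T) ⟨F, Or.inl hF, rfl⟩] at hmem
    refine Submodule.span_induction ?_ (herm_zero_left _) ?_ ?_ hmem
    · rintro b ⟨hb, hbF⟩
      exact (hE b hb).2 _ (he i hi).1 (by rintro rfl; exact hnot hbF.1)
    · intro a b _ _ ha hb; rw [herm_add_left, ha, hb, add_zero]
    · intro c a _ ha; rw [herm_smul_left, ha, mul_zero]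
  · have h1 : g (vec i) = vec i := hgl.1 i hi
    rw [h1]
    refine hT F hF _ hx i hi ?_
    rwa [show g x i = x i from hgl.apply_coord x hi]

/-- A chain of nondegenerate subspaces is conjugate to a chain of coordinate subspaces. -/
theorem exists_G₀_coord {C : Chain q} (hC : IsChain (· ≤ ·) C) {T : Finset (Idx q)}
    (hT : ∀ F ∈ C, Lev T F) (hN : ∀ F ∈ C, Nondeg F) :
    ∃ g ∈ G₀ q, ∀ F ∈ C, Coord (g • F) := by
  obtain ⟨g, hg, -, -, h⟩ := exists_coord_of_next hC hT (fun _ => True) (by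
    intro E hE _ F hF hEF hne
    have hF' : Lev T F ∧ Nondeg F := by
      rcases hF with hF | rfl
      · exact ⟨hT F hF, hN F hF⟩
      · exact ⟨lev_top T, nondeg_top⟩
    obtain ⟨e, he, h1, h2⟩ := (hF'.1.inf_nondeg hF'.2).exists_next hE hEF hne
    exact ⟨e, he, trivial, h1, h2⟩)
  exact ⟨g⁻¹, inv_mem hg, h⟩

/-- `F` is the sum of its intersections with the two summands. -/
def Split (F : Sub q) : Prop := ∀ x ∈ F, ∀ ε, IsSign ε → pr q ε x ∈ F

theorem splits_iff {C : Chain q} : Splits C ↔ ∀ F ∈ C, Split F := by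
  unfold Splits
  rw [Vpos_eq, Vneg_eq]
  refine forall₂_congr fun F _ => ⟨fun h x hx ε hε => ?_, fun h => le_antisymm (fun x hx => ?_)
    (sup_le inf_le_left inf_le_left)⟩
  · rw [h] at hx
    obtain ⟨a, ha, b, hb, rfl⟩ := Submodule.mem_sup.1 hx
    rw [map_add]
    rcases hε with rfl | rfl
    · rw [pr_of_mem ha.2, ← neg_neg (1 : ℝ), pr_neg_of_mem isSign_neg_one hb.2, add_zero]; exact ha.1
    · rw [pr_of_mem hb.2, pr_neg_of_mem isSign_one ha.2, zero_add]; exact hb.1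
  · rw [← pr_add_pr isSign_one x]
    exact Submodule.add_mem_sup ⟨h x hx 1 isSign_one, pr_mem _ _⟩
      ⟨h x hx (-1) isSign_neg_one, pr_mem _ _⟩

theorem Coord.mem_of_support {F : Sub q} {x : V q} (h : ∀ i, x i ≠ 0 → vec i ∈ F) : x ∈ F := by
  rw [eq_sum_vec (S := x.support) (x := x) (fun i hi => by simpa using hi)]
  exact sum_mem fun i hi => Submodule.smul_mem _ _ (h i (Finsupp.mem_support_iff.1 hi))

theorem Coord.split {F : Sub q} (h : Coord F) : Split F := by
  classical
  intro x hx ε _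
  refine Coord.mem_of_support fun i hi => h x hx i fun h0 => hi ?_
  rw [pr_apply, h0, ite_self]

theorem pr_mem_spanOf {T : Finset (Idx q)} {x : V q} (hx : x ∈ spanOf T) (ε : ℝ) :
    pr q ε x ∈ spanOf T := by
  classical
  exact mem_spanOf.2 fun i hi => by rw [pr_apply, mem_spanOf.1 hx i hi, ite_self]

/-- A chain of subspaces compatible with the decomposition is conjugate under `K₀` to a chain of
coordinate subspaces. -/
theorem exists_K₀_coord {C : Chain q} (hC : IsChain (· ≤ ·) C) {T : Finset (Idx q)}
    (hT : ∀ F ∈ C, Lev T F) (hN : ∀ F ∈ C, Split F) :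
    ∃ g ∈ K₀ q, ∀ F ∈ C, Coord (g • F) := by
  obtain ⟨g, hg, hgl, hgQ, h⟩ := exists_coord_of_next hC hT
    -- Adapted vectors which each lie in one of the summands give an isometry preserving the
    -- summands.
    (fun e => ∃ ε, IsSign ε ∧ e ∈ Vs q ε) (by
    intro E hE hEQ F hF hEF hne
    have hF' : Split F := by
      rcases hF with hF | rfl
      · exact hN F hF
      · exact fun _ _ _ _ => trivial
    have hex : ∃ w ∈ F ⊓ spanOf T, w ∉ Submodule.span ℍ[ℝ] (E : Set (V q)) := by
      by_contra hcon
      push Not at hcon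
      exact hne (le_antisymm (Submodule.span_le.2 hEF) hcon)
    obtain ⟨w, hw, hwE⟩ := hex
    have hex' : ∃ ε, IsSign ε ∧ pr q ε w ∉ Submodule.span ℍ[ℝ] (E : Set (V q)) := by
      by_contra hcon
      push Not at hcon
      apply hwE
      rw [← pr_add_pr isSign_one w]
      exact add_mem (hcon 1 isSign_one) (hcon _ isSign_neg_one)
    obtain ⟨ε, hε, hwε⟩ := hex'
    obtain ⟨p, hp, hpe, hpU⟩ := hE.exists_sub (pr q ε w)
    -- Only those members of `E` which are not orthogonal to `pr q ε w` enter `p`, and they all lie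
    -- in `V_ε`.
    have hpε : p ∈ Vs q ε := by
      refine hpU _ fun e he hne => ?_
      obtain ⟨ε', hε', heε'⟩ := hEQ e he
      by_cases hh : ε' = ε
      · rwa [← hh]
      · have : ε' = -ε := by
          rcases hε with rfl | rfl <;> rcases hε' with rfl | rfl <;> simp at hh ⊢
        rw [this] at heε'
        exact absurd (herm_Vs_Vs hε (pr_mem ε w) heε') hne
    have hv1 : pr q ε w - p ∈ Vs q ε := sub_mem (pr_mem _ _) hpε
    have hv2 : pr q ε w - p ∈ F ⊓ spanOf T :=
      sub_mem ⟨hF' w hw.1 ε hε, pr_mem_spanOf hw.2 ε⟩ (Submodule.span_le.2 hEF hp)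
    have hv0 : pr q ε w - p ≠ 0 := by
      intro h0
      rw [sub_eq_zero.1 h0] at hwε
      exact hwε hp
    have hv3 : (herm (pr q ε w - p) (pr q ε w - p)).re ≠ 0 := by
      intro h0
      have := def_Vs hε _ hv1 hv0
      rw [h0] at this
      simp at this
    obtain ⟨c, -, hc⟩ := exists_normalized hv3
    refine ⟨_, Submodule.smul_mem _ _ hv2, ⟨ε, hε, Submodule.smul_mem _ _ hv1⟩, hc, fun e he => ?_⟩
    rw [herm_smul_left, hpe e he, mul_zero])
  refine ⟨g⁻¹, inv_mem (mem_K₀_of_vec hg fun i => ?_), h⟩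
  by_cases hi : i ∈ T
  · obtain ⟨ε, hε, hmem⟩ := hgQ i hi
    have : sgn i = ε := by
      have h1 := def_Vs hε _ hmem ((map_ne_zero_iff g g.injective).2 (vec_ne_zero i))
      rw [hg.2, herm_vec_vec_self, Quaternion.re_coe] at h1
      rcases hε with rfl | rfl <;> rcases sgn_eq_or i with h | h <;> rw [h] at h1 ⊢ <;> norm_num at h1
    rwa [this]
  · rw [show g (vec i) = vec i from hgl.1 i hi]
    exact vec_mem_Vs rfl

/-! ### Sign preserving permutations -/

/-- Rank an element by the least cardinality of a set of the chain containing it, and sort by rank: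
each `A k` becomes an initial segment. -/
theorem exists_enumeration {α K : Type*} (X : Finset α) (A : K → Finset α) (hA : ∀ k, A k ⊆ X)
    (hc : ∀ k l, A k ⊆ A l ∨ A l ⊆ A k) :
    ∃ e : Fin X.card ≃ X, ∀ k j, (e j : α) ∈ A k ↔ j.1 < (A k).card := by
  classical
  -- An element of none of the sets gets a rank above all cardinalities, so it comes last.
  let r : X → ℕ := fun x => if ∃ k, (x : α) ∈ A k then sInf {n | ∃ k, (x : α) ∈ A k ∧ n = (A k).card}
    else X.card + 1
  have hr : ∀ (x : X) k, (x : α) ∈ A k ↔ r x ≤ (A k).card := by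
    intro x k
    constructor
    · intro h
      simp only [r, if_pos (⟨k, h⟩ : ∃ k, (x : α) ∈ A k)]
      exact Nat.sInf_le ⟨k, h, rfl⟩
    · intro h
      by_cases hex : ∃ k, (x : α) ∈ A k
      · simp only [r, if_pos hex] at h
        have hne : {n | ∃ k, (x : α) ∈ A k ∧ n = (A k).card}.Nonempty := by
          obtain ⟨l, hl⟩ := hex
          exact ⟨_, l, hl, rfl⟩
        obtain ⟨l, hl, hl'⟩ := Nat.sInf_mem hne
        rw [hl'] at h
        rcases hc l k with h' | h'
        · exact h' hl
        · rw [Finset.eq_of_subset_of_card_le h' h]; exact hl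
      · simp only [r, if_neg hex] at h
        have := Finset.card_le_card (hA k)
        omega
  let e₀ : Fin X.card ≃ X := X.equivFin.symm
  let e := (Tuple.sort (r ∘ e₀)).trans e₀
  have hmono : Monotone (r ∘ e) := Tuple.monotone_sort (r ∘ e₀)
  refine ⟨e, fun k => ?_⟩
  let L : Finset (Fin X.card) := Finset.univ.filter fun j => (e j : α) ∈ A k
  have hL : L.card = (A k).card := by
    refine Finset.card_bij (fun j _ => (e j : α)) (fun j hj => (Finset.mem_filter.1 hj).2)
      (fun i _ j _ h => e.injective (Subtype.ext h)) fun b hb => ?_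
    refine ⟨e.symm ⟨b, hA k hb⟩, Finset.mem_filter.2 ⟨Finset.mem_univ _, ?_⟩, ?_⟩ <;> simp [hb]
  have hlow : ∀ i j, i ≤ j → j ∈ L → i ∈ L := by
    intro i j hij hj
    refine Finset.mem_filter.2 ⟨Finset.mem_univ _, (hr _ _).2 ?_⟩
    exact (hmono hij).trans ((hr _ _).1 (Finset.mem_filter.1 hj).2)
  intro j
  have hjL : (e j : α) ∈ A k ↔ j ∈ L := by simp [L]
  rw [hjL, ← hL]
  constructor
  · intro hj
    have : Finset.Iic j ⊆ L := fun i hi => hlow i j (Finset.mem_Iic.1 hi) hj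
    have := Finset.card_le_card this
    rw [Fin.card_Iic] at this
    omega
  · intro hj
    by_contra hn
    have : L ⊆ Finset.Iio j := fun i hi => Finset.mem_Iio.2 (by
      by_contra hij
      exact hn (hlow j i (not_lt.1 hij) hi))
    have := Finset.card_le_card this
    rw [Fin.card_Iio] at this
    omega

/-- Enumerate `X` once for each chain, so that both chains consist of initial segments; equal
cardinalities then match them. -/
theorem exists_perm_of_chains {α K : Type*} (X : Finset α) (A A' : K → Finset α)
    (hA : ∀ k, A k ⊆ X) (hA' : ∀ k, A' k ⊆ X) (hc : ∀ k l, A k ⊆ A l ∨ A l ⊆ A k)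
    (hc' : ∀ k l, A' k ⊆ A' l ∨ A' l ⊆ A' k) (hcard : ∀ k, (A k).card = (A' k).card) :
    ∃ σ : X ≃ X, ∀ k (x : X), (x : α) ∈ A k ↔ (σ x : α) ∈ A' k := by
  obtain ⟨e, he⟩ := exists_enumeration X A hA hc
  obtain ⟨e', he'⟩ := exists_enumeration X A' hA' hc'
  refine ⟨e.symm.trans e', fun k x => ?_⟩
  have h1 := he k (e.symm x)
  rw [Equiv.apply_symm_apply] at h1
  rw [h1, Equiv.trans_apply, he', hcard]

/-- The indices in `T` of sign `ε` of the basis vectors in `F`. -/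
def idxIn (T : Finset (Idx q)) (ε : ℝ) (F : Sub q) : Finset (Idx q) :=
  open Classical in T.filter fun i => sgn i = ε ∧ vec i ∈ F

theorem mem_idxIn {T : Finset (Idx q)} {ε : ℝ} {F : Sub q} {i : Idx q} :
    i ∈ idxIn T ε F ↔ i ∈ T ∧ sgn i = ε ∧ vec i ∈ F := by
  classical
  unfold idxIn; rw [Finset.mem_filter]

theorem sum_smul_vec_apply (A : Finset (Idx q)) (c : Idx q → ℍ[ℝ]) {i : Idx q} (hi : i ∈ A) :
    (∑ a ∈ A, c a • (vec a : V q)) i = c i := by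
  rw [Finsupp.finsetSum_apply, Finset.sum_eq_single i]
  · simp [vec_apply_self]
  · intro b _ hb; simp [vec_apply_ne hb]
  · exact fun h => absurd hi h

/-- The `ε`-components of the images `g (vec i)` are independent by `hd`, and they lie in the span
of the basis vectors of sign `ε` in `g • F`. -/
theorem card_idxIn_le {T : Finset (Idx q)} {g : GLV q} (hg : AtLevel T (g : V q →ₗ[ℍ[ℝ]] V q))
    {F : Sub q} (hgF : Coord (g • F)) {ε : ℝ} (hd : ∀ x ∈ Vs q ε, g x ∈ Vs q (-ε) → x = 0)
    (hε : IsSign ε) : (idxIn T ε F).card ≤ (idxIn T ε (g • F)).card := by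
  classical
  refine card_le_of_independent _ (fun i => pr q ε (g (vec i))) _ (fun i hi => ?_) fun c hc => ?_
  · obtain ⟨hi, -, hiF⟩ := mem_idxIn.1 hi
    refine mem_spanOf.2 fun j hj => ?_
    rw [pr_apply]
    split_ifs with hjε
    · by_contra hne
      refine hj (mem_idxIn.2 ⟨?_, hjε, hgF _ (apply_mem_smul.2 hiF) j hne⟩)
      by_contra hjT
      exact hne (mem_spanOf.1 (hg.2 _ (vec_mem_spanOf hi)) j hjT)
    · rfl
  · have hx : (∑ i ∈ idxIn T ε F, c i • (vec i : V q)) = 0 := by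
      refine hd _ (sum_mem fun i hi => Submodule.smul_mem _ _ (vec_mem_Vs (mem_idxIn.1 hi).2.1)) ?_
      have h0 : pr q ε (g (∑ i ∈ idxIn T ε F, c i • (vec i : V q))) = 0 := by
        rw [map_sum, map_sum, ← hc]
        simp only [map_smul]
      rw [← pr_add_pr hε (g _), h0, zero_add]
      exact pr_mem _ _
    intro i hi
    rw [← sum_smul_vec_apply _ c hi, hx]; rfl

theorem card_idxIn_eq {T : Finset (Idx q)} {g : GLV q} (hg : AtLevel T (g : V q →ₗ[ℍ[ℝ]] V q))
    {F : Sub q} (hF : Coord F) (hgF : Coord (g • F))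
    (hd : ∀ ε, IsSign ε → ∀ x ∈ Vs q ε, g x ∈ Vs q (-ε) → x = 0) {ε : ℝ} (hε : IsSign ε) :
    (idxIn T ε F).card = (idxIn T ε (g • F)).card := by
  refine le_antisymm (card_idxIn_le hg hgF (hd ε hε) hε) ?_
  have h := card_idxIn_le (F := g • F) (ε := ε) (atLevel_inv hg) (by rwa [inv_smul_smul]) (fun x hx hgx => ?_) hε
  · rwa [inv_smul_smul] at h
  · have := hd (-ε) hε.neg _ hgx (by rwa [apply_inv_self, neg_neg])
    exact (map_eq_zero_iff g⁻¹ g⁻¹.injective).1 this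

theorem idxIn_mono {T : Finset (Idx q)} {ε : ℝ} {F F' : Sub q} (h : F ≤ F') :
    idxIn T ε F ⊆ idxIn T ε F' := fun _ hi =>
  mem_idxIn.2 ⟨(mem_idxIn.1 hi).1, (mem_idxIn.1 hi).2.1, h (mem_idxIn.1 hi).2.2⟩

/-- Two coordinate chains conjugate under an element of `G` which respects the signature are
conjugate under `K₀`. -/
theorem exists_K₀_of_coord {C : Chain q} (hC : IsChain (· ≤ ·) C) {g : GLV q} (hgG : g ∈ G q)
    (hCc : ∀ F ∈ C, Coord F) (hgC : ∀ F ∈ C, Coord (g • F))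
    (hd : ∀ ε, IsSign ε → ∀ x ∈ Vs q ε, g x ∈ Vs q (-ε) → x = 0) :
    ∃ k ∈ K₀ q, ∀ F ∈ C, k • F = g • F := by
  classical
  obtain ⟨T, hT⟩ := hgG
  have hg := levelSL_atLevel hT
  -- One permutation for each sign: both coordinate chains cut out chains of index sets of equal
  -- cardinalities.
  have hperm : ∀ ε, IsSign ε → ∃ σ : (T.filter fun i => sgn i = ε) ≃ (T.filter fun i => sgn i = ε),
      ∀ (F : C) (i : (T.filter fun i => sgn i = ε)), (i : Idx q) ∈ idxIn T ε F.1 ↔ (σ i : Idx q) ∈ idxIn T ε (g • F.1) := by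
    intro ε hε
    have hsub : ∀ F : Sub q, idxIn T ε F ⊆ T.filter fun i => sgn i = ε := fun F i hi =>
      Finset.mem_filter.2 ⟨(mem_idxIn.1 hi).1, (mem_idxIn.1 hi).2.1⟩
    refine exists_perm_of_chains _ (fun F : C => idxIn T ε F.1) (fun F : C => idxIn T ε (g • F.1))
      (fun _ => hsub _) (fun _ => hsub _) (fun F F' => ?_) (fun F F' => ?_)
      fun F => card_idxIn_eq hg (hCc F F.2) (hgC F F.2) hd hε
    · exact (hC.total F.2 F'.2).imp idxIn_mono idxIn_mono
    · exact (hC.total F.2 F'.2).imp (fun h => idxIn_mono (smul_le_smul_iff'.2 h))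
        fun h => idxIn_mono (smul_le_smul_iff'.2 h)
  choose σ hσ using hperm
  let p : Idx q → Idx q := fun i => if hi : i ∈ T then
    (σ (sgn i) (sgn_eq_or i) ⟨i, Finset.mem_filter.2 ⟨hi, rfl⟩⟩ : Idx q) else i
  have hp : ∀ i (hi : i ∈ T), p i = (σ (sgn i) (sgn_eq_or i) ⟨i, Finset.mem_filter.2 ⟨hi, rfl⟩⟩ : Idx q) :=
    fun i hi => dif_pos hi
  have hpT : ∀ i ∈ T, p i ∈ T ∧ sgn (p i) = sgn i := by
    intro i hi
    rw [hp i hi]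
    exact Finset.mem_filter.1 (σ (sgn i) (sgn_eq_or i) ⟨i, _⟩).2
  have hinj : ∀ i ∈ T, ∀ j ∈ T, p i = p j → i = j := by
    intro i hi j hj hij
    have hs : sgn i = sgn j := by rw [← (hpT i hi).2, hij, (hpT j hj).2]
    have hpε : ∀ ε (hε : IsSign ε) l (hl : l ∈ T) (h : sgn l = ε),
        p l = σ ε hε ⟨l, Finset.mem_filter.2 ⟨hl, h⟩⟩ := by
      rintro ε hε l hl rfl
      exact hp l hl
    rw [hpε _ (sgn_eq_or i) i hi rfl, hpε _ (sgn_eq_or i) j hj hs.symm] at hij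
    exact congrArg Subtype.val ((σ _ _).injective (Subtype.ext hij))
  obtain ⟨k, hk, hkl, hke⟩ := exists_isometry (T := T) (fun i => vec (p i))
    (fun i hi => vec_mem_spanOf (hpT i hi).1)
    (fun i hi => by rw [herm_vec_vec_self, (hpT i hi).2])
    (fun i hi j hj hij => herm_vec_vec_ne fun h => hij (hinj i hi j hj h))
  have hkvec : ∀ i, i ∉ T → k (vec i) = vec i := fun i hi => hkl.1 i hi
  refine ⟨k, mem_K₀_of_vec hk fun i => ?_, fun F hF => ?_⟩
  · by_cases hi : i ∈ T
    · rw [hke i hi]; exact vec_mem_Vs (hpT i hi).2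
    · rw [hkvec i hi]; exact vec_mem_Vs rfl
  · have hle : k • F ≤ g • F := by
      intro y hy
      obtain ⟨x, hx, rfl⟩ := (Submodule.mem_smul_pointwise_iff_exists _ _ _).1 hy
      change k x ∈ _
      rw [eq_sum_vec (S := x.support) (x := x) (fun i hi => by simpa using hi), map_sum]
      refine sum_mem fun i hi => ?_
      rw [map_smul]
      refine Submodule.smul_mem _ _ ?_
      have hiF := hCc F hF x hx i (Finsupp.mem_support_iff.1 hi)
      by_cases hiT : i ∈ T
      · rw [hke i hiT, hp i hiT]
        exact (mem_idxIn.1 ((hσ (sgn i) (sgn_eq_or i) ⟨F, hF⟩ ⟨i, _⟩).1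
          (mem_idxIn.2 ⟨hiT, rfl, hiF⟩))).2.2
      · rw [hkvec i hiT]
        have := apply_mem_smul (g := g).2 hiF
        rwa [show g (vec i) = vec i from hg.1 i hiT] at this
    -- The inclusion is enough, since an element of `G` mapping `F` into itself maps it onto itself.
    have h1 : (g⁻¹ * k) • F = F := by
      refine smul_eq_of_le (mul_mem (inv_mem ⟨T, hT⟩) (G₀_le hk)) ?_
      rw [mul_smul]
      have := smul_le_smul_iff' (g := g⁻¹).2 hle
      rwa [inv_smul_smul] at this
    rwa [mul_smul, inv_smul_eq_iff] at h1

/-! ### Reflections -/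

/-- The reflection in `w = u - v`. Equal lengths and a real value of `herm u v` give `2 * herm u w =
herm w w`, so that `u` is sent to `u - w = v`; vectors orthogonal to `u` and `v` are orthogonal to
`w` and stay fixed. -/
theorem exists_reflection {ε : ℝ} (hε : IsSign ε) {u v : V q} (hu : u ∈ Vs q ε) (hv : v ∈ Vs q ε)
    (huv : herm u u = herm v v) (hr : herm u v = ((herm u v).re : ℍ[ℝ])) :
    ∃ k ∈ K₀ q, k u = v ∧ ∀ z, herm z u = 0 → herm z v = 0 → k z = z := by
  classical
  by_cases hw : u = v
  · subst hw
    exact ⟨1, one_mem _, rfl, fun _ _ _ => rfl⟩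
  obtain ⟨w, hwdef⟩ : ∃ w, w = u - v := ⟨_, rfl⟩
  have hwε : w ∈ Vs q ε := hwdef ▸ sub_mem hu hv
  obtain ⟨m, hm⟩ : ∃ m, m = (herm w w).re := ⟨_, rfl⟩
  have hm0 : m ≠ 0 := by
    intro h0
    have := def_Vs hε _ hwε (hwdef ▸ sub_ne_zero.2 hw)
    rw [← hm, h0] at this
    simp at this
  have hww : herm w w = (m : ℍ[ℝ]) := hm ▸ herm_self w
  obtain ⟨r, hrdef⟩ : ∃ r : ℝ, r = 2 / m := ⟨_, rfl⟩
  have hrm : (m : ℍ[ℝ]) * (r : ℍ[ℝ]) = 2 := by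
    rw [← Quaternion.coe_mul, hrdef, mul_div_cancel₀ _ hm0]
    rfl
  let φ : V q →ₗ[ℍ[ℝ]] V q :=
    { toFun := fun z => z - (herm z w * (r : ℍ[ℝ])) • w
      map_add' := fun x y => by rw [herm_add_left, add_mul, add_smul]; abel
      map_smul' := fun a x => by
        rw [herm_smul_left, mul_assoc, mul_smul, RingHom.id_apply, smul_sub] }
  have hφ : ∀ z, φ z = z - (herm z w * (r : ℍ[ℝ])) • w := fun _ => rfl
  have hl : AtLevel w.support φ := by
    refine .of_vec (fun i hi => ?_) fun i hi => ?_
    · have : w i = 0 := by simpa using hi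
      rw [hφ, herm_vec_left, this]; simp
    · rw [hφ]
      refine sub_mem (vec_mem_spanOf hi) (Submodule.smul_mem _ _ (mem_spanOf.2 fun j hj => ?_))
      simpa using hj
  have hiso : ∀ x y, herm (φ x) (φ y) = herm x y := by
    intro x y
    rw [hφ, hφ, herm_sub_left, herm_sub_right, herm_sub_right, herm_smul_left, herm_smul_right,
      herm_smul_left, herm_smul_right, star_mul, Quaternion.star_coe, star_herm, hww]
    have h1 : (m : ℍ[ℝ]) * ((r : ℍ[ℝ]) * herm w y) = 2 * herm w y := by rw [← mul_assoc, hrm]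
    rw [h1, two_mul]
    noncomm_ring
  obtain ⟨k, hk, -, hkφ⟩ := exists_G₀_of_isometry hl hiso
  refine ⟨k, mem_K₀_of_vec hk fun i => ?_, ?_, fun z hzu hzv => ?_⟩
  · rw [hkφ, hφ]
    refine sub_mem (vec_mem_Vs rfl) ?_
    by_cases hi : sgn i = ε
    · rw [hi]; exact Submodule.smul_mem _ _ hwε
    · rw [herm_vec_left, mem_Vs.1 hwε i hi]; simp
  · rw [hkφ, hφ]
    have h1 : herm u w * (r : ℍ[ℝ]) = 1 := by
      have h2 : herm w w = 2 * herm u w := by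
        have h3 : herm v u = herm u v := by rw [← star_herm, hr, Quaternion.star_coe]
        rw [hwdef, herm_sub_left, herm_sub_right, herm_sub_right, h3, ← huv]
        noncomm_ring
      have h4 : (2 : ℍ[ℝ]) * (herm u w * (r : ℍ[ℝ])) = 2 * 1 := by
        rw [← mul_assoc, ← h2, hww, hrm, mul_one]
      exact mul_left_cancel₀ (fun h => two_ne_zero (α := ℝ) (Quaternion.coe_injective
      (show ((2 : ℝ) : ℍ[ℝ]) = ((0 : ℝ) : ℍ[ℝ]) from h))) h4
    rw [h1, one_smul, hwdef]; abel
  · rw [hkφ, hφ, hwdef, herm_sub_right, hzu, hzv]; simp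

/-- `K₀` is transitive on the lines in each of the two summands. -/
theorem exists_K₀_line {ε : ℝ} (hε : IsSign ε) {u v : V q} (hu : u ∈ Vs q ε) (hv : v ∈ Vs q ε)
    (hu0 : u ≠ 0) (hv0 : v ≠ 0) :
    ∃ k ∈ K₀ q, (∃ c : ℍ[ℝ], c ≠ 0 ∧ k u = c • v) ∧ ∀ z, herm z u = 0 → herm z v = 0 → k z = z := by
  -- A quaternionic phase: with `c = herm u v` the value `herm u (c • v) = c * star c` is real.
  obtain ⟨c, hc0, hc⟩ : ∃ c : ℍ[ℝ], c ≠ 0 ∧ herm u (c • v) = ((herm u (c • v)).re : ℍ[ℝ]) := by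
    by_cases h0 : herm u v = 0
    · exact ⟨1, one_ne_zero, by rw [one_smul, h0]; simp⟩
    · refine ⟨herm u v, h0, ?_⟩
      rw [herm_smul_right, Quaternion.self_mul_star, Quaternion.re_coe]
  have hcv : c • v ≠ 0 := smul_ne_zero hc0 hv0
  have h1 := def_Vs hε u hu hu0
  have h2 := def_Vs hε _ (Submodule.smul_mem _ c hv) hcv
  set a := (herm u u).re with ha
  set b := (herm (c • v) (c • v)).re with hb
  have hb0 : b ≠ 0 := by rintro h; rw [h] at h2; simp at h2
  have hab : 0 < a / b := by
    have hε0 : ε ≠ 0 := by rcases hε with rfl | rfl <;> norm_num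
    rw [← mul_div_mul_left a b hε0]; exact div_pos h1 h2
  -- The real factor which gives `c • v` the same length as `u`.
  set t := √(a / b) with ht
  have ht0 : t ≠ 0 := (Real.sqrt_pos.2 hab).ne'
  have hcoe : ∀ x : V q, herm u ((t : ℍ[ℝ]) • x) = (t : ℍ[ℝ]) * herm u x := fun x => by
    rw [herm_smul_right, Quaternion.star_coe, ← Quaternion.coe_commutes]
  obtain ⟨k, hk, hku, hkz⟩ := exists_reflection hε hu
    (Submodule.smul_mem _ (t : ℍ[ℝ]) (Submodule.smul_mem _ c hv)) (by
      rw [herm_self, herm_self ((t : ℍ[ℝ]) • _), herm_smul_smul_re, ← ha, ← hb, Quaternion.normSq_coe,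
        ht, Real.sq_sqrt hab.le, div_mul_cancel₀ _ hb0]) (by
      rw [hcoe, hc, ← Quaternion.coe_mul, Quaternion.re_coe])
  refine ⟨k, hk, ⟨(t : ℍ[ℝ]) * c, mul_ne_zero (fun h => ht0 ?_) hc0, by rw [hku, mul_smul]⟩,
    fun z hzu hzv => hkz z hzu ?_⟩
  · exact Quaternion.coe_injective (by rw [h]; simp)
  · rw [herm_smul_right, herm_smul_right, hzv]; simp

/-! ### Definite translates of the summands -/

theorem Coord.le_Vs {F : Sub q} (h : Coord F) {ε : ℝ} (hε : IsSign ε) (hF : Def ε F) : F ≤ Vs q ε := by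
  intro x hx
  refine mem_Vs.2 fun i hi => ?_
  by_contra hxi
  have := hF _ (h x hx i hxi) (vec_ne_zero i)
  rw [herm_vec_vec_self, Quaternion.re_coe, (hε.sgn_ne_iff i).1 hi, mul_neg, hε.mul_self] at this
  linarith

theorem Def.nondeg {F : Sub q} {ε : ℝ} (h : Def ε F) : Nondeg F := by
  intro x hx hxy
  refine h.eq_zero hx ?_
  rw [hxy x hx]; simp

theorem Def.smul {F : Sub q} {ε : ℝ} (h : Def ε F) {g : GLV q} (hg : g ∈ G₀ q) : Def ε (g • F) := by
  intro x hx hx0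
  rw [mem_smul_iff] at hx
  have := h _ hx ((map_ne_zero_iff g⁻¹ g⁻¹.injective).2 hx0)
  rwa [(inv_mem hg).2] at this

theorem isChain_three (W : Sub q) : IsChain (· ≤ ·) ({⊥, W, ⊤} : Chain q) := by
  rintro A hA B hB -
  simp only [Set.mem_insert_iff, Set.mem_singleton_iff] at hA hB
  rcases hA with rfl | rfl | rfl <;> rcases hB with rfl | rfl | rfl <;> simp

theorem nondeg_bot : Nondeg (⊥ : Sub q) := fun _ hx _ => (Submodule.mem_bot _).1 hx

theorem exists_G₀_coord_of_def {W : Sub q} {T : Finset (Idx q)} (hT : Lev T W) {ε : ℝ} (hW : Def ε W) :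
    ∃ g ∈ G₀ q, Coord (g • W) := by
  obtain ⟨g, hg, h⟩ := exists_G₀_coord (isChain_three W) (T := T) (by
    rintro F (rfl | rfl | rfl)
    · exact lev_bot T
    · exact hT
    · exact lev_top T) (by
    rintro F (rfl | rfl | rfl)
    · exact nondeg_bot
    · exact hW.nondeg
    · exact nondeg_top)
  exact ⟨g, hg, h W (by simp)⟩

/-- Definite translates of a summand are translates under the isometry group. -/
theorem exists_G₀_of_def {g : GLV q} (hg : g ∈ G q) {ε : ℝ} (hε : IsSign ε) (h : Def ε (g • Vs q ε)) :
    ∃ g₀ ∈ G₀ q, g • Vs q ε = g₀ • Vs q ε := by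
  obtain ⟨S, hS⟩ := hg
  obtain ⟨g₁, hg₁, hc⟩ := exists_G₀_coord_of_def
    (((coord_Vs ε).lev S).smul (levelSL_atLevel hS)) h
  have h1 : (g₁ * g) • Vs q ε = Vs q ε := by
    refine smul_eq_of_le (mul_mem (G₀_le hg₁) ⟨S, hS⟩) ?_
    rw [mul_smul]
    exact hc.le_Vs hε (h.smul hg₁)
  refine ⟨g₁⁻¹, inv_mem hg₁, ?_⟩
  rw [eq_inv_smul_iff, ← mul_smul, h1]

/-- A definite subspace containing `V_ε` contains the `V_{-ε}`-components of its vectors; these have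
both signs at once and vanish. -/
theorem maximal_Vs {ε : ℝ} (hε : IsSign ε) : Maximal (Def ε) (Vs q ε) := by
  refine ⟨def_Vs hε, fun W hW hle x hx => ?_⟩
  have h1 : pr q (-ε) x ∈ W := by
    have : pr q (-ε) x = x - pr q ε x := by rw [eq_sub_iff_add_eq', pr_add_pr hε]
    rw [this]; exact sub_mem hx (hle (pr_mem _ _))
  have h2 : pr q (-ε) x = 0 := by
    refine hW.eq_zero h1 ?_
    have := (def_Vs hε.neg).nonneg (pr_mem (-ε) x)
    linarith
  rw [← pr_add_pr hε x, h2, add_zero]; exact pr_mem _ _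

/-- For `x` in `F`, the vector `x - res S x` is in `F` and is fixed by `g`; so the intersection
misses at most the span of `S`. -/
theorem finiteCodimIn_smul {g : GLV q} (hg : g ∈ G q) {F : Sub q} (hF : Coord F) :
    FiniteCodimIn (g • F) F ∧ FiniteCodimIn F (g • F) := by
  obtain ⟨S, hS⟩ := hg
  have hl := levelSL_atLevel hS
  have key : ∀ y ∈ F, y - res S y ∈ g • F ⊓ F := fun y hy => by
    have h1 := (hF.lev S).sub_res_mem hy
    refine ⟨?_, h1⟩
    have := apply_mem_smul (g := g).2 h1
    rwa [show g (y - res S y) = y - res S y from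
      apply_of_disjoint hl.1 fun i hi => sub_res_apply y hi] at this
  refine ⟨⟨spanOf S, inferInstance, fun x hx => ?_⟩, ⟨spanOf S, inferInstance, fun y hy => ?_⟩⟩
  · have h1 := key _ (mem_smul_iff.1 hx)
    have h2 : x - (g⁻¹ x - res S (g⁻¹ x)) ∈ spanOf S := by
      have h3 : g⁻¹ x - x ∈ spanOf S := (atLevel_inv hl).sub_mem x
      have h4 := sub_mem (res_mem S (g⁻¹ x)) h3
      convert h4 using 1; abel
    have := Submodule.add_mem_sup h1 h2
    rwa [add_sub_cancel] at this
  · have h1 : y - res S y ∈ F ⊓ g • F := ⟨(key y hy).2, (key y hy).1⟩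
    have h2 := res_mem S y
    have := Submodule.add_mem_sup h1 h2
    rwa [sub_add_cancel] at this

/-- The images of the elements of `L` under `g` form the required basis; `g` fixes all but finitely
many of them. -/
theorem weaklyCompatible_smul {g : GLV q} (hg : g ∈ G q) {F : Sub q} (hF : Coord F) :
    WeaklyCompatible {⊥, g • F, ⊤} := by
  obtain ⟨S, hS⟩ := hg
  have hl := levelSL_atLevel hS
  have hli : LinearIndependent ℍ[ℝ] (fun i : Idx q => g (vec i)) :=
    (Finsupp.linearIndependent_single_one ℍ[ℝ] (Idx q)).map' (g : V q →ₗ[ℍ[ℝ]] V q)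
      (LinearEquiv.ker g)
  have hmem : ∀ F : Sub q, Coord F → ∀ x ∈ g • F,
      x ∈ Submodule.span ℍ[ℝ] (Set.range (fun i : Idx q => g (vec i)) ∩ (g • F : Sub q)) := by
    intro F hF x hx
    rw [mem_smul_iff] at hx
    rw [← apply_inv_self g x, eq_sum_vec (S := (g⁻¹ x).support) (x := g⁻¹ x) (fun i hi => by simpa using hi), map_sum]
    refine sum_mem fun i hi => ?_
    rw [map_smul]
    refine Submodule.smul_mem _ _ (Submodule.subset_span ⟨⟨i, rfl⟩, apply_mem_smul.2 ?_⟩)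
    exact hF _ hx i (Finsupp.mem_support_iff.1 hi)
  have htop : Coord (⊤ : Sub q) := fun _ _ _ _ => trivial
  refine ⟨Set.range fun i => g (vec i), ⟨hli.linearIndepOn_id, top_le_iff.1 fun x _ => ?_⟩, ?_, ?_⟩
  · have := hmem ⊤ htop x (by rw [smul_top']; trivial)
    exact Submodule.span_mono Set.inter_subset_left this
  · refine Set.Finite.subset (S.finite_toSet.image vec) ?_
    rintro _ ⟨⟨i, rfl⟩, hi⟩
    refine ⟨i, ?_, rfl⟩
    by_contra hiS
    exact hi ⟨i, hl.1 i hiS⟩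
  · rintro W hW
    refine le_antisymm (Submodule.span_le.2 Set.inter_subset_right) ?_
    rcases hW with rfl | rfl | rfl
    · exact bot_le
    · exact fun x hx => hmem F hF x hx
    · intro x hx
      have := hmem ⊤ htop x (by rw [smul_top']; trivial)
      rwa [smul_top'] at this

/-- The definite translates of a summand under `G` are the maximal definite subspaces which are
weakly compatible with `L` and commensurable to the summand. -/
theorem maximal_def_iff {ε : ℝ} (hε : IsSign ε) (W : Sub q) :
    (Maximal (Def ε) W ∧ FiniteCodimIn W (Vs q ε) ∧ FiniteCodimIn (Vs q ε) W ∧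
      WeaklyCompatible {⊥, W, ⊤}) ↔ (∃ g ∈ G q, W = g • Vs q ε) ∧ Def ε W := by
  constructor
  · rintro ⟨hmax, -, -, hw⟩
    obtain ⟨T, hT⟩ := hw.exists_lev
    obtain ⟨g, hg, hc⟩ := exists_G₀_coord_of_def (hT W (by simp)) hmax.prop
    refine ⟨⟨g⁻¹, inv_mem (G₀_le hg), ?_⟩, hmax.prop⟩
    have h1 : W ≤ g⁻¹ • Vs q ε := by
      have := smul_le_smul_iff' (g := g⁻¹).2 (hc.le_Vs hε (hmax.prop.smul hg))
      rwa [inv_smul_smul] at this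
    exact le_antisymm h1 (hmax.le_of_ge ((def_Vs hε).smul (inv_mem hg)) h1)
  · rintro ⟨⟨g, hg, rfl⟩, hdef⟩
    refine ⟨?_, (finiteCodimIn_smul hg (coord_Vs ε)).1, (finiteCodimIn_smul hg (coord_Vs ε)).2,
      weaklyCompatible_smul hg (coord_Vs ε)⟩
    obtain ⟨g₀, hg₀, h⟩ := exists_G₀_of_def hg hε hdef
    rw [h]
    refine ⟨(def_Vs hε).smul hg₀, fun W hW hle => ?_⟩
    have h1 : Vs q ε ≤ g₀⁻¹ • W := by
      have := smul_le_smul_iff' (g := g₀⁻¹).2 hle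
      rwa [inv_smul_smul] at this
    have h2 := (maximal_Vs hε).le_of_ge (hW.smul (inv_mem hg₀)) h1
    have := smul_le_smul_iff' (g := g₀).2 h2
    rwa [smul_inv_smul] at this

/-- The bounded symmetric domain of sign `ε`. -/
def Bs (q : ℕ∞) (ε : ℝ) : Set (Sub q) := {W | (∃ g ∈ G q, W = g • Vs q ε) ∧ Def ε W}

theorem Bpos_eq : Bpos q = Bs q 1 := by
  ext W
  have := maximal_def_iff isSign_one W
  rw [show Def (q := q) 1 = PosDef from funext fun _ => propext def_one, ← Vpos_eq] at this
  exact this.trans (by rw [Bs, Set.mem_ofPred_eq, ← Vpos_eq, def_one])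

theorem Bneg_eq : Bneg q = Bs q (-1) := by
  ext W
  have := maximal_def_iff isSign_neg_one W
  rw [show Def (q := q) (-1) = NegDef from funext fun _ => propext def_neg_one, ← Vneg_eq] at this
  exact this.trans (by rw [Bs, Set.mem_ofPred_eq, ← Vneg_eq, def_neg_one])

/-! ### Smooth families of endomorphisms -/

section Smooth
variable {X : Type*} [NormedAddCommGroup X] [NormedSpace ℝ X] {w : Set X}

/-- The family has smooth matrix entries, and each basis vector is mapped into a fixed finite
dimensional space. -/
def SmoothLin (T : X → V q →ₗ[ℍ[ℝ]] V q) (w : Set X) : Prop :=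
  ∀ i, (∃ S : Finset (Idx q), ∀ y ∈ w, T y (vec i) ∈ spanOf S) ∧
    ∀ j, ContDiffOn ℝ ∞ (fun y => T y (vec i) j) w

theorem AtLevel.apply_vec_mem {S : Finset (Idx q)} {T : V q →ₗ[ℍ[ℝ]] V q} (h : AtLevel S T)
    (i : Idx q) [DecidableEq (Idx q)] : T (vec i) ∈ spanOf (insert i S) := by
  have h1 := spanOf_mono (Finset.subset_insert i S) (h.sub_mem (vec i))
  have h2 : (vec i : V q) ∈ spanOf (insert i S) := vec_mem_spanOf (Finset.mem_insert_self i S)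
  have := add_mem h1 h2
  rwa [sub_add_cancel] at this

theorem SmoothLin.of_atLevel {T : X → V q →ₗ[ℍ[ℝ]] V q} {S : Finset (Idx q)}
    (h : ∀ y ∈ w, AtLevel S (T y)) (h' : ∀ i j, ContDiffOn ℝ ∞ (fun y => T y (vec i) j) w) :
    SmoothLin T w := by
  classical
  exact fun i => ⟨⟨insert i S, fun y hy => (h y hy).apply_vec_mem i⟩, h' i⟩

theorem SmoothLin.const (T : V q →ₗ[ℍ[ℝ]] V q) : SmoothLin (fun _ : X => T) w :=
  fun i => ⟨⟨(T (vec i)).support, fun _ _ => mem_spanOf.2 fun j hj => by simpa using hj⟩,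
    fun _ => contDiffOn_const⟩

theorem apply_coord_eq_sum (T : V q →ₗ[ℍ[ℝ]] V q) {S : Finset (Idx q)} {x : V q}
    (hx : x ∈ spanOf S) (j : Idx q) : T x j = ∑ k ∈ S, x k * T (vec k) j := by
  conv_lhs => rw [eq_sum_vec (S := S) (x := x) (mem_spanOf.1 hx), map_sum, Finsupp.finsetSum_apply]
  simp only [map_smul, Finsupp.smul_apply, smul_eq_mul]

/-- The inner family keeps the image of a basis vector in one finite dimensional space, so each
matrix entry of the composite is a sum over a fixed finite set. -/
theorem SmoothLin.comp {T T' : X → V q →ₗ[ℍ[ℝ]] V q} (h : SmoothLin T w) (h' : SmoothLin T' w) :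
    SmoothLin (fun y => T y ∘ₗ T' y) w := by
  classical
  intro i
  obtain ⟨⟨S, hS⟩, hs⟩ := h' i
  constructor
  · choose U hU using fun k => (h k).1
    refine ⟨S.biUnion U, fun y hy => ?_⟩
    rw [LinearMap.comp_apply, eq_sum_vec (S := S) (x := T' y (vec i)) (mem_spanOf.1 (hS y hy)), map_sum]
    refine sum_mem fun k hk => ?_
    rw [map_smul]
    exact Submodule.smul_mem _ _ (spanOf_mono (Finset.subset_biUnion_of_mem U hk) (hU k y hy))
  · intro j
    refine (ContDiffOn.sum (s := S) (f := fun k y => T' y (vec i) k * T y (vec k) j)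
      fun k _ => (hs k).mul ((h k).2 j)).congr fun y hy => ?_
    rw [LinearMap.comp_apply, apply_coord_eq_sum _ (hS y hy)]

theorem SmoothLin.add {T T' : X → V q →ₗ[ℍ[ℝ]] V q} (h : SmoothLin T w) (h' : SmoothLin T' w) :
    SmoothLin (fun y => T y + T' y) w := by
  classical
  intro i
  obtain ⟨⟨S, hS⟩, hs⟩ := h i
  obtain ⟨⟨S', hS'⟩, hs'⟩ := h' i
  refine ⟨⟨S ∪ S', fun y hy => ?_⟩, fun j => ?_⟩
  · rw [LinearMap.add_apply]
    exact add_mem (spanOf_mono Finset.subset_union_left (hS y hy))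
      (spanOf_mono Finset.subset_union_right (hS' y hy))
  · exact (hs j).add (hs' j)

theorem SmoothLin.neg {T : X → V q →ₗ[ℍ[ℝ]] V q} (h : SmoothLin T w) :
    SmoothLin (fun y => -T y) w := by
  intro i
  obtain ⟨⟨S, hS⟩, hs⟩ := h i
  exact ⟨⟨S, fun y hy => by rw [LinearMap.neg_apply]; exact neg_mem (hS y hy)⟩, fun j => (hs j).neg⟩

theorem SmoothLin.congr {T T' : X → V q →ₗ[ℍ[ℝ]] V q} (h : SmoothLin T w)
    (h' : ∀ y ∈ w, T' y = T y) : SmoothLin T' w := by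
  intro i
  obtain ⟨⟨S, hS⟩, hs⟩ := h i
  exact ⟨⟨S, fun y hy => by rw [h' y hy]; exact hS y hy⟩,
    fun j => (hs j).congr fun y hy => by rw [h' y hy]⟩

/-- The vector with the given coordinates. -/
def toVec (S : Finset (Idx q)) (a : S → ℍ[ℝ]) : V q := ∑ k : S, a k • vec k.1

theorem toVec_mem (S : Finset (Idx q)) (a : S → ℍ[ℝ]) : toVec S a ∈ spanOf S :=
  sum_mem fun k _ => Submodule.smul_mem _ _ (vec_mem_spanOf k.2)

theorem toVec_apply (S : Finset (Idx q)) (a : S → ℍ[ℝ]) (k : S) : toVec S a k = a k := by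
  unfold toVec
  rw [Finsupp.finsetSum_apply, Finset.sum_eq_single k]
  · simp [vec_apply_self]
  · intro b _ hb
    rw [Finsupp.smul_apply, vec_apply_ne fun h => hb (Subtype.ext h), smul_zero]
  · exact fun h => absurd (Finset.mem_univ k) h

theorem toVec_coords {S : Finset (Idx q)} {x : V q} (hx : x ∈ spanOf S) :
    toVec S (fun k => x k) = x := by
  ext1 i
  by_cases hi : i ∈ S
  · exact toVec_apply S _ ⟨i, hi⟩
  · rw [mem_spanOf.1 hx i hi, mem_spanOf.1 (toVec_mem S _) i hi]

theorem apply_toVec (T : V q →ₗ[ℍ[ℝ]] V q) (S : Finset (Idx q)) (a : S → ℍ[ℝ]) (j : Idx q) :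
    T (toVec S a) j = ∑ k : S, a k * T (vec k.1) j := by
  unfold toVec
  rw [map_sum, Finsupp.finsetSum_apply]
  simp only [map_smul, Finsupp.smul_apply, smul_eq_mul]

/-- The real-linear map on coordinate vectors induced by an endomorphism. -/
def coordMap (S : Finset (Idx q)) (T : V q →ₗ[ℍ[ℝ]] V q) : (S → ℍ[ℝ]) →L[ℝ] (S → ℍ[ℝ]) :=
  LinearMap.toContinuousLinearMap
    { toFun := fun a j => T (toVec S a) j
      map_add' := fun a b => by
        ext1 j
        simp only [Pi.add_apply, apply_toVec, add_mul, Finset.sum_add_distrib]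
      map_smul' := fun c a => by
        ext1 j
        simp only [Pi.smul_apply, apply_toVec, smul_mul_assoc, Finset.smul_sum, RingHom.id_apply] }

theorem coordMap_apply (S : Finset (Idx q)) (T : V q →ₗ[ℍ[ℝ]] V q) (a : S → ℍ[ℝ]) (j : S) :
    coordMap S T a j = T (toVec S a) j := rfl

theorem coordMap_comp {S : Finset (Idx q)} {T T' : V q →ₗ[ℍ[ℝ]] V q} (h : AtLevel S T') :
    (coordMap S T).comp (coordMap S T') = coordMap S (T ∘ₗ T') := by
  ext1 a
  funext j
  rw [ContinuousLinearMap.comp_apply, coordMap_apply, coordMap_apply, LinearMap.comp_apply]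
  congr 2
  exact toVec_coords (h.2 _ (toVec_mem S a))

theorem coordMap_id (S : Finset (Idx q)) :
    coordMap S (LinearMap.id : V q →ₗ[ℍ[ℝ]] V q) = ContinuousLinearMap.id ℝ _ := by
  ext1 a
  funext j
  exact toVec_apply S a j

theorem contDiffOn_coordMap {T : X → V q →ₗ[ℍ[ℝ]] V q} (h : SmoothLin T w) (S : Finset (Idx q)) :
    ContDiffOn ℝ ∞ (fun y => coordMap S (T y)) w := by
  rw [contDiffOn_clm_apply]
  intro a
  rw [contDiffOn_pi]
  intro j
  simp only [coordMap_apply, apply_toVec]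
  exact ContDiffOn.sum fun k _ => contDiffOn_const.mul ((h k.1).2 j)

/-- At level `S` everything happens on the finite dimensional coordinate space of `S`, where
inversion of continuous linear maps is smooth at invertible ones; outside, the entries are constant.
-/
theorem SmoothLin.inv {g : X → GLV q} {S : Finset (Idx q)}
    (hl : ∀ y ∈ w, AtLevel S (g y : V q →ₗ[ℍ[ℝ]] V q))
    (h : SmoothLin (fun y => (g y : V q →ₗ[ℍ[ℝ]] V q)) w) :
    SmoothLin (fun y => ((g y)⁻¹ : GLV q).toLinearMap) w := by
  classical
  refine .of_atLevel (S := S) (fun y hy => atLevel_inv (hl y hy)) fun i j => ?_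
  have hid1 : ∀ y, (g y).toLinearMap ∘ₗ ((g y)⁻¹ : GLV q).toLinearMap = LinearMap.id := fun y =>
    LinearMap.ext fun x => apply_inv_self (g y) x
  have hid2 : ∀ y, ((g y)⁻¹ : GLV q).toLinearMap ∘ₗ (g y).toLinearMap = LinearMap.id := fun y =>
    LinearMap.ext fun x => inv_apply_self (g y) x
  have hinv : ∀ y ∈ w, ContinuousLinearMap.inverse (coordMap S (g y).toLinearMap) =
      coordMap S ((g y)⁻¹ : GLV q).toLinearMap := fun y hy => by
    refine ContinuousLinearMap.inverse_eq ?_ ?_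
    · rw [coordMap_comp (atLevel_inv (hl y hy)), hid1, coordMap_id]
    · rw [coordMap_comp (hl y hy), hid2, coordMap_id]
  have hsm : ContDiffOn ℝ ∞ (fun y => ContinuousLinearMap.inverse (coordMap S (g y).toLinearMap)) w := by
    intro y hy
    let e : (S → ℍ[ℝ]) ≃L[ℝ] (S → ℍ[ℝ]) := ContinuousLinearEquiv.equivOfInverse'
      (coordMap S (g y).toLinearMap) (coordMap S ((g y)⁻¹ : GLV q).toLinearMap)
      (by rw [coordMap_comp (atLevel_inv (hl y hy)), hid1, coordMap_id])
      (by rw [coordMap_comp (hl y hy), hid2, coordMap_id])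
    have h1 : ContDiffAt ℝ ∞ ContinuousLinearMap.inverse (coordMap S (g y).toLinearMap) :=
      contDiffAt_map_inverse e
    exact h1.comp_contDiffWithinAt y (contDiffOn_coordMap h S y hy)
  by_cases hi : i ∈ S
  · by_cases hj : j ∈ S
    · have h2 := (contDiffOn_pi.1 ((contDiffOn_clm_apply.1 hsm) fun k => (vec i : V q) k)) ⟨j, hj⟩
      refine h2.congr fun y hy => ?_
      rw [hinv y hy, coordMap_apply, toVec_coords (vec_mem_spanOf hi)]
    · refine (contDiffOn_const (c := (0 : ℍ[ℝ]))).congr fun y hy => ?_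
      exact mem_spanOf.1 ((atLevel_inv (hl y hy)).2 _ (vec_mem_spanOf hi)) j hj
  · refine (contDiffOn_const (c := (vec i : V q) j)).congr fun y hy => ?_
    rw [(atLevel_inv (hl y hy)).1 i hi]

/-! ### Unipotent families -/

/-- `N` maps the summand of sign `ε` into the other one, which it annihilates, at level `S`. -/
structure Off (ε : ℝ) (S : Finset (Idx q)) (N : V q →ₗ[ℍ[ℝ]] V q) : Prop where
  mem : ∀ x, N x ∈ Vs q (-ε)
  ker : ∀ x ∈ Vs q (-ε), N x = 0
  fix : ∀ i ∉ S, N (vec i) = 0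
  span : ∀ x, N x ∈ spanOf S

/-- The automorphism `1 + N`, if `N` has square zero. -/
def uni (N : V q →ₗ[ℍ[ℝ]] V q) : GLV q :=
  open Classical in
  if h : ∀ x, N (N x) = 0 then
    LinearEquiv.ofLinearMap (LinearMap.id + N) (LinearMap.id - N)
      (LinearMap.ext fun x => by
        simp only [LinearMap.comp_apply, LinearMap.add_apply, LinearMap.sub_apply, LinearMap.id_apply,
          map_sub, h]
        abel)
      (LinearMap.ext fun x => by
        simp only [LinearMap.comp_apply, LinearMap.add_apply, LinearMap.sub_apply, LinearMap.id_apply,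
          map_add, h]
        abel)
  else 1

theorem uni_apply {N : V q →ₗ[ℍ[ℝ]] V q} (h : ∀ x, N (N x) = 0) (x : V q) : uni N x = x + N x := by
  unfold uni
  rw [dif_pos h]; rfl

theorem uni_mem {N : V q →ₗ[ℍ[ℝ]] V q} (h : ∀ x, N (N x) = 0) {S : Finset (Idx q)}
    (hf : ∀ i ∉ S, N (vec i) = 0) (hs : ∀ x, N x ∈ spanOf S) : uni N ∈ levelSL S := by
  refine mem_levelSL_of_sq_zero N (uni_apply h) h ⟨fun i hi => ?_, fun x hx => ?_⟩
  · exact (uni_apply h _).trans (by rw [hf i hi, add_zero])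
  · have : uni N x ∈ spanOf S := by rw [uni_apply h]; exact add_mem hx (hs x)
    exact this

namespace Off
variable {ε : ℝ} {S : Finset (Idx q)} {N : V q →ₗ[ℍ[ℝ]] V q}

theorem sq (h : Off ε S N) (x : V q) : N (N x) = 0 := h.ker _ (h.mem x)

theorem uni_apply (h : Off ε S N) (x : V q) : uni N x = x + N x := QuatCycle.uni_apply h.sq x

theorem uni_mem (h : Off ε S N) : uni N ∈ levelSL S := QuatCycle.uni_mem h.sq h.fix h.span

theorem zero : Off ε S (0 : V q →ₗ[ℍ[ℝ]] V q) :=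
  ⟨fun _ => zero_mem _, fun _ _ => rfl, fun _ _ => rfl, fun _ => zero_mem _⟩

theorem uni_neg_smul (h : Off ε S N) : uni N • Vs q (-ε) = Vs q (-ε) :=
  smul_eq_of_le ⟨S, h.uni_mem⟩ fun x hx => by
    obtain ⟨y, hy, rfl⟩ := (Submodule.mem_smul_pointwise_iff_exists _ _ _).1 hx
    change uni N y ∈ _
    rw [h.uni_apply, h.ker y hy, add_zero]; exact hy

theorem toLinearMap_uni (h : Off ε S N) : (uni N).toLinearMap = LinearMap.id + N :=
  LinearMap.ext h.uni_apply

end Off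

/-- A subspace complementary to `V_{-ε}` is the graph of a map `V_ε → V_{-ε}`, which depends
smoothly on it. -/
theorem exists_chart {ε : ℝ} (hε : IsSign ε) {g : X → GLV q} {S : Finset (Idx q)}
    (hl : ∀ y ∈ w, g y ∈ levelSL S) (h : SmoothLin (fun y => (g y : V q →ₗ[ℍ[ℝ]] V q)) w)
    (hd : ∀ y ∈ w, ∀ x ∈ Vs q ε, g y x ∈ Vs q (-ε) → x = 0) :
    ∃ N : X → V q →ₗ[ℍ[ℝ]] V q, (∀ y, Off ε S (N y)) ∧ SmoothLin N w ∧
      ∀ y ∈ w, uni (N y) • Vs q ε = g y • Vs q ε := by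
  classical
  have hprS : ∀ ε' (x : V q), x ∈ spanOf S → pr q ε' x ∈ spanOf S := fun ε' x hx => pr_mem_spanOf hx ε'
  have hprv : ∀ i, (sgn i = ε → pr q ε (vec i) = vec i ∧ pr q (-ε) (vec i) = 0) ∧
      (sgn i = -ε → pr q ε (vec i) = 0 ∧ pr q (-ε) (vec i) = vec i) := fun i =>
    ⟨fun hi => ⟨pr_of_mem (vec_mem_Vs hi), pr_neg_of_mem hε (vec_mem_Vs hi)⟩,
      fun hi => ⟨by have := pr_neg_of_mem hε.neg (vec_mem_Vs hi); rwa [neg_neg] at this,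
        pr_of_mem (vec_mem_Vs hi)⟩⟩
  -- The diagonal block `V_ε → V_ε` of `g`, completed by the identity of `V_{-ε}`. By `hd` it is
  -- invertible.
  let A₀ : X → V q →ₗ[ℍ[ℝ]] V q := fun y => pr q ε ∘ₗ (g y).toLinearMap ∘ₗ pr q ε + pr q (-ε)
  have hA₀ : ∀ y x, A₀ y x = pr q ε (g y (pr q ε x)) + pr q (-ε) x := fun _ _ => rfl
  have hA₀l : ∀ y ∈ w, AtLevel S (A₀ y) := fun y hy => by
    have hgl := levelSL_atLevel (hl y hy)
    refine .of_vec (fun i hi => ?_) fun i hi => ?_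
    · rw [hA₀]
      rcases hε.sgn_or i with h' | h'
      · have h3 : g y (vec i) = vec i := hgl.1 i hi
        rw [((hprv i).1 h').1, ((hprv i).1 h').2, h3, ((hprv i).1 h').1, add_zero]
      · rw [((hprv i).2 h').1, ((hprv i).2 h').2, map_zero, map_zero, zero_add]
    · rw [hA₀]
      exact add_mem (hprS _ _ (hgl.2 _ (hprS _ _ (vec_mem_spanOf hi)))) (hprS _ _ (vec_mem_spanOf hi))
  have hA₀i : ∀ y ∈ w, Function.Bijective (A₀ y) := fun y hy =>
    (hA₀l y hy).bijective fun x _ hx => by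
      rw [hA₀] at hx
      have h1 : pr q (-ε) x = 0 := by
        have := congrArg (pr q (-ε)) hx
        rwa [map_add, pr_neg_of_mem hε (pr_mem _ _), pr_of_mem (pr_mem _ _), zero_add, map_zero] at this
      have h2 : pr q ε (g y (pr q ε x)) = 0 := by rwa [h1, add_zero] at hx
      have h3 : pr q ε x = 0 := by
        refine hd y hy _ (pr_mem _ _) ?_
        rw [← pr_add_pr hε (g y _), h2, zero_add]; exact pr_mem _ _
      rw [← pr_add_pr hε x, h1, h3, add_zero]
  let A : X → GLV q := fun y => if hy : y ∈ w then LinearEquiv.ofBijective (A₀ y) (hA₀i y hy) else 1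
  have hA : ∀ y ∈ w, (A y).toLinearMap = A₀ y := fun y hy => by
    simp only [A, dif_pos hy]; rfl
  have hA' : ∀ y ∈ w, ∀ x, A y x = pr q ε (g y (pr q ε x)) + pr q (-ε) x := fun y hy x => by
    rw [← hA₀, ← hA y hy]; rfl
  have hAl : ∀ y ∈ w, AtLevel S (A y).toLinearMap := fun y hy => by rw [hA y hy]; exact hA₀l y hy
  have hAs : SmoothLin (fun y => (A y).toLinearMap) w :=
    (((SmoothLin.const (pr q ε)).comp (h.comp (SmoothLin.const (pr q ε)))).add
      (SmoothLin.const (pr q (-ε)))).congr hA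
  have hBs := SmoothLin.inv hAl hAs
  have hBε : ∀ y ∈ w, ∀ x ∈ Vs q ε, (A y)⁻¹ x ∈ Vs q ε ∧ pr q ε (g y ((A y)⁻¹ x)) = x := by
    intro y hy x hx
    have h1 := hA' y hy ((A y)⁻¹ x)
    rw [apply_inv_self] at h1
    have h2 : pr q (-ε) ((A y)⁻¹ x) = 0 := by
      have := congrArg (pr q (-ε)) h1
      rw [map_add, pr_neg_of_mem hε (pr_mem _ _), pr_of_mem (pr_mem (-ε) _), zero_add,
        pr_neg_of_mem hε hx] at this
      exact this.symm
    have h3 : pr q ε ((A y)⁻¹ x) = (A y)⁻¹ x := by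
      conv_rhs => rw [← pr_add_pr hε ((A y)⁻¹ x), h2, add_zero]
    rw [h2, add_zero, h3] at h1
    exact ⟨h3 ▸ pr_mem _ _, h1.symm⟩
  -- The lower block of `g` composed with the inverse of the diagonal block: the slope of the graph.
  let N₀ : X → V q →ₗ[ℍ[ℝ]] V q := fun y =>
    pr q (-ε) ∘ₗ (g y).toLinearMap ∘ₗ ((A y)⁻¹ : GLV q).toLinearMap ∘ₗ pr q ε
  have hN₀ : ∀ y x, N₀ y x = pr q (-ε) (g y ((A y)⁻¹ (pr q ε x))) := fun _ _ => rfl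
  have hN₀f : ∀ y ∈ w, ∀ i ∉ S, N₀ y (vec i) = 0 := fun y hy i hi => by
    rw [hN₀]
    rcases hε.sgn_or i with h' | h'
    · have h3 : g y (vec i) = vec i := (levelSL_atLevel (hl y hy)).1 i hi
      have h4 : (A y)⁻¹ (vec i) = vec i := (atLevel_inv (hAl y hy)).1 i hi
      rw [((hprv i).1 h').1, h4, h3, ((hprv i).1 h').2]
    · rw [((hprv i).2 h').1, map_zero, map_zero, map_zero]
  have hN₀O : ∀ y ∈ w, Off ε S (N₀ y) := fun y hy => by
    refine ⟨fun x => ?_, fun x hx => ?_, hN₀f y hy, fun x => ?_⟩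
    · rw [hN₀]; exact pr_mem _ _
    · have := pr_neg_of_mem hε.neg hx
      rw [neg_neg] at this
      rw [hN₀, this, map_zero, map_zero, map_zero]
    · have h0 : N₀ y (x - res S x) = 0 := by
        rw [eq_sum_vec (S := (x - res S x).support) (x := x - res S x) (fun i hi => by simpa using hi),
          map_sum]
        refine Finset.sum_eq_zero fun i hi => ?_
        rw [map_smul, hN₀f y hy i, smul_zero]
        intro hiS
        exact Finsupp.mem_support_iff.1 hi (sub_res_apply x hiS)
      rw [← add_sub_cancel (res S x) x, map_add, h0, add_zero, hN₀]
      exact hprS _ _ ((levelSL_atLevel (hl y hy)).2 _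
        ((atLevel_inv (hAl y hy)).2 _ (hprS _ _ (res_mem S x))))
  -- The value `0` off `w` gives the algebraic properties at every `y`.
  refine ⟨fun y => if y ∈ w then N₀ y else 0, fun y => ?_, ?_, fun y hy => ?_⟩
  · dsimp only
    split_ifs with hy
    · exact hN₀O y hy
    · exact Off.zero
  · exact ((SmoothLin.const (pr q (-ε))).comp (h.comp (hBs.comp (SmoothLin.const (pr q ε))))).congr
      fun y hy => if_pos hy
  · dsimp only
    rw [if_pos hy]
    have key : ∀ x ∈ Vs q ε, uni (N₀ y) x = g y ((A y)⁻¹ x) := fun x hx => by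
      rw [(hN₀O y hy).uni_apply, hN₀, pr_of_mem hx]
      conv_rhs => rw [← pr_add_pr hε (g y ((A y)⁻¹ x)), (hBε y hy x hx).2]
    refine le_antisymm (fun z hz => ?_) fun z hz => ?_
    · obtain ⟨x, hx, rfl⟩ := (Submodule.mem_smul_pointwise_iff_exists _ _ _).1 hz
      change uni (N₀ y) x ∈ _
      rw [key x hx, apply_mem_smul]
      exact (hBε y hy x hx).1
    · obtain ⟨x, hx, rfl⟩ := (Submodule.mem_smul_pointwise_iff_exists _ _ _).1 hz
      change g y x ∈ _
      have h1 : A y x ∈ Vs q ε := by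
        rw [hA' y hy, pr_neg_of_mem hε hx, add_zero]; exact pr_mem _ _
      have h2 := key _ h1
      rw [inv_apply_self] at h2
      rw [← h2, apply_mem_smul]; exact h1

end Smooth

/-! ### Simultaneous charts for a pair of subspaces, and openness of definiteness. -/

section Smooth
variable {X : Type*} [NormedAddCommGroup X] [NormedSpace ℝ X] {w : Set X}

theorem SmoothLin.apply {T : X → V q →ₗ[ℍ[ℝ]] V q} (h : SmoothLin T w) (x : V q) :
    (∃ S : Finset (Idx q), ∀ y ∈ w, T y x ∈ spanOf S) ∧
      ∀ j, ContDiffOn ℝ ∞ (fun y => T y x j) w := by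
  classical
  have hx : ∀ i ∉ x.support, x i = 0 := fun i hi => by simpa using hi
  constructor
  · choose U hU using fun k => (h k).1
    refine ⟨x.support.biUnion U, fun y hy => ?_⟩
    have h1 : T y x = ∑ k ∈ x.support, T y (x k • vec k) := by
      conv_lhs => rw [eq_sum_vec hx, map_sum]
    rw [h1]
    refine sum_mem fun k hk => ?_
    rw [map_smul]
    exact Submodule.smul_mem _ _ (spanOf_mono (Finset.subset_biUnion_of_mem U hk) (hU k y hy))
  · intro j
    refine (ContDiffOn.sum (s := x.support) (f := fun k y => x k * T y (vec k) j)
      fun k _ => contDiffOn_const.mul ((h k).2 j)).congr fun y hy => ?_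
    rw [apply_coord_eq_sum _ (mem_spanOf.2 hx)]

theorem contDiffOn_star {f : X → ℍ[ℝ]} (h : ContDiffOn ℝ ∞ f w) :
    ContDiffOn ℝ ∞ (fun y => star (f y)) w :=
  (LinearMap.toContinuousLinearMap
    ({ toFun := fun a => star a, map_add' := star_add,
       map_smul' := fun c a => by simp [Quaternion.star_smul] } : ℍ[ℝ] →ₗ[ℝ] ℍ[ℝ])).contDiff.comp_contDiffOn h

theorem contDiffOn_re {f : X → ℍ[ℝ]} (h : ContDiffOn ℝ ∞ f w) :
    ContDiffOn ℝ ∞ (fun y => (f y).re) w := by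
  have h1 : ContDiff ℝ ∞ (fun a : ℍ[ℝ] => a.re) :=
    (LinearMap.toContinuousLinearMap
      ({ toFun := fun a => a.re, map_add' := fun _ _ => rfl, map_smul' := fun _ _ => rfl } :
        ℍ[ℝ] →ₗ[ℝ] ℝ)).contDiff
  exact h1.comp_contDiffOn h

theorem contDiffOn_herm {f g : X → V q} {S : Finset (Idx q)} (hS : ∀ y ∈ w, f y ∈ spanOf S)
    (hf : ∀ j, ContDiffOn ℝ ∞ (fun y => f y j) w) (hg : ∀ j, ContDiffOn ℝ ∞ (fun y => g y j) w) :
    ContDiffOn ℝ ∞ (fun y => herm (f y) (g y)) w := by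
  refine (ContDiffOn.sum (s := S) (f := fun i y => sgn i • (f y i * star (g y i)))
    fun i _ => ((hf i).mul (contDiffOn_star (hg i))).const_smul _).congr fun y hy => ?_
  rw [herm_eq_sum (mem_spanOf.1 (hS y hy))]

theorem SmoothLin.herm {T T' : X → V q →ₗ[ℍ[ℝ]] V q} (h : SmoothLin T w) (h' : SmoothLin T' w)
    (x x' : V q) : ContDiffOn ℝ ∞ (fun y => herm (T y x) (T' y x')) w := by
  obtain ⟨⟨S, hS⟩, hs⟩ := h.apply x
  exact contDiffOn_herm hS hs (h'.apply x').2

/-- `g x` belongs to a subspace of sign `ε` and to one of sign `-ε`. This transversality is what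
`exists_chart` asks for. -/
theorem Off.def_inj {ε : ℝ} (hε : IsSign ε) {g : GLV q} (h : Def ε (g • Vs q ε)) (x : V q)
    (hx : x ∈ Vs q ε) (hgx : g x ∈ Vs q (-ε)) : x = 0 := by
  have h1 := (def_Vs hε.neg).nonneg hgx
  have h2 := h.eq_zero (apply_mem_smul.2 hx) (by linarith)
  simpa using h2

/-- A pair of complementary definite subspaces is simultaneously a translate of the standard pair,
smoothly in parameters. -/
theorem exists_prod_chart {ε : ℝ} (hε : IsSign ε) {g g' : X → GLV q} {S : Finset (Idx q)}
    (hl : ∀ y ∈ w, g y ∈ levelSL S) (h : SmoothLin (fun y => (g y : V q →ₗ[ℍ[ℝ]] V q)) w)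
    (hl' : ∀ y ∈ w, g' y ∈ levelSL S) (h' : SmoothLin (fun y => (g' y : V q →ₗ[ℍ[ℝ]] V q)) w)
    (hd : ∀ y ∈ w, Def ε (g y • Vs q ε)) (hd' : ∀ y ∈ w, Def (-ε) (g' y • Vs q (-ε))) :
    ∃ δ : X → GLV q, (∀ y ∈ w, δ y ∈ levelSL S) ∧
      SmoothLin (fun y => (δ y : V q →ₗ[ℍ[ℝ]] V q)) w ∧
      ∀ y ∈ w, δ y • Vs q ε = g y • Vs q ε ∧ δ y • Vs q (-ε) = g' y • Vs q (-ε) := by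
  classical
  obtain ⟨N, hN, hNs, hNg⟩ := exists_chart hε hl h fun y hy => Off.def_inj hε (hd y hy)
  obtain ⟨N', hN', hNs', hNg'⟩ := exists_chart hε.neg hl' h' fun y hy => Off.def_inj hε.neg (hd' y hy)
  have hmem' : ∀ y x, N' y x ∈ Vs q ε := fun y x => by
    have := (hN' y).mem x
    rwa [neg_neg] at this
  have hker' : ∀ y, ∀ x ∈ Vs q ε, N' y x = 0 := fun y x hx => (hN' y).ker x (by rwa [neg_neg])
  -- The two graphs meet only in `0`, being definite of opposite signs; this makes `1 - N N'`
  -- injective.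
  let B₀ : X → V q →ₗ[ℍ[ℝ]] V q := fun y => LinearMap.id + -(N y ∘ₗ N' y)
  have hB₀ : ∀ y x, B₀ y x = x - N y (N' y x) := fun y x => (sub_eq_add_neg _ _).symm
  have hB₀l : ∀ y, AtLevel S (B₀ y) := fun y =>
    .of_vec (fun i hi => by rw [hB₀, (hN' y).fix i hi, map_zero, sub_zero]) fun i hi => by
      rw [hB₀]; exact sub_mem (vec_mem_spanOf hi) ((hN y).span _)
  have hBi : ∀ y ∈ w, Function.Bijective (B₀ y) := fun y hy =>
    (hB₀l y).bijective fun x _ hx => by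
      rw [hB₀, sub_eq_zero] at hx
      have hxm : x ∈ Vs q (-ε) := by rw [hx]; exact (hN y).mem _
      have h1 : uni (N y) (N' y x) = uni (N' y) x := by
        rw [(hN y).uni_apply, (hN' y).uni_apply, ← hx, add_comm]
      have h2 : uni (N y) (N' y x) ∈ g y • Vs q ε := by
        rw [← hNg y hy]; exact apply_mem_smul.2 (hmem' y x)
      have h3 : uni (N' y) x ∈ g' y • Vs q (-ε) := by
        rw [← hNg' y hy]; exact apply_mem_smul.2 hxm
      rw [← h1] at h3
      have h4 := (hd y hy).eq_zero h2 (by have := (hd' y hy).nonneg h3; linarith)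
      have h5 : N' y x = 0 := by simpa using h4
      rw [hx, h5, map_zero]
  let B : X → GLV q := fun y => if hy : y ∈ w then LinearEquiv.ofBijective (B₀ y) (hBi y hy) else 1
  have hB : ∀ y ∈ w, (B y).toLinearMap = B₀ y := fun y hy => by
    simp only [B, dif_pos hy]; rfl
  have hBl : ∀ y ∈ w, AtLevel S (B y).toLinearMap := fun y hy => by rw [hB y hy]; exact hB₀l y
  have hBs : SmoothLin (fun y => (B y).toLinearMap) w :=
    ((SmoothLin.const LinearMap.id).add (hNs.comp hNs').neg).congr hB
  have hBa : ∀ y ∈ w, ∀ x, B y x = x - N y (N' y x) := fun y hy x => by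
    rw [← hB₀, ← hB y hy]; rfl
  have hBis := SmoothLin.inv hBl hBs
  have hBm : ∀ y ∈ w, ∀ x, B y x ∈ Vs q (-ε) ↔ x ∈ Vs q (-ε) := fun y hy x => by
    rw [hBa y hy, Submodule.sub_mem_iff_left _ ((hN y).mem _)]
  have hBfix : ∀ y ∈ w, ∀ x ∈ Vs q ε, (B y)⁻¹ x = x := fun y hy x hx => by
    have : B y x = x := by rw [hBa y hy, hker' y x hx, map_zero, sub_zero]
    conv_lhs => rw [← this, inv_apply_self]
  -- With `B = 1 - N N'` and `M = N' B⁻¹`, the product `(1 + N) (1 + M)` sends `B z` to `B z + N' z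
  -- + N N' z = z + N' z` for `z` in `V_{-ε}`. It therefore maps `V_{-ε}` to the graph of `N'`,
  -- while on `V_ε` it agrees with `1 + N`.
  let M : X → V q →ₗ[ℍ[ℝ]] V q := fun y => N' y ∘ₗ ((B y)⁻¹ : GLV q).toLinearMap
  have hM : ∀ y x, M y x = N' y ((B y)⁻¹ x) := fun _ _ => rfl
  have hMO : ∀ y ∈ w, Off (-ε) S (M y) := fun y hy => by
    refine ⟨fun x => (hN' y).mem _, fun x hx => ?_, fun i hi => ?_, fun x => (hN' y).span _⟩
    · rw [neg_neg] at hx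
      rw [hM, hBfix y hy x hx, hker' y x hx]
    · have : (B y)⁻¹ (vec i) = vec i := (atLevel_inv (hBl y hy)).1 i hi
      rw [hM, this, (hN' y).fix i hi]
  have hMs : SmoothLin M w := hNs'.comp hBis
  have hδ : ∀ y ∈ w, (uni (N y) * uni (M y) : GLV q).toLinearMap =
      (LinearMap.id + N y) ∘ₗ (LinearMap.id + M y) := fun y hy =>
    LinearMap.ext fun x => by
      rw [← (hN y).toLinearMap_uni, ← (hMO y hy).toLinearMap_uni]; rfl
  refine ⟨fun y => uni (N y) * uni (M y), fun y hy => mul_mem (hN y).uni_mem (hMO y hy).uni_mem,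
    (((SmoothLin.const LinearMap.id).add hNs).comp ((SmoothLin.const LinearMap.id).add hMs)).congr hδ,
    fun y hy => ⟨?_, ?_⟩⟩
  · have := (hMO y hy).uni_neg_smul
    rw [neg_neg] at this
    rw [mul_smul, this, hNg y hy]
  · rw [← hNg' y hy]
    have key : ∀ z ∈ Vs q (-ε), (uni (N y) * uni (M y)) (B y z) = uni (N' y) z := fun z hz => by
      rw [LinearEquiv.mul_apply, (hMO y hy).uni_apply, hM, inv_apply_self, (hN y).uni_apply, map_add,
        (hN y).ker _ ((hBm y hy z).2 hz), zero_add, hBa y hy, (hN' y).uni_apply]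
      abel
    refine le_antisymm (fun z hz => ?_) fun z hz => ?_
    · obtain ⟨x, hx, rfl⟩ := (Submodule.mem_smul_pointwise_iff_exists _ _ _).1 hz
      change (uni (N y) * uni (M y)) x ∈ _
      have h1 : (B y)⁻¹ x ∈ Vs q (-ε) := by rwa [← hBm y hy, apply_inv_self]
      have h2 := key _ h1
      rw [apply_inv_self] at h2
      rw [h2]
      exact apply_mem_smul.2 h1
    · obtain ⟨x, hx, rfl⟩ := (Submodule.mem_smul_pointwise_iff_exists _ _ _).1 hz
      change uni (N' y) x ∈ _
      rw [← key x hx]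
      exact apply_mem_smul.2 ((hBm y hy x).2 hx)

/-- Only the vectors at the level of `g` matter for the definiteness of `g • V_ε`. -/
theorem def_smul_of_level {ε : ℝ} (hε : IsSign ε) {g : GLV q} {S : Finset (Idx q)}
    (hl : AtLevel S (g : V q →ₗ[ℍ[ℝ]] V q))
    (h : ∀ x ∈ Vs q ε, x ∈ spanOf S → x ≠ 0 → 0 < ε * (herm (g x) (g x)).re) :
    Def ε (g • Vs q ε) := by
  intro y hy hy0
  obtain ⟨x, hx, rfl⟩ := (Submodule.mem_smul_pointwise_iff_exists _ _ _).1 hy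
  change 0 < ε * (herm (g x) (g x)).re
  classical
  have hx0 : x ≠ 0 := fun h0 => hy0 (by rw [h0]; exact map_zero g)
  have hrε : res S x ∈ Vs q ε := mem_Vs.2 fun i hi => by
    rw [res_apply, mem_Vs.1 hx i hi, ite_self]
  have hb : x - res S x ∈ Vs q ε := sub_mem hx hrε
  have hgx : g x = g (res S x) + (x - res S x) := hl.apply_eq x
  have hgr : g (res S x) ∈ spanOf S := hl.2 _ (res_mem S x)
  have horth : herm (g (res S x)) (x - res S x) = 0 := by
    rw [herm_eq_sum (mem_spanOf.1 hgr)]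
    exact Finset.sum_eq_zero fun i hi => by rw [sub_res_apply x hi]; simp
  have hsum : (herm (g x) (g x)).re = (herm (g (res S x)) (g (res S x))).re +
      (herm (x - res S x) (x - res S x)).re := by
    rw [hgx, herm_add_self_re, horth]; simp
  rw [hsum, mul_add]
  have h2 := (def_Vs hε).nonneg hb
  by_cases hr : res S x = 0
  · have h3 : 0 < ε * (herm (x - res S x) (x - res S x)).re :=
      def_Vs hε _ hb (by rw [hr, sub_zero]; exact hx0)
    have h4 : (herm (g (res S x)) (g (res S x))).re = 0 := by
      rw [hr, map_zero, herm_zero_left]; rfl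
    rw [h4]; linarith
  · have := h _ hrε (res_mem S x) hr
    linarith

/-- By `def_smul_of_level` only the finitely many coordinates in `S` matter. On the compact unit
sphere of the corresponding part of `V_ε`, positivity of a continuous function persists for nearby
parameters; homogeneity gives it for all nonzero vectors. -/
theorem eventually_def {ε : ℝ} (hε : IsSign ε) {g : X → GLV q} {S : Finset (Idx q)} (hw : IsOpen w)
    (hl : ∀ y ∈ w, g y ∈ levelSL S) (h : SmoothLin (fun y => (g y : V q →ₗ[ℍ[ℝ]] V q)) w)
    {y₀ : X} (hy₀ : y₀ ∈ w) (hd : Def ε (g y₀ • Vs q ε)) :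
    ∀ᶠ y in nhds y₀, Def ε (g y • Vs q ε) := by
  classical
  let K : Set (S → ℍ[ℝ]) := Metric.sphere 0 1 ∩ {a | toVec S a ∈ Vs q ε}
  have hKc : IsClosed {a : S → ℍ[ℝ] | toVec S a ∈ Vs q ε} := by
    have : {a : S → ℍ[ℝ] | toVec S a ∈ Vs q ε} = ⋂ i : S, ⋂ _ : sgn i.1 ≠ ε, {a | a i = 0} := by
      ext a
      simp only [Set.mem_iInter, Set.mem_ofPred_eq, mem_Vs]
      refine ⟨fun ha i hi => by rw [← toVec_apply S a i]; exact ha _ hi, fun ha i hi => ?_⟩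
      by_cases hiS : i ∈ S
      · rw [toVec_apply S a ⟨i, hiS⟩]; exact ha ⟨i, hiS⟩ hi
      · exact mem_spanOf.1 (toVec_mem S a) i hiS
    rw [this]
    exact isClosed_iInter fun i => isClosed_iInter fun _ =>
      isClosed_eq (continuous_apply i) continuous_const
  have hK : IsCompact K := (isCompact_sphere _ _).inter_right hKc
  let f : X → (S → ℍ[ℝ]) → ℝ := fun y a =>
    ε * (herm (g y (toVec S a)) (g y (toVec S a))).re
  have hf : ContDiffOn ℝ ∞ (fun p : X × (S → ℍ[ℝ]) => f p.1 p.2) (w ×ˢ Set.univ) := by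
    refine contDiffOn_const.mul (contDiffOn_re (contDiffOn_herm (S := S) (fun p hp => ?_) ?_ ?_))
    · exact (levelSL_atLevel (hl p.1 hp.1)).2 _ (toVec_mem S _)
    all_goals
      intro j
      refine (ContDiffOn.sum (s := Finset.univ)
        (f := fun (k : S) (p : X × (S → ℍ[ℝ])) => p.2 k * (g p.1 (vec k.1)) j) fun k _ => ?_).congr
          fun p _ => apply_toVec (g p.1 : V q →ₗ[ℍ[ℝ]] V q) S p.2 j
      exact ((contDiff_apply ℝ ℍ[ℝ] k).comp contDiff_snd).contDiffOn.mul
        (((h k.1).2 j).comp contDiff_fst.contDiffOn fun p hp => hp.1)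
  have hev : ∀ᶠ y in nhds y₀, ∀ a ∈ K, 0 < f y a := by
    refine hK.eventually_forall_of_forall_eventually fun a ha => ?_
    have hc : ContinuousAt (fun p : X × (S → ℍ[ℝ]) => f p.1 p.2) (y₀, a) :=
      hf.continuousOn.continuousAt (prod_mem_nhds (hw.mem_nhds hy₀) Filter.univ_mem)
    refine hc.eventually (lt_mem_nhds ?_)
    refine hd _ (apply_mem_smul.2 ha.2) fun h0 => ?_
    have h1 : toVec S a = 0 := by simpa using h0
    have h2 : a = 0 := funext fun i => by
      rw [← toVec_apply S a i, h1]; rfl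
    have h3 := ha.1
    rw [h2] at h3
    simp at h3
  filter_upwards [hev, hw.mem_nhds hy₀] with y hy hyw
  refine def_smul_of_level hε (levelSL_atLevel (hl y hyw)) fun x hx hxS hx0 => ?_
  obtain ⟨a, ha⟩ : ∃ a : S → ℍ[ℝ], a = fun k : S => x k := ⟨_, rfl⟩
  have hxa : toVec S a = x := by rw [ha]; exact toVec_coords hxS
  have ha0 : a ≠ 0 := by
    intro h0
    apply hx0
    rw [← hxa, h0]
    simp [toVec]
  have hna : ‖a‖ ≠ 0 := norm_ne_zero_iff.2 ha0
  obtain ⟨b, hb⟩ : ∃ b : S → ℍ[ℝ], b = ‖a‖⁻¹ • a := ⟨_, rfl⟩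
  have hbx : toVec S b = ((‖a‖⁻¹ : ℝ) : ℍ[ℝ]) • x := by
    rw [← hxa, hb]
    unfold toVec
    rw [Finset.smul_sum]
    refine Finset.sum_congr rfl fun k _ => ?_
    rw [smul_smul, Pi.smul_apply, Quaternion.coe_mul_eq_smul]
  have hbK : b ∈ K := by
    refine ⟨?_, ?_⟩
    · rw [mem_sphere_zero_iff_norm, hb, norm_smul, norm_inv, norm_norm, inv_mul_cancel₀ hna]
    · change toVec S b ∈ Vs q ε
      rw [hbx]; exact Submodule.smul_mem _ _ hx
  have h5 := hy b hbK
  change 0 < ε * (herm (g y (toVec S b)) (g y (toVec S b))).re at h5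
  rw [hbx, map_smul, herm_smul_smul_re] at h5
  have h6 : 0 < Quaternion.normSq ((‖a‖⁻¹ : ℝ) : ℍ[ℝ]) :=
    lt_of_le_of_ne Quaternion.normSq_nonneg (Ne.symm (by
      rw [Ne, Quaternion.normSq_eq_zero]
      intro h7
      exact inv_ne_zero hna (Quaternion.coe_injective (by simpa using h7))))
  have h7 : 0 < Quaternion.normSq ((‖a‖⁻¹ : ℝ) : ℍ[ℝ]) * (ε * (herm (g y x) (g y x)).re) := by
    linarith [h5]
  exact pos_of_mul_pos_right h7 h6.le

end Smooth

/-! ### Smooth families in `G`, orbits, and elements keeping both summands definite. -/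

theorem SmoothFamily.smoothLin {n : ℕ} {γ : EuclideanSpace ℝ (Fin n) → GLV q}
    {w : Set (EuclideanSpace ℝ (Fin n))} (h : SmoothFamily γ w) :
    SmoothLin (fun y => (γ y : V q →ₗ[ℍ[ℝ]] V q)) w := by
  obtain ⟨S, hS, hs⟩ := h
  exact .of_atLevel (fun y hy => levelSL_atLevel (hS y hy)) hs

theorem SmoothFamily.mul {n : ℕ} {γ δ : EuclideanSpace ℝ (Fin n) → GLV q}
    {w : Set (EuclideanSpace ℝ (Fin n))} (h : SmoothFamily γ w) (h' : SmoothFamily δ w) :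
    SmoothFamily (fun y => γ y * δ y) w := by
  classical
  have h1 := h.smoothLin.comp h'.smoothLin
  obtain ⟨S, hS, _⟩ := h
  obtain ⟨S', hS', _⟩ := h'
  exact ⟨S ∪ S', fun y hy => mul_mem (levelSL_mono Finset.subset_union_left (hS y hy))
    (levelSL_mono Finset.subset_union_right (hS' y hy)), fun i => (h1 i).2⟩

theorem SmoothFamily.const {n : ℕ} {g : GLV q} (hg : g ∈ G q)
    (w : Set (EuclideanSpace ℝ (Fin n))) : SmoothFamily (fun _ => g) w := by
  obtain ⟨S, hS⟩ := hg
  exact ⟨S, fun _ _ => hS, fun _ _ => contDiffOn_const⟩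

theorem SmoothFamily.mono {n : ℕ} {γ : EuclideanSpace ℝ (Fin n) → GLV q}
    {w w' : Set (EuclideanSpace ℝ (Fin n))} (h : SmoothFamily γ w) (hw : w' ⊆ w) :
    SmoothFamily γ w' := by
  obtain ⟨S, hS, hs⟩ := h
  exact ⟨S, fun y hy => hS y (hw hy), fun i j => (hs i j).mono hw⟩

theorem SmoothFamily.mem_G {n : ℕ} {γ : EuclideanSpace ℝ (Fin n) → GLV q}
    {w : Set (EuclideanSpace ℝ (Fin n))} (h : SmoothFamily γ w) {y : EuclideanSpace ℝ (Fin n)}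
    (hy : y ∈ w) : γ y ∈ G q := by
  obtain ⟨S, hS, _⟩ := h
  exact ⟨S, hS y hy⟩

theorem mem_orbit_subgroup {H : Subgroup (GLV q)} {X : Type*} [MulAction (GLV q) X] {x y : X} :
    y ∈ MulAction.orbit H x ↔ ∃ g ∈ H, y = g • x := by
  constructor
  · rintro ⟨⟨g, hg⟩, rfl⟩; exact ⟨g, hg, rfl⟩
  · rintro ⟨g, hg, rfl⟩; exact ⟨⟨g, hg⟩, rfl⟩

theorem orbit_subgroup_eq {H : Subgroup (GLV q)} {X : Type*} [MulAction (GLV q) X] {x : X}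
    {g : GLV q} (hg : g ∈ H) : MulAction.orbit H (g • x) = MulAction.orbit H x :=
  MulAction.orbit_eq_iff.2 (mem_orbit_subgroup.2 ⟨g, hg, rfl⟩)

theorem smul_chain_congr {C : Chain q} {g g' : GLV q} (h : ∀ F ∈ C, g • F = g' • F) :
    g • C = g' • C :=
  Set.image_congr h

theorem smul_isChain {C : Chain q} (h : IsChain (· ≤ ·) C) (g : GLV q) :
    IsChain (· ≤ ·) (g • C) := by
  rintro _ ⟨E, hE, rfl⟩ _ ⟨E', hE', rfl⟩ _
  exact (h.total hE hE').imp smul_le_smul_iff'.2 smul_le_smul_iff'.2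

theorem exists_lev_smul {C : Chain q} {T : Finset (Idx q)} (h : ∀ F ∈ C, Lev T F) {g : GLV q}
    (hg : g ∈ G q) : ∃ T' : Finset (Idx q), ∀ F ∈ g • C, Lev T' F := by
  classical
  obtain ⟨S, hS⟩ := hg
  refine ⟨T ∪ S, ?_⟩
  rintro _ ⟨E, hE, rfl⟩
  exact ((h E hE).mono Finset.subset_union_left).smul
    ((levelSL_atLevel hS).mono Finset.subset_union_right)

theorem Coord.nondeg {F : Sub q} (h : Coord F) : Nondeg F := by
  intro x hx hxF
  ext1 i
  by_contra hi
  have h1 : vec i ∈ F := h x hx i hi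
  have h2 := hxF _ h1
  rw [herm_vec_right, smul_eq_zero] at h2
  exact h2.elim (sgn_ne_zero i) hi

theorem Nondeg.smul {F : Sub q} (h : Nondeg F) {g : GLV q} (hg : g ∈ G₀ q) : Nondeg (g • F) := by
  intro x hx hxF
  obtain ⟨y, hy, rfl⟩ := (Submodule.mem_smul_pointwise_iff_exists _ _ _).1 hx
  have : y = 0 := h y hy fun z hz => by
    rw [← hg.2]; exact hxF _ (apply_mem_smul.2 hz)
  rw [this]; exact map_zero g

/-- `g` maps the standard decomposition to a pair of definite subspaces. -/
def Adm (g : GLV q) : Prop := ∀ ε, IsSign ε → Def ε (g • Vs q ε)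

theorem Adm.of_G₀ {g : GLV q} (hg : g ∈ G₀ q) : Adm g := fun _ hε => (def_Vs hε).smul hg

theorem Adm.mul_left {g g₀ : GLV q} (h : Adm g) (hg : g₀ ∈ G₀ q) : Adm (g₀ * g) := fun ε hε => by
  rw [mul_smul]; exact (h ε hε).smul hg

theorem Adm.mul_right {g k : GLV q} (h : Adm g) (hk : k ∈ K₀ q) : Adm (g * k) := fun ε hε => by
  rw [mul_smul, (mem_K₀.1 hk).2 ε hε]; exact h ε hε

/-- A coordinate subspace splits, so a radical vector of `g • F` is `a + b` with `a`, `b` in `g • F`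
of opposite signs. Pairing with `a` and with `b` gives equal squares `herm a a` and `herm b b`,
which must both vanish. -/
theorem Adm.nondeg_smul {g : GLV q} (h : Adm g) {F : Sub q} (hF : Coord F) : Nondeg (g • F) := by
  intro x hx hxF
  obtain ⟨y, hy, rfl⟩ := (Submodule.mem_smul_pointwise_iff_exists _ _ _).1 hx
  change g y = 0
  replace hxF : ∀ z ∈ g • F, herm (g y) z = 0 := hxF
  have h1 : g y = g (pr q 1 y) + g (pr q (-1) y) := by rw [← map_add, pr_add_pr isSign_one]
  have h2 := hxF _ (apply_mem_smul.2 (hF.split y hy 1 isSign_one))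
  have h3 := hxF _ (apply_mem_smul.2 (hF.split y hy (-1) isSign_neg_one))
  have hp1 := h 1 isSign_one
  have hp2 := h (-1) isSign_neg_one
  have m1 : g (pr q 1 y) ∈ g • Vs q 1 := apply_mem_smul.2 (pr_mem _ _)
  have m2 : g (pr q (-1) y) ∈ g • Vs q (-1) := apply_mem_smul.2 (pr_mem _ _)
  rw [h1] at h2 h3 ⊢
  generalize g (pr q 1 y) = a at *
  generalize g (pr q (-1) y) = b at *
  rw [herm_add_left] at h2 h3
  have h2' : (herm a a).re + (herm b a).re = 0 := by rw [← Quaternion.re_add, h2]; rfl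
  have h3' : (herm a b).re + (herm b b).re = 0 := by rw [← Quaternion.re_add, h3]; rfl
  have h4 := herm_re_comm a b
  have n1 := hp1.nonneg m1
  have n2 := hp2.nonneg m2
  have e1 := hp1.eq_zero m1 (by linarith)
  have e2 := hp2.eq_zero m2 (by linarith)
  rw [e1, e2, add_zero]

/-! ### Cycles through a coordinate flag -/

section Cycle
variable {C : Chain q}

/-- The chain `g • C` is nondegenerate, hence `G₀`-conjugate to a coordinate chain. Definiteness of
`g • V_±` forces the same numbers of basis vectors of each sign as in `C`, so the two coordinate
chains are conjugate under `K₀`. -/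
theorem exists_G₀_of_adm (hC : IsChain (· ≤ ·) C) (hco : ∀ F ∈ C, Coord F)
    {g : GLV q} (hg : g ∈ G q) (h : Adm g) :
    ∃ g₀ ∈ G₀ q, ∀ F ∈ C, g • F = g₀ • F := by
  obtain ⟨T, hT⟩ := exists_lev_smul (T := ∅) (fun F hF => (hco F hF).lev _) hg
  obtain ⟨g₁, hg₁, h1⟩ := exists_G₀_coord (smul_isChain hC g) hT (by
    rintro _ ⟨E, hE, rfl⟩
    exact h.nondeg_smul (hco E hE))
  have h2 := h.mul_left hg₁
  obtain ⟨k, hk, h3⟩ := exists_K₀_of_coord hC (mul_mem (G₀_le hg₁) hg) hco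
    (fun F hF => by rw [mul_smul]; exact h1 _ ⟨F, hF, rfl⟩)
    fun ε hε => Off.def_inj hε (h2 ε hε)
  refine ⟨g₁⁻¹ * k, mul_mem (inv_mem hg₁) (K₀_le hk), fun F hF => ?_⟩
  rw [mul_smul, h3 F hF, mul_smul, inv_smul_smul]

/-- Here `g` commutes with the projections to the summands, so `g • C` still splits and the
conjugation to a coordinate chain can be done in `K₀`. -/
theorem exists_K₀_of_stab (hC : IsChain (· ≤ ·) C) (hco : ∀ F ∈ C, Coord F)
    {g : GLV q} (hg : g ∈ G q) (h : ∀ ε, IsSign ε → g • Vs q ε = Vs q ε) :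
    ∃ k ∈ K₀ q, ∀ F ∈ C, g • F = k • F := by
  obtain ⟨T, hT⟩ := exists_lev_smul (T := ∅) (fun F hF => (hco F hF).lev _) hg
  obtain ⟨k₁, hk₁, h1⟩ := exists_K₀_coord (smul_isChain hC g) hT (by
    rintro _ ⟨E, hE, rfl⟩ x hx
    obtain ⟨y, hy, rfl⟩ := (Submodule.mem_smul_pointwise_iff_exists _ _ _).1 hx
    have key : ∀ ε, IsSign ε → pr q ε (g y) = g (pr q ε y) := fun ε hε => by
      have m1 : g (pr q ε y) ∈ Vs q ε := by
        have := apply_mem_smul (g := g).2 (pr_mem ε y)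
        rwa [h ε hε] at this
      have m2 : g (pr q (-ε) y) ∈ Vs q (-ε) := by
        have := apply_mem_smul (g := g).2 (pr_mem (-ε) y)
        rwa [h (-ε) hε.neg] at this
      have m3 := pr_neg_of_mem hε.neg m2
      rw [neg_neg] at m3
      conv_lhs => rw [← pr_add_pr hε y, map_add, map_add, m3, pr_of_mem m1, add_zero]
    intro ε hε
    change pr q ε (g y) ∈ _
    rw [key ε hε]
    exact apply_mem_smul.2 ((hco E hE).split y hy ε hε))
  have hk₁' := mem_K₀.1 hk₁
  have h2 : ∀ ε, IsSign ε → (k₁ * g) • Vs q ε = Vs q ε := fun ε hε => by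
    rw [mul_smul, h ε hε, hk₁'.2 ε hε]
  obtain ⟨k, hk, h3⟩ := exists_K₀_of_coord hC (mul_mem (G₀_le (K₀_le hk₁)) hg) hco
    (fun F hF => by rw [mul_smul]; exact h1 _ ⟨F, hF, rfl⟩) fun ε hε x hx hx' => by
      have : (k₁ * g) x ∈ Vs q ε := by
        have := apply_mem_smul (g := k₁ * g).2 hx
        rwa [h2 ε hε] at this
      have := Vs_inf hε this hx'
      simpa using this
  refine ⟨k₁⁻¹ * k, mul_mem (inv_mem hk₁) hk, fun F hF => ?_⟩
  rw [mul_smul, h3 F hF, mul_smul, inv_smul_smul]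

/-- A point of the translated cycle is `g * k` applied to `C`, and `g * k` also keeps both summands
definite. -/
theorem smul_cycle_subset (hC : IsChain (· ≤ ·) C) (hco : ∀ F ∈ C, Coord F)
    {g : GLV q} (hg : g ∈ G q) (h : Adm g) :
    g • MulAction.orbit (K₀ q) C ⊆ MulAction.orbit (G₀ q) C := by
  rintro _ ⟨C', hC', rfl⟩
  obtain ⟨k, hk, rfl⟩ := mem_orbit_subgroup.1 hC'
  obtain ⟨g₀, hg₀, h1⟩ := exists_G₀_of_adm hC hco (mul_mem hg (G₀_le (K₀_le hk))) (h.mul_right hk)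
  refine mem_orbit_subgroup.2 ⟨g₀, hg₀, ?_⟩
  change g • k • C = _
  rw [← mul_smul, smul_chain_congr h1]

theorem smul_set_eq_of_forall {X : Type*} [MulAction (GLV q) X] {Y : Set X} {g : GLV q}
    (h : ∀ x ∈ Y, g • x ∈ Y) (h' : ∀ x ∈ Y, g⁻¹ • x ∈ Y) : g • Y = Y := by
  refine Set.Subset.antisymm ?_ fun x hx => ⟨g⁻¹ • x, h' x hx, smul_inv_smul g x⟩
  rintro _ ⟨x, hx, rfl⟩
  exact h x hx

theorem smul_cycle_of_stab (hC : IsChain (· ≤ ·) C) (hco : ∀ F ∈ C, Coord F)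
    {g : GLV q} (hg : g ∈ G q) (h : ∀ ε, IsSign ε → g • Vs q ε = Vs q ε) :
    g • MulAction.orbit (K₀ q) C = MulAction.orbit (K₀ q) C := by
  have key : ∀ g ∈ G q, (∀ ε, IsSign ε → g • Vs q ε = Vs q ε) →
      ∀ C' ∈ MulAction.orbit (K₀ q) C, g • C' ∈ MulAction.orbit (K₀ q) C := by
    intro g hg h C' hC'
    obtain ⟨k, hk, rfl⟩ := mem_orbit_subgroup.1 hC'
    obtain ⟨k', hk', h1⟩ := exists_K₀_of_stab hC hco (mul_mem hg (G₀_le (K₀_le hk)))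
      fun ε hε => by rw [mul_smul, (mem_K₀.1 hk).2 ε hε, h ε hε]
    exact mem_orbit_subgroup.2 ⟨k', hk', by rw [← mul_smul, smul_chain_congr h1]⟩
  exact smul_set_eq_of_forall (key g hg h) (key g⁻¹ (inv_mem hg) fun ε hε => by
    rw [inv_smul_eq_iff, h ε hε])

/-- Some member of the chain contains a basis vector of sign `ε` and omits one of sign `-ε`. -/
def Sep (ε : ℝ) (C : Chain q) : Prop :=
  ∃ F ∈ C, (∃ i, sgn i = ε ∧ vec i ∈ F) ∧ ∃ j, sgn j = -ε ∧ vec j ∉ F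

theorem le_or_ge_of_not_sep (hco : ∀ F ∈ C, Coord F)
    {ε : ℝ} (hε : IsSign ε) (h : ¬ Sep (-ε) C) {F : Sub q} (hF : F ∈ C) :
    F ≤ Vs q ε ∨ Vs q ε ≤ F := by
  by_contra h'
  push Not at h'
  obtain ⟨h1, h2⟩ := h'
  apply h
  obtain ⟨x, hx, hx'⟩ := Set.not_subset.1 h1
  obtain ⟨y, hy, hy'⟩ := Set.not_subset.1 h2
  refine ⟨F, hF, ?_, ?_⟩
  · rw [SetLike.mem_coe, mem_Vs] at hx'
    push Not at hx'
    obtain ⟨i, hi, hxi⟩ := hx'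
    exact ⟨i, (hε.sgn_ne_iff i).1 hi, hco F hF x hx i hxi⟩
  · by_contra h3
    push Not at h3
    refine hy' (Coord.mem_of_support fun i hi => h3 i ?_)
    rw [neg_neg]
    by_contra h4
    exact hi (mem_Vs.1 hy i h4)

/-- Write `g⁻¹ • V_{-ε} = u • V_{-ε}` with `u` unipotent, sending `V_{-ε}` into its sum with `V_ε`
and fixing `V_ε` pointwise. Each member of a flag in the cycle is contained in `V_ε` or contains it,
so `u` fixes the cycle pointwise. The element `g * u` stabilizes both summands. -/
theorem smul_cycle_of_not_sep (hC : IsChain (· ≤ ·) C) (hco : ∀ F ∈ C, Coord F)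
    {ε : ℝ} (hε : IsSign ε) (h : ¬ Sep (-ε) C) {g : GLV q} (hg : g ∈ G q)
    (hgε : g • Vs q ε = Vs q ε) : g • MulAction.orbit (K₀ q) C = MulAction.orbit (K₀ q) C := by
  obtain ⟨S, hS⟩ := hg
  have hginv : g⁻¹ • Vs q ε = Vs q ε := by rw [inv_smul_eq_iff, hgε]
  obtain ⟨N, hN, -, hNg⟩ := exists_chart (X := ℝ) (w := Set.univ) hε.neg (g := fun _ => g⁻¹) (S := S)
    (fun _ _ => inv_mem hS) (SmoothLin.const _) (fun _ _ x hx hx' => by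
      rw [neg_neg, ← hginv] at hx'
      exact Vs_inf hε (apply_mem_smul.1 hx') hx)
  replace hN := hN 0
  replace hNg := hNg 0 (Set.mem_univ _)
  have hNmem : ∀ x, N 0 x ∈ Vs q ε := fun x => by
    have := hN.mem x
    rwa [neg_neg] at this
  have huε : uni (N 0) • Vs q ε = Vs q ε := by
    have := hN.uni_neg_smul
    rwa [neg_neg] at this
  have hufix : ∀ C' ∈ MulAction.orbit (K₀ q) C, uni (N 0) • C' = C' := by
    intro C' hC'
    obtain ⟨k, hk, rfl⟩ := mem_orbit_subgroup.1 hC'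
    have : ∀ F ∈ k • C, uni (N 0) • F = (1 : GLV q) • F := by
      rintro _ ⟨F, hF, rfl⟩
      change uni (N 0) • k • F = (1 : GLV q) • k • F
      rw [one_smul]
      refine smul_eq_of_le ⟨S, hN.uni_mem⟩ fun z hz => ?_
      obtain ⟨x, hx, rfl⟩ := (Submodule.mem_smul_pointwise_iff_exists _ _ _).1 hz
      change uni (N 0) x ∈ _
      rw [hN.uni_apply]
      refine add_mem hx ?_
      rcases le_or_ge_of_not_sep hco hε h hF with h1 | h1
      · have h2 : k • F ≤ Vs q ε := by
          rw [← (mem_K₀.1 hk).2 ε hε]; exact smul_le_smul_iff'.2 h1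
        rw [hN.ker x (by rw [neg_neg]; exact h2 hx)]
        exact zero_mem _
      · have h2 : Vs q ε ≤ k • F := by
          rw [← (mem_K₀.1 hk).2 ε hε]; exact smul_le_smul_iff'.2 h1
        exact h2 (hNmem x)
    rw [smul_chain_congr this, one_smul]
  have hu : uni (N 0) • MulAction.orbit (K₀ q) C = MulAction.orbit (K₀ q) C :=
    smul_set_eq_of_forall (fun C' hC' => by rw [hufix C' hC']; exact hC') fun C' hC' => by
      have : (uni (N 0))⁻¹ • C' = C' := by rw [inv_smul_eq_iff, hufix C' hC']
      rw [this]; exact hC'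
  have hstab := smul_cycle_of_stab hC hco (g := g * uni (N 0)) (mul_mem ⟨S, hS⟩ ⟨S, hN.uni_mem⟩)
    fun ε' hε' => by
      have hcase : ε' = ε ∨ ε' = -ε := by
        rcases hε with rfl | rfl <;> rcases hε' with rfl | rfl <;> simp
      rcases hcase with rfl | rfl
      · rw [mul_smul, huε, hgε]
      · rw [mul_smul, hNg, smul_inv_smul]
  rwa [mul_smul, hu] at hstab

end Cycle

/-! ### What a cycle remembers of the two summands. -/

theorem K₀_pr {k : GLV q} (hk : k ∈ K₀ q) {ε : ℝ} (hε : IsSign ε) (x : V q) :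
    pr q ε (k x) = k (pr q ε x) := by
  have m1 := K₀_mem_Vs hk hε (pr_mem ε x)
  have m2 := K₀_mem_Vs hk hε.neg (pr_mem (-ε) x)
  have m3 := pr_neg_of_mem hε.neg m2
  rw [neg_neg] at m3
  conv_lhs => rw [← pr_add_pr hε x, map_add, map_add, m3, pr_of_mem m1, add_zero]

theorem smul_mem_cancel {F : Sub q} {c : ℍ[ℝ]} (hc : c ≠ 0) {x : V q} (h : c • x ∈ F) : x ∈ F :=
  (Submodule.smul_mem_iff _ hc).1 h

theorem mem_smul_inv_of {F : Sub q} {k : GLV q} {x : V q} : x ∈ k⁻¹ • F ↔ k x ∈ F := by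
  rw [mem_smul_iff, inv_inv]

/-- Two nonzero vectors, one in each summand, can be moved to prescribed lines by `K₀`. -/
theorem exists_K₀_two_lines {ε : ℝ} (hε : IsSign ε) {x y u v : V q} (hx : x ∈ Vs q ε)
    (hy : y ∈ Vs q (-ε)) (hu : u ∈ Vs q ε) (hv : v ∈ Vs q (-ε)) (hx0 : x ≠ 0) (hy0 : y ≠ 0)
    (hu0 : u ≠ 0) (hv0 : v ≠ 0) :
    ∃ k ∈ K₀ q, (∃ c : ℍ[ℝ], c ≠ 0 ∧ k x = c • u) ∧ ∃ c : ℍ[ℝ], c ≠ 0 ∧ k y = c • v := by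
  obtain ⟨k₁, hk₁, ⟨c₁, hc₁, h1⟩, -⟩ := exists_K₀_line hε hx hu hx0 hu0
  have hy1 := K₀_mem_Vs hk₁ hε.neg hy
  obtain ⟨k₂, hk₂, ⟨c₂, hc₂, h2⟩, h3⟩ := exists_K₀_line hε.neg hy1 hv
    (fun h => hy0 (by simpa using h)) hv0
  refine ⟨k₂ * k₁, mul_mem hk₂ hk₁, ⟨c₁, hc₁, ?_⟩, c₂, hc₂, h2⟩
  rw [LinearEquiv.mul_apply, h1, map_smul, h3 u (herm_Vs_Vs hε hu hy1) (herm_Vs_Vs hε hu hv)]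

/-- A subspace which separates basis vectors of both signs determines the lines of `V_ε` through
its `K₀`-translates. -/
theorem mem_span_of_forall_mem {ε : ℝ} (hε : IsSign ε) {F : Sub q} (hF : Coord F) {i i' j : Idx q}
    (hi : sgn i = ε) (hiF : vec i ∈ F) (hi' : sgn i' = ε) (hi'F : vec i' ∉ F) (hj : sgn j = -ε)
    (hjF : vec j ∉ F) {x y : V q} (hx : x ∈ Vs q ε) (hx0 : x ≠ 0)
    (h : ∀ k ∈ K₀ q, x ∈ k • F → y ∈ k • F) : ∃ c : ℍ[ℝ], y = c • x := by
  have hii' : i ≠ i' := fun h' => hi'F (h' ▸ hiF)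
  have h' : ∀ k ∈ K₀ q, k x ∈ F → k y ∈ F := fun k hk hxk =>
    mem_smul_inv_of.1 (h k⁻¹ (inv_mem hk) (mem_smul_inv_of.2 hxk))
  -- Otherwise some `k` in `K₀` moves `x` into `F` and the `V_{-ε}`-component of `y` to the line of
  -- `vec j`, which is not in `F`.
  have hy1 : pr q (-ε) y = 0 := by
    by_contra hy0
    obtain ⟨k, hk, ⟨c, hc, h1⟩, c', hc', h2⟩ := exists_K₀_two_lines hε hx (pr_mem (-ε) y)
      (vec_mem_Vs hi) (vec_mem_Vs hj) hx0 hy0 (vec_ne_zero i) (vec_ne_zero j)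
    have h3 := hF.split _ (h' k hk (by rw [h1]; exact F.smul_mem _ hiF)) (-ε) hε.neg
    rw [K₀_pr hk hε.neg, h2] at h3
    exact hjF (smul_mem_cancel hc' h3)
  have hyε : y ∈ Vs q ε := by
    rw [← pr_add_pr hε y, hy1, add_zero]; exact pr_mem _ _
  have hxx : herm x x ≠ 0 := fun h0 => by
    have := def_Vs hε x hx hx0
    rw [h0] at this
    simp at this
  refine ⟨herm y x * (herm x x)⁻¹, ?_⟩
  -- The part of `y` orthogonal to `x`. If nonzero, it can be moved to the line of `vec i'`, outside
  -- `F`, while `x` goes to the line of `vec i`, inside `F`.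
  obtain ⟨z, hz⟩ : ∃ z, z = y - (herm y x * (herm x x)⁻¹) • x := ⟨_, rfl⟩
  rw [← sub_eq_zero, ← hz]
  by_contra hz0
  have hzε : z ∈ Vs q ε := by rw [hz]; exact sub_mem hyε (Submodule.smul_mem _ _ hx)
  have hzx : herm z x = 0 := by
    rw [hz, herm_sub_left, herm_smul_left, mul_assoc, inv_mul_cancel₀ hxx, mul_one, sub_self]
  obtain ⟨k₁, hk₁, ⟨c₁, hc₁, h1⟩, -⟩ := exists_K₀_line hε hx (vec_mem_Vs hi) hx0 (vec_ne_zero i)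
  have horth : herm (vec i) (k₁ z) = 0 := by
    have h2 : herm (k₁ z) (k₁ x) = 0 := by rw [K₀_herm hk₁, hzx]
    rw [h1, herm_smul_right] at h2
    have h3 := (mul_eq_zero.1 h2).resolve_right (star_ne_zero.2 hc₁)
    rw [← star_herm, h3, star_zero]
  obtain ⟨k₂, hk₂, ⟨c₂, hc₂, h2⟩, h3⟩ := exists_K₀_line hε (K₀_mem_Vs hk₁ hε hzε) (vec_mem_Vs hi')
    (fun h0 => hz0 (by simpa using h0)) (vec_ne_zero i')
  have h4 : (k₂ * k₁) x = c₁ • vec i := by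
    rw [LinearEquiv.mul_apply, h1, map_smul, h3 _ horth (herm_vec_vec_ne hii')]
  have h5 : (k₂ * k₁) x ∈ F := by rw [h4]; exact F.smul_mem _ hiF
  have h6 := h' _ (mul_mem hk₂ hk₁) h5
  have h7 : (k₂ * k₁) z ∈ F := by
    rw [hz, map_sub, map_smul]
    exact sub_mem h6 (F.smul_mem _ h5)
  rw [LinearEquiv.mul_apply, h2] at h7
  exact hi'F (smul_mem_cancel hc₂ h7)

theorem Coord.smul_K₀_split {F : Sub q} (hF : Coord F) {k : GLV q} (hk : k ∈ K₀ q) :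
    Split (k • F) := by
  intro x hx ε hε
  obtain ⟨y, hy, rfl⟩ := (Submodule.mem_smul_pointwise_iff_exists _ _ _).1 hx
  change pr q ε (k y) ∈ _
  rw [K₀_pr hk hε]
  exact apply_mem_smul.2 (hF.split y hy ε hε)

/-- A subspace is not the union of two proper subspaces. -/
theorem le_or_le_of_forall_mem {A B W : Sub q} (h : ∀ x ∈ W, x ∈ A ∨ x ∈ B) : W ≤ A ∨ W ≤ B := by
  by_contra h'
  push Not at h'
  obtain ⟨h1, h2⟩ := h'
  obtain ⟨x, hx, hxA⟩ := Set.not_subset.1 h1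
  obtain ⟨y, hy, hyB⟩ := Set.not_subset.1 h2
  have hxB := (h x hx).resolve_left hxA
  have hyA := (h y hy).resolve_right hyB
  rcases h _ (add_mem hx hy) with h3 | h3
  · exact hxA ((Submodule.add_mem_iff_left _ hyA).1 h3)
  · exact hyB ((Submodule.add_mem_iff_right _ hxB).1 h3)

section Cycle
variable {C : Chain q}

/-- An equality of flags in the cycle becomes an equality of corresponding members, since elements
of `G` which agree on a chain agree on its members. -/
theorem exists_smul_eq_of_cycle (hC : IsChain (· ≤ ·) C) {g : GLV q} (hg : g ∈ G q)
    (h : g • MulAction.orbit (K₀ q) C = MulAction.orbit (K₀ q) C) {k : GLV q} (hk : k ∈ K₀ q) :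
    ∃ k' ∈ K₀ q, ∀ F ∈ C, g • k • F = k' • F := by
  have h1 : g • k • C ∈ MulAction.orbit (K₀ q) C := by
    rw [← h]
    exact ⟨k • C, mem_orbit_subgroup.2 ⟨k, hk, rfl⟩, rfl⟩
  obtain ⟨k', hk', h2⟩ := mem_orbit_subgroup.1 h1
  refine ⟨k', hk', fun F hF => ?_⟩
  rw [← mul_smul]
  exact smul_eq_smul_of_chain (mul_mem hg (G₀_le (K₀_le hk))) (G₀_le (K₀_le hk')) hC
    (by rw [mul_smul, h2]) hF

theorem inv_smul_cycle {g : GLV q} {Y : Set (Chain q)} (h : g • Y = Y) : g⁻¹ • Y = Y := by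
  rw [inv_smul_eq_iff, h]

/-- `V_ε` is the intersection of the `K₀`-translates of `F`, because `K₀` moves any line of `V_{-ε}`
to that of `vec j`; and `g` permutes these translates. -/
theorem smul_Vs_of_ge (hC : IsChain (· ≤ ·) C) {g : GLV q} (hg : g ∈ G q)
    (h : g • MulAction.orbit (K₀ q) C = MulAction.orbit (K₀ q) C) {ε : ℝ} (hε : IsSign ε)
    {F : Sub q} (hF : F ∈ C) (hFV : Vs q ε ≤ F) {j : Idx q} (hj : sgn j = -ε) (hjF : vec j ∉ F) :
    g • Vs q ε = Vs q ε := by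
  refine smul_eq_of_le hg fun z hz => ?_
  obtain ⟨x, hx, rfl⟩ := (Submodule.mem_smul_pointwise_iff_exists _ _ _).1 hz
  change g x ∈ _
  have h1 : ∀ k ∈ K₀ q, g x ∈ k • F := fun k hk => by
    obtain ⟨k', hk', h2⟩ := exists_smul_eq_of_cycle hC (inv_mem hg) (inv_smul_cycle h) hk
    have h3 : x ∈ k' • F := by
      have : Vs q ε ≤ k' • F := by
        rw [← (mem_K₀.1 hk').2 ε hε]; exact smul_le_smul_iff'.2 hFV
      exact this hx
    rw [← h2 F hF, mem_smul_inv_of] at h3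
    exact h3
  have h2 : pr q (-ε) (g x) = 0 := by
    by_contra h0
    obtain ⟨k, hk, ⟨c, hc, h3⟩, -⟩ := exists_K₀_line hε.neg (pr_mem (-ε) (g x)) (vec_mem_Vs hj) h0
      (vec_ne_zero j)
    have h4 := mem_smul_inv_of.1 (h1 k⁻¹ (inv_mem hk))
    rw [← pr_add_pr hε (g x), map_add, h3] at h4
    have h5 := (Submodule.add_mem_iff_right _ (hFV (K₀_mem_Vs hk hε (pr_mem ε (g x))))).1 h4
    exact hjF (smul_mem_cancel hc h5)
  rw [← pr_add_pr hε (g x), h2, add_zero]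
  exact pr_mem _ _

/-- For `x` in `V_ε`, both components of `g x` pull back into every `K₀`-translate of `F` through
`x`, since all these translates split after applying `g`. By `mem_span_of_forall_mem` they are
multiples of `g x`, so `g x` lies in one of the summands. -/
theorem smul_Vs_le_or (hC : IsChain (· ≤ ·) C) {g : GLV q} (hg : g ∈ G q)
    (h : g • MulAction.orbit (K₀ q) C = MulAction.orbit (K₀ q) C) {ε : ℝ} (hε : IsSign ε)
    {F : Sub q} (hF : F ∈ C) (hco : Coord F) {i i' j : Idx q}
    (hi : sgn i = ε) (hiF : vec i ∈ F) (hi' : sgn i' = ε) (hi'F : vec i' ∉ F) (hj : sgn j = -ε)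
    (hjF : vec j ∉ F) : g • Vs q ε ≤ Vs q ε ∨ g • Vs q ε ≤ Vs q (-ε) := by
  refine le_or_le_of_forall_mem fun z hz => ?_
  obtain ⟨x, hx, rfl⟩ := (Submodule.mem_smul_pointwise_iff_exists _ _ _).1 hz
  change g x ∈ _ ∨ g x ∈ _
  by_cases hx0 : x = 0
  · rw [hx0, map_zero]; exact Or.inl (zero_mem _)
  have key : ∀ ε', IsSign ε' → ∃ c : ℍ[ℝ], g⁻¹ (pr q ε' (g x)) = c • x := fun ε' hε' =>
    mem_span_of_forall_mem hε hco hi hiF hi' hi'F hj hjF hx hx0 fun k hk hxk => by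
      obtain ⟨k', hk', h2⟩ := exists_smul_eq_of_cycle hC hg h hk
      have h3 : g x ∈ g • k • F := apply_mem_smul.2 hxk
      rw [h2 F hF] at h3
      have h4 := hco.smul_K₀_split hk' _ h3 ε' hε'
      rw [← h2 F hF] at h4
      exact mem_smul_iff.1 h4
  by_cases h0 : pr q ε (g x) = 0
  · right
    rw [← pr_add_pr hε (g x), h0, zero_add]
    exact pr_mem _ _
  · left
    obtain ⟨c, hc⟩ := key ε hε
    have h1 : pr q ε (g x) = c • g x := by
      rw [← map_smul, ← hc, apply_inv_self]
    have hc0 : c ≠ 0 := fun hc0 => h0 (by rw [h1, hc0, zero_smul])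
    exact smul_mem_cancel hc0 (h1 ▸ pr_mem ε (g x))

/-- `V_+` is infinite dimensional, so it contains a basis vector fixed by `g`. -/
theorem not_smul_Vpos_le {g : GLV q} (hg : g ∈ G q) : ¬ g • Vs q 1 ≤ Vs q (-1) := by
  intro h
  obtain ⟨S, hS⟩ := hg
  obtain ⟨i, hi⟩ : ∃ i : Idx q, i ∉ S ∧ sgn i = 1 := by
    obtain ⟨n, hn⟩ := Infinite.exists_notMem_finset (S.preimage (Sum.inl : ℕ → Idx q)
      (Sum.inl_injective.injOn))
    exact ⟨Sum.inl n, by simpa using hn, rfl⟩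
  have h1 : (vec i : V q) ∈ g • Vs q 1 := by
    have h2 : g (vec i) = vec i := hS.1 i hi.1
    rw [← h2]
    exact apply_mem_smul.2 (vec_mem_Vs hi.2)
  exact vec_ne_zero i (Vs_inf isSign_one (vec_mem_Vs hi.2) (h h1))

/-- By `smul_Vs_le_or` only an inclusion of `g • V_ε` in `V_{-ε}` has to be excluded. For `ε = 1`
this is infinite dimensionality. For `ε = -1`, either `F` contains a positive basis vector and the
case `ε = 1` shows that `g` preserves `V_+`, or `F` lies in `V_-` and so do all its `K₀`-translates,
one of which is `g • F`. -/
theorem smul_Vs_of_sep (hC : IsChain (· ≤ ·) C) (hco : ∀ F ∈ C, Coord F) {g : GLV q} (hg : g ∈ G q)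
    (h : g • MulAction.orbit (K₀ q) C = MulAction.orbit (K₀ q) C) {ε : ℝ} (hε : IsSign ε)
    (hs : Sep ε C) : g • Vs q ε = Vs q ε := by
  have key : ∀ ε, IsSign ε → ∀ F ∈ C, ∀ i j, sgn i = ε → vec i ∈ F → sgn j = -ε → vec j ∉ F →
      g • Vs q ε = Vs q ε ∨ ((∃ i', sgn i' = ε ∧ vec i' ∉ F) ∧ g • Vs q ε ≤ Vs q (-ε)) := by
    intro ε hε F hF i j hi hiF hj hjF
    by_cases h1 : ∃ i', sgn i' = ε ∧ vec i' ∉ F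
    · obtain ⟨i', hi', hi'F⟩ := h1
      exact (smul_Vs_le_or hC hg h hε hF (hco F hF) hi hiF hi' hi'F hj hjF).imp
        (smul_eq_of_le hg) fun h2 => ⟨⟨i', hi', hi'F⟩, h2⟩
    · push Not at h1
      refine Or.inl (smul_Vs_of_ge hC hg h hε hF (fun x hx => ?_) hj hjF)
      exact Coord.mem_of_support fun i' hi' => h1 i' (by
        by_contra h2; exact hi' (mem_Vs.1 hx i' h2))
  have hone : ∀ F ∈ C, ∀ i j, sgn i = 1 → vec i ∈ F → sgn j = -1 → vec j ∉ F →
      g • Vs q 1 = Vs q 1 := fun F hF i j hi hiF hj hjF =>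
    (key 1 isSign_one F hF i j hi hiF hj hjF).resolve_right fun h => not_smul_Vpos_le hg h.2
  obtain ⟨F, hF, ⟨i, hi, hiF⟩, j, hj, hjF⟩ := hs
  rcases hε with rfl | rfl
  · exact hone F hF i j hi hiF hj hjF
  · refine (key (-1) isSign_neg_one F hF i j hi hiF hj hjF).resolve_right ?_
    rintro ⟨⟨i', hi', hi'F⟩, hle⟩
    rw [neg_neg] at hle
    by_cases h1 : ∃ l, sgn l = 1 ∧ vec l ∈ F
    · obtain ⟨l, hl, hlF⟩ := h1
      have h2 := hone F hF l i' hl hlF hi' hi'F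
      rw [← h2, smul_le_smul_iff'] at hle
      exact vec_ne_zero i (Vs_inf isSign_one (hle (vec_mem_Vs hi)) (vec_mem_Vs hi))
    · push Not at h1
      have hFV : F ≤ Vs q (-1) := fun x hx => mem_Vs.2 fun l hl => by
        by_contra h2
        have h3 : sgn l = 1 := (sgn_eq_or l).resolve_right hl
        exact h1 l h3 (hco F hF x hx l h2)
      obtain ⟨k', hk', h2⟩ := exists_smul_eq_of_cycle hC hg h (one_mem _)
      have h3 : g (vec i) ∈ k' • F := by
        rw [← h2 F hF, one_smul]; exact apply_mem_smul.2 hiF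
      have h4 : k' • F ≤ Vs q (-1) := by
        rw [← (mem_K₀.1 hk').2 (-1) isSign_neg_one]; exact smul_le_smul_iff'.2 hFV
      have h5 := Vs_inf isSign_one (hle (apply_mem_smul.2 (vec_mem_Vs hi))) (h4 h3)
      exact vec_ne_zero i (by simpa using h5)

/-- The degenerate case of the Cauchy–Schwarz inequality: isotropic vectors of a semidefinite
subspace are in its radical. -/
theorem herm_eq_zero_of_semidef {ε : ℝ} (hε : IsSign ε) {W : Sub q}
    (h : ∀ z ∈ W, 0 ≤ ε * (herm z z).re) {x z : V q} (hx : x ∈ W) (hz : z ∈ W)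
    (hx0 : (herm x x).re = 0) : herm x z = 0 := by
  refine eq_zero_of_re_mul fun c => ?_
  by_contra hne
  obtain ⟨y, hy⟩ : ∃ y, y = star c • z := ⟨_, rfl⟩
  have hyW : y ∈ W := by rw [hy]; exact W.smul_mem _ hz
  have hxy : herm x y = herm x z * c := by rw [hy, herm_smul_right, star_star]
  rw [← hxy] at hne
  have key : ∀ t : ℝ, 0 ≤ ε * (2 * t * (herm x y).re + (herm y y).re) := fun t => by
    have h1 := h ((t : ℍ[ℝ]) • x + y) (add_mem (W.smul_mem _ hx) hyW)
    rw [herm_add_self_re, herm_smul_smul_re, hx0, herm_smul_left, Quaternion.coe_mul_eq_smul] at h1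
    have h2 : (t • herm x y).re = t * (herm x y).re := rfl
    rw [h2] at h1
    linarith
  have hb : ε * (herm x y).re ≠ 0 := mul_ne_zero (by rcases hε with rfl | rfl <;> norm_num) hne
  have hε0 : ε ≠ 0 := by rcases hε with rfl | rfl <;> norm_num
  -- This `t` makes the affine function of `t` equal to `-1`.
  have h1 := key (-(ε * (herm y y).re + 1) / (2 * (ε * (herm x y).re)))
  have h2 : ε * (2 * (-(ε * (herm y y).re + 1) / (2 * (ε * (herm x y).re))) * (herm x y).re +
      (herm y y).re) = -1 := by
    field_simp
    ring
  linarith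

/-- A linear functional of finite level on `V_ε` is represented by a vector. -/
theorem exists_representing {ε : ℝ} (hε : IsSign ε) {g : GLV q} (hg : g ∈ G q) (w : V q) :
    ∃ y ∈ Vs q ε, ∀ z ∈ Vs q ε, herm z y = 0 → herm (g z) w = 0 := by
  classical
  obtain ⟨S, hS⟩ := hg
  -- Outside `U` the vector `vec i` is fixed by `g` and orthogonal to `w`, so the functional `z ↦
  -- herm (g z) w` only involves the coordinates in `U`.
  obtain ⟨U, hU⟩ : ∃ U, U = S ∪ w.support := ⟨_, rfl⟩
  obtain ⟨y, hy⟩ : ∃ y : V q, y = pr q ε (∑ i ∈ U, herm w (g (vec i)) • vec i) := ⟨_, rfl⟩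
  have hyU : ∀ i ∈ U, sgn i = ε → y i = herm w (g (vec i)) := fun i hi hiε => by
    rw [hy, pr_apply, if_pos hiε, sum_smul_vec_apply U (fun i => herm w (g (vec i))) hi]
  have hyU' : ∀ i ∉ U, y i = 0 := fun i hi => by
    rw [hy, pr_apply]
    split_ifs
    · rw [Finsupp.finsetSum_apply]
      exact Finset.sum_eq_zero fun k hk => by
        rw [Finsupp.smul_apply, vec_apply_ne (i := k) (j := i) fun h => hi (h ▸ hk), smul_zero]
    · rfl
  refine ⟨y, by rw [hy]; exact pr_mem _ _, fun z hz hzy => ?_⟩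
  obtain ⟨R, hR⟩ : ∃ R, R = U ∪ z.support := ⟨_, rfl⟩
  have hzR : ∀ i ∉ R, z i = 0 := fun i hi => by
    by_contra h
    exact hi (by rw [hR]; exact Finset.mem_union_right _ (Finsupp.mem_support_iff.2 h))
  rw [herm_eq_sum hzR] at hzy
  have h1 : herm (g z) w = ε • ∑ i ∈ R, sgn i • (z i * star (y i)) := by
    conv_lhs => rw [eq_sum_vec hzR]
    rw [map_sum, herm_sum_left, Finset.smul_sum]
    refine Finset.sum_congr rfl fun i _ => ?_
    rw [map_smul, herm_smul_left]
    by_cases hiε : sgn i = ε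
    · rw [hiε, smul_smul, hε.mul_self, one_smul]
      congr 1
      by_cases hiU : i ∈ U
      · rw [hyU i hiU hiε, star_herm]
      · rw [hyU' i hiU, star_zero]
        have hiS : i ∉ S := fun h => hiU (by rw [hU]; exact Finset.mem_union_left _ h)
        have hiw : w i = 0 := by
          by_contra h
          exact hiU (by rw [hU]; exact Finset.mem_union_right _ (Finsupp.mem_support_iff.2 h))
        rw [hS.1 i hiS, herm_vec_left, hiw, star_zero, smul_zero]
    · rw [mem_Vs.1 hz i hiε]; simp
  rw [h1, hzy, smul_zero]

/-- If all translates of the cycle stay in the domain, semidefiniteness implies definiteness. -/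
theorem def_of_semidef (hC : IsChain (· ≤ ·) C) (hco : ∀ F ∈ C, Coord F) {g : GLV q} (hg : g ∈ G q)
    (h : g • MulAction.orbit (K₀ q) C ⊆ MulAction.orbit (G₀ q) C) {ε : ℝ} (hε : IsSign ε)
    (hs : Sep ε C) (hsd : ∀ z ∈ g • Vs q ε, 0 ≤ ε * (herm z z).re) : Def ε (g • Vs q ε) := by
  intro w hw hw0
  refine lt_of_le_of_ne (hsd w hw) fun h0 => ?_
  obtain ⟨x, hx, rfl⟩ := (Submodule.mem_smul_pointwise_iff_exists _ _ _).1 hw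
  replace hw : g x ∈ g • Vs q ε := hw
  replace hw0 : g x ≠ 0 := hw0
  replace h0 : 0 = ε * (herm (g x) (g x)).re := h0
  have hx0 : x ≠ 0 := fun h => hw0 (by rw [h, map_zero])
  have hn : (herm (g x) (g x)).re = 0 := (mul_eq_zero.1 h0.symm).resolve_left (by
    rcases hε with rfl | rfl <;> norm_num)
  have horth : ∀ z ∈ Vs q ε, herm (g x) (g z) = 0 := fun z hz =>
    herm_eq_zero_of_semidef hε hsd hw (apply_mem_smul.2 hz) hn
  -- The isotropic `g x` is orthogonal to `g • V_ε`; on `V_{-ε}` its pairing with `g z` vanishes on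
  -- the orthogonal complement of `y`. Moving `x` into `F` and `y` to a multiple of `vec j`, which
  -- `F` omits, puts `g x` in the radical of a translate of `F`.
  obtain ⟨y, hy, hyz⟩ := exists_representing hε.neg hg (g x)
  obtain ⟨F, hF, ⟨i, hi, hiF⟩, j, hj, hjF⟩ := hs
  obtain ⟨k, hk, ⟨c, hc, h1⟩, h2⟩ : ∃ k ∈ K₀ q, (∃ c : ℍ[ℝ], c ≠ 0 ∧ k x = c • vec i) ∧
      ∃ c : ℍ[ℝ], k y = c • vec j := by
    by_cases hy0 : y = 0
    · obtain ⟨k, hk, h1, -⟩ := exists_K₀_line hε hx (vec_mem_Vs hi) hx0 (vec_ne_zero i)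
      exact ⟨k, hk, h1, 0, by rw [hy0, map_zero, zero_smul]⟩
    · obtain ⟨k, hk, h1, c, -, h2⟩ := exists_K₀_two_lines hε hx hy (vec_mem_Vs hi) (vec_mem_Vs hj)
        hx0 hy0 (vec_ne_zero i) (vec_ne_zero j)
      exact ⟨k, hk, h1, c, h2⟩
  obtain ⟨c', h2⟩ := h2
  have hxF : x ∈ k⁻¹ • F := by rw [mem_smul_inv_of, h1]; exact F.smul_mem _ hiF
  have horth' : ∀ z ∈ k⁻¹ • F, herm (g x) (g z) = 0 := fun z hz => by
    rw [mem_smul_inv_of] at hz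
    rw [← pr_add_pr hε z, map_add, herm_add_right, horth _ (pr_mem _ _), zero_add, ← star_herm,
      hyz _ (pr_mem _ _), star_zero]
    rw [← K₀_herm hk, h2, ← K₀_pr hk hε.neg, herm_smul_right, herm_vec_right]
    have h3 : (pr q (-ε) (k z)) j = 0 := by
      by_contra h3
      exact hjF (hco F hF _ ((hco F hF).split _ hz (-ε) hε.neg) j h3)
    rw [h3, smul_zero, zero_mul]
  obtain ⟨g₀, hg₀, h3⟩ := mem_orbit_subgroup.1
    (h ⟨k⁻¹ • C, mem_orbit_subgroup.2 ⟨k⁻¹, inv_mem hk, rfl⟩, rfl⟩)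
  have h4 : g • k⁻¹ • F = g₀ • F := by
    rw [← mul_smul]
    exact smul_eq_smul_of_chain (mul_mem hg (inv_mem (G₀_le (K₀_le hk)))) (G₀_le hg₀) hC
      (by rw [mul_smul]; exact h3) hF
  -- The translate of the flag lies in the `G₀`-orbit of a coordinate flag, so its members are
  -- nondegenerate.
  have h5 : Nondeg (g • k⁻¹ • F) := by rw [h4]; exact (hco F hF).nondeg.smul hg₀
  refine hw0 (h5 _ (apply_mem_smul.2 hxF) fun z hz => ?_)
  obtain ⟨z', hz', rfl⟩ := (Submodule.mem_smul_pointwise_iff_exists _ _ _).1 hz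
  exact horth' z' hz'

end Cycle

/-! ### Plots of homogeneous spaces -/

section Plots
variable {X : Type*} [MulAction (GLV q) X]

theorem mem_plots_iff {n : ℕ} {p : EuclideanSpace ℝ (Fin n) → X} :
    p ∈ (orbitDiffeology q X).plots n ↔ ∀ y, ∃ w, IsOpen w ∧ y ∈ w ∧
      ∃ (γ : EuclideanSpace ℝ (Fin n) → GLV q) (x : X), SmoothFamily γ w ∧
        ∀ z ∈ w, p z = γ z • x :=
  ⟨fun h y => (h y trivial).imp fun _ hw => ⟨hw.1, hw.2.1, hw.2.2.2⟩,
    fun h y _ => (h y).imp fun _ hw => ⟨hw.1, hw.2.1, Set.subset_univ _, hw.2.2⟩⟩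

/-- Near a point with value `g • x`, a plot is a smooth family through `g` applied to `x`. -/
theorem exists_family_of_plot {n : ℕ} {p : EuclideanSpace ℝ (Fin n) → X}
    (hp : p ∈ (orbitDiffeology q X).plots n) {y : EuclideanSpace ℝ (Fin n)} {g : GLV q}
    (hg : g ∈ G q) {x : X} (h : p y = g • x) :
    ∃ w, IsOpen w ∧ y ∈ w ∧ ∃ γ : EuclideanSpace ℝ (Fin n) → GLV q, SmoothFamily γ w ∧ γ y = g ∧
      ∀ z ∈ w, p z = γ z • x := by
  obtain ⟨w, hw, hy, γ, x', hγ, hx'⟩ := mem_plots_iff.1 hp y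
  refine ⟨w, hw, hy, fun z => γ z * ((γ y)⁻¹ * g),
    hγ.mul (SmoothFamily.const (mul_mem (inv_mem (hγ.mem_G hy)) hg) w), mul_inv_cancel_left _ _,
    fun z hz => ?_⟩
  rw [mul_smul, mul_smul, ← h, hx' y hy, inv_smul_smul, hx' z hz]

/-- Openness is tested on plots, and near a point with value `g • x` a plot is a smooth family
through `g` applied to `x`. -/
theorem isOpen_of_family {x : X} (Q : GLV q → Prop)
    (h : ∀ (n : ℕ) (w : Set (EuclideanSpace ℝ (Fin n))) (γ : EuclideanSpace ℝ (Fin n) → GLV q),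
      IsOpen w → SmoothFamily γ w → ∀ y ∈ w, Q (γ y) → ∀ᶠ z in nhds y, Q (γ z)) :
    @IsOpen X (orbitDiffeology q X).dTopology {x' | ∃ g ∈ G q, Q g ∧ x' = g • x} := by
  refine (@Diffeology.isOpen_iff_preimages_plots X (orbitDiffeology q X) _).2 fun n p hp => ?_
  rw [isOpen_iff_mem_nhds]
  rintro y ⟨g, hg, hQ, hgx⟩
  obtain ⟨w, hw, hy, γ, hγ, hγy, hz⟩ := exists_family_of_plot hp hg hgx
  filter_upwards [h n w γ hw hγ y hy (by rwa [hγy]), hw.mem_nhds hy] with z h1 h2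
  exact ⟨γ z, hγ.mem_G h2, h1, hz z h2⟩

/-- A map of the form `g • x₁ ↦ g • x₂` uses the same local family in `G` for a plot and for its
image. -/
theorem dSmooth_of_orbit {X₂ : Type*} [MulAction (GLV q) X₂] {s₁ : Set X} {s₂ : Set X₂} {x₁ : X}
    {x₂ : X₂} (f : s₁ → s₂) (h₁ : ∀ x ∈ s₁, ∃ g ∈ G q, x = g • x₁)
    (h₂ : ∀ g ∈ G q, ∀ h : g • x₁ ∈ s₁, (f ⟨g • x₁, h⟩ : X₂) = g • x₂) :
    @Diffeology.DSmooth _ _ (subDiffeology (orbitDiffeology q X) s₁)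
      (subDiffeology (orbitDiffeology q X₂) s₂) f := by
  intro n p hp
  refine mem_plots_iff.2 fun y => ?_
  obtain ⟨g, hg, hgx⟩ := h₁ _ (p y).2
  obtain ⟨w, hw, hy, γ, hγ, -, hz⟩ := exists_family_of_plot (p := Subtype.val ∘ p) hp hg hgx
  refine ⟨w, hw, hy, γ, x₂, hγ, fun z hzw => ?_⟩
  have h3 : p z = ⟨γ z • x₁, by rw [← hz z hzw]; exact (p z).2⟩ := Subtype.ext (hz z hzw)
  have h4 := h₂ (γ z) (hγ.mem_G hzw) (by rw [← hz z hzw]; exact (p z).2)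
  rw [← h4]
  exact congrArg (fun a => (f a : X₂)) h3

end Plots

/-! ### Open orbits -/

theorem contDiffOn_real_smul {X : Type*} [NormedAddCommGroup X] [NormedSpace ℝ X] {w : Set X}
    {f : X → ℝ} (hf : ContDiffOn ℝ ∞ f w) (N : V q →ₗ[ℍ[ℝ]] V q) :
    SmoothLin (fun y => f y • N) w := fun i =>
  ⟨⟨(N (vec i)).support, fun y _ => mem_spanOf.2 fun j hj => by
      rw [LinearMap.smul_apply, Finsupp.smul_apply, Finsupp.notMem_support_iff.1 hj, smul_zero]⟩,
    fun j => (hf.smul (contDiffOn_const (c := N (vec i) j))).congr fun y _ => rfl⟩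

theorem real_smul_eq (c : ℝ) (x : V q) : c • x = (c : ℍ[ℝ]) • x := by
  ext1 i
  exact (Quaternion.coe_mul_eq_smul c (x i)).symm

/-- A hyperbolic partner of `x`: normalize some `y₀` with `herm x y₀ = 1`, then subtract half of its
square times `x`. -/
theorem exists_isotropic_dual {x : V q} (hx0 : x ≠ 0) (hxx : herm x x = 0) :
    ∃ y, herm x y = 1 ∧ herm y y = 0 := by
  obtain ⟨i, hi⟩ : ∃ i, herm x (vec i) ≠ 0 := by
    by_contra h
    push Not at h
    exact hx0 (eq_zero_of_herm h)
  obtain ⟨y₀, hy₀⟩ : ∃ y₀, y₀ = star (herm x (vec i))⁻¹ • (vec i : V q) := ⟨_, rfl⟩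
  have h1 : herm x y₀ = 1 := by rw [hy₀, herm_smul_right, star_star, mul_inv_cancel₀ hi]
  have h1' : herm y₀ x = 1 := by rw [← star_herm, h1, star_one]
  obtain ⟨r, hr⟩ : ∃ r, r = (herm y₀ y₀).re := ⟨_, rfl⟩
  have h2 : herm y₀ y₀ = (r : ℍ[ℝ]) := by rw [hr]; exact herm_self y₀
  refine ⟨y₀ - ((r / 2 : ℝ) : ℍ[ℝ]) • x, ?_, ?_⟩
  · rw [herm_sub_right, herm_smul_right, hxx, zero_mul, sub_zero, h1]
  · rw [herm_sub_right, herm_sub_left, herm_sub_left, herm_smul_right, herm_smul_right, herm_smul_left,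
      herm_smul_left, hxx, h1, h1', h2, one_mul, mul_one, mul_zero, zero_mul, sub_zero,
      Quaternion.star_coe, sub_sub, ← Quaternion.coe_add, add_halves, sub_self]

/-- Suppose `x ≠ 0` is in the radical `R` of `F`, and let `y` be a hyperbolic partner. The elements
`z ↦ z + t ⟨z, y⟩ y` move the flag along a curve, and openness provides `t ≠ 0` and `g₀` in `G₀`
with the same effect on the flag. The radical of the moved subspace is `g₀ • R`, and it is contained
in the part of `R` orthogonal to `y`. An element of `G` cannot shrink `R`, so `x` is orthogonal to
`y`, which is absurd. -/
theorem nondeg_of_isOpen {C : Chain q} (hC : IsChain (· ≤ ·) C)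
    (ho : @IsOpen (Chain q) (orbitDiffeology q (Chain q)).dTopology (MulAction.orbit (G₀ q) C))
    {F : Sub q} (hF : F ∈ C) : Nondeg F := by
  classical
  intro x hx hxF
  by_contra hx0
  obtain ⟨y, hxy, hyy⟩ := exists_isotropic_dual hx0 (hxF x hx)
  have hyx : herm y x = 1 := by rw [← star_herm, hxy, star_one]
  let N : V q →ₗ[ℍ[ℝ]] V q :=
    { toFun := fun z => herm z y • y
      map_add' := fun a b => by rw [herm_add_left, add_smul]
      map_smul' := fun c a => by rw [herm_smul_left, mul_smul, RingHom.id_apply] }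
  have hN : ∀ z, N z = herm z y • y := fun _ => rfl
  have hNy : N y = 0 := by rw [hN, hyy, zero_smul]
  have hsq : ∀ (t : ℝ) z, (t • N) ((t • N) z) = 0 := fun t z => by
    simp only [LinearMap.smul_apply, real_smul_eq, map_smul, hN z, hNy, smul_zero]
  obtain ⟨S, hS⟩ : ∃ S, S = y.support := ⟨_, rfl⟩
  have hyS : ∀ i ∉ S, y i = 0 := fun i hi => by rw [hS] at hi; simpa using hi
  have hmem : ∀ t : ℝ, uni (t • N) ∈ levelSL S := fun t => uni_mem (hsq t)
    (fun i hi => by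
      rw [LinearMap.smul_apply, hN, herm_vec_left, hyS i hi, star_zero, smul_zero, zero_smul, smul_zero])
    fun z => by
      rw [LinearMap.smul_apply, real_smul_eq, hN]
      exact Submodule.smul_mem _ _ (Submodule.smul_mem _ _ (mem_spanOf.2 hyS))
  have happ : ∀ (t : ℝ) z, uni (t • N) z = z + ((t : ℍ[ℝ]) * herm z y) • y := fun t z => by
    rw [uni_apply (hsq t), LinearMap.smul_apply, real_smul_eq, hN, mul_smul]
  let p : EuclideanSpace ℝ (Fin 1) → Chain q := fun z => uni (z 0 • N) • C
  have hcoord : ContDiff ℝ ∞ fun z : EuclideanSpace ℝ (Fin 1) => z 0 :=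
    (EuclideanSpace.proj (𝕜 := ℝ) (0 : Fin 1)).contDiff
  have hp : p ∈ (orbitDiffeology q (Chain q)).plots 1 := by
    refine mem_plots_iff.2 fun _ => ⟨Set.univ, isOpen_univ, trivial, fun z => uni (z 0 • N), C,
      ⟨S, fun z _ => hmem _, fun i j => ?_⟩, fun z _ => rfl⟩
    refine ((((SmoothLin.const LinearMap.id).add
      (contDiffOn_real_smul hcoord.contDiffOn N)) i).2 j).congr fun z _ => ?_
    rw [uni_apply (hsq _)]; rfl
  have hopen := (@Diffeology.isOpen_iff_preimages_plots _ (orbitDiffeology q (Chain q)) _).1 ho 1 p hp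
  have h0 : (0 : EuclideanSpace ℝ (Fin 1)) ∈ p ⁻¹' MulAction.orbit (G₀ q) C := by
    change uni (((0 : EuclideanSpace ℝ (Fin 1)) 0) • N) • C ∈ MulAction.orbit (G₀ q) C
    have : uni (((0 : EuclideanSpace ℝ (Fin 1)) 0) • N) = 1 := by
      ext1 z
      rw [happ]; simp
    rw [this, one_smul]
    exact MulAction.mem_orbit_self C
  obtain ⟨t, ht0, ht⟩ : ∃ t : ℝ, t ≠ 0 ∧ uni (t • N) • C ∈ MulAction.orbit (G₀ q) C := by
    have hc : Continuous fun t : ℝ => t • EuclideanSpace.single (0 : Fin 1) (1 : ℝ) := by fun_prop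
    have h1 : ∀ᶠ t : ℝ in nhds 0, t • EuclideanSpace.single (0 : Fin 1) (1 : ℝ) ∈
        p ⁻¹' MulAction.orbit (G₀ q) C :=
      (hopen.preimage hc).mem_nhds (by
        rw [Set.mem_preimage, zero_smul]; exact h0)
    obtain ⟨t, h2, h3⟩ := ((h1.filter_mono nhdsWithin_le_nhds).and
      (self_mem_nhdsWithin (s := {(0 : ℝ)}ᶜ))).exists
    refine ⟨t, h3, ?_⟩
    have h4 : uni (((t • EuclideanSpace.single (0 : Fin 1) (1 : ℝ)) 0) • N) • C ∈
      MulAction.orbit (G₀ q) C := h2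
    simpa using h4
  obtain ⟨g₀, hg₀, h1⟩ := mem_orbit_subgroup.1 ht
  have h2 : uni (t • N) • F = g₀ • F := smul_eq_smul_of_chain ⟨S, hmem t⟩ (G₀_le hg₀) hC h1 hF
  have ht0' : (t : ℍ[ℝ]) ≠ 0 := fun h => ht0 (Quaternion.coe_injective (by simpa using h))
  let R : Sub q :=
    { carrier := {z | z ∈ F ∧ ∀ u ∈ F, herm z u = 0}
      add_mem' := fun ha hb => ⟨add_mem ha.1 hb.1, fun u hu => by
        rw [herm_add_left, ha.2 u hu, hb.2 u hu, add_zero]⟩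
      zero_mem' := ⟨zero_mem _, fun u _ => herm_zero_left u⟩
      smul_mem' := fun c a ha => ⟨F.smul_mem _ ha.1, fun u hu => by
        rw [herm_smul_left, ha.2 u hu, mul_zero]⟩ }
  have hR : ∀ z, z ∈ R ↔ z ∈ F ∧ ∀ u ∈ F, herm z u = 0 := fun _ => Iff.rfl
  have key : ∀ z ∈ g₀ • R, z ∈ R ∧ herm z y = 0 := by
    intro z hz
    obtain ⟨a, ha, rfl⟩ := (Submodule.mem_smul_pointwise_iff_exists _ _ _).1 hz
    change g₀ a ∈ R ∧ herm (g₀ a) y = 0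
    have hga : g₀ a ∈ uni (t • N) • F := by rw [h2]; exact apply_mem_smul.2 ha.1
    have hrad : ∀ u ∈ F, herm (g₀ a) (uni (t • N) u) = 0 := fun u hu => by
      have h3 : uni (t • N) u ∈ g₀ • F := by rw [← h2]; exact apply_mem_smul.2 hu
      obtain ⟨b, hb, h4⟩ := (Submodule.mem_smul_pointwise_iff_exists _ _ _).1 h3
      rw [← h4]
      exact (hg₀.2 a b).trans (ha.2 b hb)
    obtain ⟨z, hz, h5⟩ := (Submodule.mem_smul_pointwise_iff_exists _ _ _).1 hga
    have h6 : g₀ a = z + ((t : ℍ[ℝ]) * herm z y) • y := by rw [← happ]; exact h5.symm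
    -- Pairing `g₀ a = z + t ⟨z, y⟩ y` with the image `x + t y` of `x` gives `2 t ⟨z, y⟩ = 0`.
    have h7 := hrad x hx
    have hzx : herm z x = 0 := by rw [← star_herm, hxF z hz, star_zero]
    rw [h6, happ, hxy, mul_one, herm_add_left, herm_add_right, herm_add_right, herm_smul_left,
      herm_smul_left, herm_smul_right, herm_smul_right, hzx, hyx, hyy, Quaternion.star_coe, zero_add,
      mul_one, zero_mul, mul_zero, add_zero, Quaternion.coe_commutes, ← mul_two] at h7
    have h8 : herm z y = 0 := by
      have h9 : (2 : ℍ[ℝ]) ≠ 0 := fun h => by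
        have : ((2 : ℝ) : ℍ[ℝ]) = ((0 : ℝ) : ℍ[ℝ]) := by exact_mod_cast h
        exact two_ne_zero (Quaternion.coe_injective this)
      simpa [h9, ht0'] using h7
    have h10 : g₀ a = z := by rw [h6, h8, mul_zero, zero_smul, add_zero]
    rw [h10]
    refine ⟨⟨hz, fun u hu => ?_⟩, h8⟩
    have h11 := hrad u hu
    rwa [h10, happ, herm_add_right, herm_smul_right, h8, zero_mul, add_zero] at h11
  have h3 : g₀ • R = R := smul_eq_of_le (G₀_le hg₀) fun z hz => (key z hz).1
  have h4 : x ∈ g₀ • R := by rw [h3]; exact ⟨hx, hxF⟩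
  have h5 := (key x h4).2
  rw [hxy] at h5
  exact one_ne_zero h5

/-! ### Rigidity, and the cycle space of a coordinate flag. -/

theorem Vs_eq_top {ε : ℝ} (hε : IsSign ε) (h : Vs q (-ε) = ⊥) : Vs q ε = ⊤ := by
  refine eq_top_iff.2 fun x _ => ?_
  have h1 : pr q (-ε) x = 0 := (Submodule.mem_bot _).1 (h ▸ pr_mem (-ε) x)
  rw [← pr_add_pr hε x, h1, add_zero]
  exact pr_mem _ _

/-- The cycle through the chain determines the translate of `V_ε`. -/
def Rigid (ε : ℝ) (C : Chain q) : Prop := Sep ε C ∨ Vs q (-ε) = ⊥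

section Cycle
variable {C : Chain q}

theorem Rigid.smul_Vs (hC : IsChain (· ≤ ·) C) (hco : ∀ F ∈ C, Coord F) {ε : ℝ} (hε : IsSign ε)
    (hr : Rigid ε C) {g g' : GLV q} (hg : g ∈ G q) (hg' : g' ∈ G q)
    (h : g • MulAction.orbit (K₀ q) C = g' • MulAction.orbit (K₀ q) C) :
    g • Vs q ε = g' • Vs q ε := by
  rcases hr with hr | hr
  · have h1 := smul_Vs_of_sep hC hco (mul_mem (inv_mem hg') hg)
      (by rw [mul_smul, h, inv_smul_smul]) hε hr
    rwa [mul_smul, inv_smul_eq_iff] at h1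
  · rw [Vs_eq_top hε hr, smul_top', smul_top']

theorem Rigid.def_of_semidef (hC : IsChain (· ≤ ·) C) (hco : ∀ F ∈ C, Coord F) {ε : ℝ}
    (hε : IsSign ε) (hr : Rigid ε C) {g : GLV q} (hg : g ∈ G q)
    (h : g • MulAction.orbit (K₀ q) C ⊆ MulAction.orbit (G₀ q) C)
    (hsd : ∀ z ∈ g • Vs q ε, 0 ≤ ε * (herm z z).re) : Def ε (g • Vs q ε) := by
  rcases hr with hr | hr
  · exact QuatCycle.def_of_semidef hC hco hg h hε hr hsd
  · have h1 := def_Vs (q := q) hε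
    rw [Vs_eq_top hε hr] at h1 ⊢
    rwa [smul_top']

/-- The cycle depends only on the translate of `V_ε` here, so a `g` which keeps just `V_ε` definite
can be replaced by an isometry. -/
theorem exists_adm_of_def (hC : IsChain (· ≤ ·) C) (hco : ∀ F ∈ C, Coord F) {ε : ℝ}
    (hε : IsSign ε) (hs : ¬ Sep (-ε) C) {g : GLV q} (hg : g ∈ G q) (h : Def ε (g • Vs q ε)) :
    ∃ g₀ ∈ G₀ q, g • Vs q ε = g₀ • Vs q ε ∧
      g • MulAction.orbit (K₀ q) C = g₀ • MulAction.orbit (K₀ q) C := by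
  obtain ⟨g₀, hg₀, h1⟩ := exists_G₀_of_def hg hε h
  refine ⟨g₀, hg₀, h1, ?_⟩
  have h2 := smul_cycle_of_not_sep hC hco hε hs (mul_mem (inv_mem (G₀_le hg₀)) hg)
    (by rw [mul_smul, h1, inv_smul_smul])
  rwa [mul_smul, inv_smul_eq_iff] at h2

theorem smul_cycle_congr (hC : IsChain (· ≤ ·) C) (hco : ∀ F ∈ C, Coord F) {g g' : GLV q}
    (hg : g ∈ G q) (hg' : g' ∈ G q) (h : ∀ ε, IsSign ε → g • Vs q ε = g' • Vs q ε) :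
    g • MulAction.orbit (K₀ q) C = g' • MulAction.orbit (K₀ q) C := by
  have h2 := smul_cycle_of_stab hC hco (mul_mem (inv_mem hg') hg)
    fun ε hε => by rw [mul_smul, h ε hε, inv_smul_smul]
  rwa [mul_smul, inv_smul_eq_iff] at h2

theorem eventually_adm {n : ℕ} {w : Set (EuclideanSpace ℝ (Fin n))}
    {γ : EuclideanSpace ℝ (Fin n) → GLV q} (hw : IsOpen w) (hγ : SmoothFamily γ w)
    {y : EuclideanSpace ℝ (Fin n)} (hy : y ∈ w) (h : Adm (γ y)) :
    ∀ᶠ z in nhds y, Adm (γ z) := by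
  have hs := hγ.smoothLin
  obtain ⟨S, hS, -⟩ := hγ
  filter_upwards [eventually_def isSign_one hw hS hs hy (h 1 isSign_one),
    eventually_def isSign_neg_one hw hS hs hy (h (-1) isSign_neg_one)] with z h1 h2
  rintro ε (rfl | rfl)
  exacts [h1, h2]

/-- A vector violating semidefiniteness keeps violating it for nearby parameters. -/
theorem eventually_not_semidef {ε : ℝ} {n : ℕ} {w : Set (EuclideanSpace ℝ (Fin n))}
    {γ : EuclideanSpace ℝ (Fin n) → GLV q} (hw : IsOpen w) (hγ : SmoothFamily γ w)
    {y : EuclideanSpace ℝ (Fin n)} (hy : y ∈ w)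
    (h : ¬ ∀ z ∈ γ y • Vs q ε, 0 ≤ ε * (herm z z).re) :
    ∀ᶠ z in nhds y, ¬ ∀ x ∈ γ z • Vs q ε, 0 ≤ ε * (herm x x).re := by
  push Not at h
  obtain ⟨_, hx', h1⟩ := h
  obtain ⟨x, hx, rfl⟩ := (Submodule.mem_smul_pointwise_iff_exists _ _ _).1 hx'
  have hc : ContinuousOn (fun z => ε * (herm (γ z x) (γ z x)).re) w :=
    (contDiffOn_const.mul (contDiffOn_re (hγ.smoothLin.herm hγ.smoothLin x x))).continuousOn
  filter_upwards [(hc.continuousAt (hw.mem_nhds hy)).eventually (gt_mem_nhds h1)] with z hz h2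
  exact absurd (h2 _ (apply_mem_smul.2 hx)) (not_le.2 hz)

/-- On the graph the form is that of `x` plus that of `N x`, of opposite sign; scaling `N` by `t`
multiplies the harmful term by `t ^ 2`. -/
theorem def_uni_smul {ε : ℝ} (hε : IsSign ε) {S : Finset (Idx q)} {N : V q →ₗ[ℍ[ℝ]] V q}
    (hN : Off ε S N) {t : ℝ} (ht : t ^ 2 ≤ 1) (h : Def ε (uni N • Vs q ε)) :
    Off ε S (t • N) ∧ Def ε (uni (t • N) • Vs q ε) := by
  have hO : Off ε S (t • N) := by
    refine ⟨fun x => ?_, fun x hx => ?_, fun i hi => ?_, fun x => ?_⟩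
    · rw [LinearMap.smul_apply, real_smul_eq]; exact Submodule.smul_mem _ _ (hN.mem x)
    · rw [LinearMap.smul_apply, hN.ker x hx, smul_zero]
    · rw [LinearMap.smul_apply, hN.fix i hi, smul_zero]
    · rw [LinearMap.smul_apply, real_smul_eq]; exact Submodule.smul_mem _ _ (hN.span x)
  refine ⟨hO, ?_⟩
  have key : ∀ (N' : V q →ₗ[ℍ[ℝ]] V q), Off ε S N' → ∀ x ∈ Vs q ε,
      (herm (uni N' x) (uni N' x)).re = (herm x x).re + (herm (N' x) (N' x)).re := by
    intro N' hN' x hx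
    rw [hN'.uni_apply, herm_add_self_re, herm_Vs_Vs hε hx (hN'.mem x)]
    simp
  intro z hz hz0
  obtain ⟨x, hx, rfl⟩ := (Submodule.mem_smul_pointwise_iff_exists _ _ _).1 hz
  have hx0 : x ≠ 0 := fun h0 => hz0 (by rw [h0]; exact map_zero (uni (t • N)))
  change 0 < ε * (herm (uni (t • N) x) (uni (t • N) x)).re
  have h1 := h _ (apply_mem_smul.2 hx) (fun h0 => hx0 (by simpa using h0))
  have h2 := (def_Vs hε.neg).nonneg (hN.mem x)
  rw [key N hN x hx] at h1
  rw [key _ hO x hx, LinearMap.smul_apply, real_smul_eq, herm_smul_smul_re,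
    Quaternion.normSq_coe]
  nlinarith

/-- The translates of the base cycle by elements which keep the standard summands definite. -/
def admTranslates (C : Chain q) : Set (Set (Chain q)) :=
  {Z | ∃ g ∈ G q, Adm g ∧ Z = g • MulAction.orbit (K₀ q) C}

/-- Shrinking the slopes of both graphs simultaneously to zero joins a translate to the base cycle;
`exists_prod_chart` lifts the path of pairs of subspaces to a smooth family in `G`, that is, to a
plot. -/
theorem isPreconnected_admTranslates (hC : IsChain (· ≤ ·) C) (hco : ∀ F ∈ C, Coord F) :
    @IsPreconnected _ (orbitDiffeology q (Set (Chain q))).dTopology (admTranslates C) := by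
  let _ : TopologicalSpace (Set (Chain q)) := (orbitDiffeology q (Set (Chain q))).dTopology
  refine isPreconnected_of_forall (MulAction.orbit (K₀ q) C) ?_
  rintro _ ⟨g, ⟨S, hS⟩, hadm, rfl⟩
  have hN : ∀ ε, IsSign ε → ∃ N : V q →ₗ[ℍ[ℝ]] V q, Off ε S N ∧ uni N • Vs q ε = g • Vs q ε := by
    intro ε hε
    obtain ⟨N, hN, -, h1⟩ := exists_chart (X := ℝ) (w := Set.univ) hε (g := fun _ => g) (S := S)
      (fun _ _ => hS) (SmoothLin.const _) fun _ _ => Off.def_inj hε (hadm ε hε)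
    exact ⟨N 0, hN 0, h1 0 trivial⟩
  obtain ⟨N, hN1, hN2⟩ := hN 1 isSign_one
  obtain ⟨N', hN'1, hN'2⟩ := hN (-1) isSign_neg_one
  have hdef := fun t ht => def_uni_smul isSign_one hN1 (t := t) ht
    (by rw [hN2]; exact hadm 1 isSign_one)
  have hdef' := fun t ht => def_uni_smul isSign_neg_one hN'1 (t := t) ht
    (by rw [hN'2]; exact hadm (-1) isSign_neg_one)
  -- The sine keeps the parameter in `[-1, 1]` on the whole line and takes the values `0` and `1`,
  -- so the path is a plot defined everywhere.
  have hsin : ∀ s : ℝ, Real.sin s ^ 2 ≤ 1 := Real.sin_sq_le_one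
  let f : EuclideanSpace ℝ (Fin 1) → ℝ := fun z => Real.sin (z 0)
  have hf : ContDiffOn ℝ ∞ f Set.univ :=
    (Real.contDiff_sin.comp (EuclideanSpace.proj (𝕜 := ℝ) (0 : Fin 1)).contDiff).contDiffOn
  have hsm : ∀ {ε : ℝ} (M : V q →ₗ[ℍ[ℝ]] V q), (∀ z, Off ε S (f z • M)) →
      SmoothLin (fun z => (uni (f z • M)).toLinearMap) Set.univ := fun M hM =>
    ((SmoothLin.const LinearMap.id).add (contDiffOn_real_smul hf M)).congr
      fun z _ => (hM z).toLinearMap_uni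
  obtain ⟨δ, hδ, hδs, hδV⟩ := exists_prod_chart isSign_one (X := EuclideanSpace ℝ (Fin 1))
    (w := Set.univ) (g := fun z => uni (f z • N)) (g' := fun z => uni (f z • N')) (S := S)
    (fun z _ => (hdef _ (hsin _)).1.uni_mem) (hsm N fun z => (hdef _ (hsin _)).1)
    (fun z _ => (hdef' _ (hsin _)).1.uni_mem) (hsm N' fun z => (hdef' _ (hsin _)).1)
    (fun z _ => (hdef _ (hsin _)).2) (fun z _ => (hdef' _ (hsin _)).2)
  have hδadm : ∀ z, Adm (δ z) := by
    rintro z ε (rfl | rfl)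
    · rw [(hδV z trivial).1]; exact (hdef _ (hsin _)).2
    · rw [(hδV z trivial).2]; exact (hdef' _ (hsin _)).2
  let p : EuclideanSpace ℝ (Fin 1) → Set (Chain q) := fun z => δ z • MulAction.orbit (K₀ q) C
  have hp : p ∈ (orbitDiffeology q (Set (Chain q))).plots 1 :=
    mem_plots_iff.2 fun _ => ⟨Set.univ, isOpen_univ, trivial, δ, _,
      ⟨S, hδ, fun i => (hδs i).2⟩, fun _ _ => rfl⟩
  have hpc : Continuous p :=
    @Diffeology.IsPlot.continuous _ (orbitDiffeology q (Set (Chain q))) 1 p hp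
  refine ⟨Set.range p, ?_, ⟨0, ?_⟩, ⟨EuclideanSpace.single 0 (Real.pi / 2), ?_⟩,
    isPreconnected_range hpc⟩
  · rintro _ ⟨z, rfl⟩
    exact ⟨δ z, ⟨S, hδ z trivial⟩, hδadm z, rfl⟩
  · change δ 0 • MulAction.orbit (K₀ q) C = _
    have h1 := smul_cycle_congr hC hco (g := δ 0) (g' := 1) ⟨S, hδ 0 trivial⟩ (one_mem _) ?_
    · rwa [one_smul] at h1
    have h2 : f 0 = 0 := by simp [f]
    have h3 : uni (0 : V q →ₗ[ℍ[ℝ]] V q) = 1 := by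
      ext1 x
      rw [uni_apply fun _ => rfl]; exact add_zero x
    rintro ε (rfl | rfl)
    · rw [(hδV 0 trivial).1, h2, zero_smul, h3]
    · rw [(hδV 0 trivial).2, h2, zero_smul, h3]
  · have h2 : f (EuclideanSpace.single 0 (Real.pi / 2)) = 1 := by simp [f]
    refine smul_cycle_congr hC hco ⟨S, hδ _ trivial⟩ ⟨S, hS⟩ ?_
    rintro ε (rfl | rfl)
    · rw [(hδV _ trivial).1, h2, one_smul, hN2]
    · rw [(hδV _ trivial).2, h2, one_smul, hN'2]

/-- The translates in the orbit are covered by two disjoint open sets, `admTranslates C` and the set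
`U` where semidefiniteness fails for some rigid sign: on the complement of `U`, semidefinite means
definite. Since the first set is connected and contains the base cycle, it is the component. -/
theorem cycleSpace_eq (hC : IsChain (· ≤ ·) C) (hco : ∀ F ∈ C, Coord F)
    (hr : (Rigid 1 C ∧ Rigid (-1) C) ∨ (Rigid 1 C ∧ ¬ Sep (-1) C) ∨ (¬ Sep 1 C ∧ Rigid (-1) C)) :
    cycleSpace (MulAction.orbit (G₀ q) C) (MulAction.orbit (K₀ q) C) = admTranslates C := by
  let _ : TopologicalSpace (Set (Chain q)) := (orbitDiffeology q (Set (Chain q))).dTopology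
  have hsub : admTranslates C ⊆ translatesIn (MulAction.orbit (G₀ q) C) (MulAction.orbit (K₀ q) C) := by
    rintro _ ⟨g, hg, hadm, rfl⟩
    exact ⟨⟨g, hg, rfl⟩, smul_cycle_subset hC hco hg hadm⟩
  have hY : MulAction.orbit (K₀ q) C ∈ admTranslates C :=
    ⟨1, one_mem _, Adm.of_G₀ (one_mem _), (one_smul _ _).symm⟩
  refine Set.Subset.antisymm ?_
    ((isPreconnected_admTranslates hC hco).subset_connectedComponentIn hY hsub)
  -- Restricting to rigid signs makes the condition depend on the cycle and not on the chosen `g`.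
  let U : Set (Set (Chain q)) := {Z | ∃ g ∈ G q, (∃ ε, IsSign ε ∧ Rigid ε C ∧
    ¬ ∀ z ∈ g • Vs q ε, 0 ≤ ε * (herm z z).re) ∧ Z = g • MulAction.orbit (K₀ q) C}
  have hUo : IsOpen U := isOpen_of_family _ fun n w γ hw hγ y hy ⟨ε, hε, hr, h⟩ =>
    (eventually_not_semidef hw hγ hy h).mono fun z hz => ⟨ε, hε, hr, hz⟩
  have hTo : IsOpen (admTranslates C) := isOpen_of_family _ fun n w γ hw hγ y hy h =>
    eventually_adm hw hγ hy h
  have hcov : translatesIn (MulAction.orbit (G₀ q) C) (MulAction.orbit (K₀ q) C) ⊆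
      admTranslates C ∪ U := by
    rintro _ ⟨⟨g, hg, rfl⟩, hD⟩
    by_cases hU : g • MulAction.orbit (K₀ q) C ∈ U
    · exact Or.inr hU
    left
    have hdef : ∀ ε, IsSign ε → Rigid ε C → Def ε (g • Vs q ε) := fun ε hε hr => by
      by_contra h1
      exact hU ⟨g, hg, ⟨ε, hε, hr, fun h2 => h1 (hr.def_of_semidef hC hco hε hg hD h2)⟩, rfl⟩
    have hsingle : ∀ ε, IsSign ε → Rigid ε C → ¬ Sep (-ε) C →
        g • MulAction.orbit (K₀ q) C ∈ admTranslates C := fun ε hε hr hs => by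
      obtain ⟨g₀, hg₀, -, h1⟩ := exists_adm_of_def hC hco hε hs hg (hdef ε hε hr)
      exact ⟨g₀, G₀_le hg₀, Adm.of_G₀ hg₀, h1⟩
    rcases hr with ⟨h1, h2⟩ | ⟨h1, h2⟩ | ⟨h1, h2⟩
    · refine ⟨g, hg, ?_, rfl⟩
      rintro ε (rfl | rfl)
      exacts [hdef 1 isSign_one h1, hdef (-1) isSign_neg_one h2]
    · exact hsingle 1 isSign_one h1 h2
    · exact hsingle (-1) isSign_neg_one h2 (by rwa [neg_neg])
  have hdisj : Disjoint (admTranslates C) U := by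
    rw [Set.disjoint_left]
    rintro _ ⟨g, hg, hadm, rfl⟩ ⟨g', hg', ⟨ε, hε, hr, h⟩, h1⟩
    rw [← hr.smul_Vs hC hco hε hg hg' h1] at h
    exact h fun z hz => (hadm ε hε).nonneg hz
  have hsubT : cycleSpace (MulAction.orbit (G₀ q) C) (MulAction.orbit (K₀ q) C) ⊆
      admTranslates C ∪ U :=
    (connectedComponentIn_subset _ _).trans hcov
  exact IsPreconnected.subset_left_of_subset_union hTo hUo hdisj hsubT
    ⟨_, mem_connectedComponentIn (hsub hY), hY⟩ isPreconnected_connectedComponentIn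

/-- If neither sign separates, every member is comparable with both summands. A member other than
`0` and `V` must then be one that contains one summand and is contained in the other, which makes
one summand vanish; and then the other sign is rigid. -/
theorem rigid_cases (hco : ∀ F ∈ C, Coord F) {F : Sub q} (hF : F ∈ C) (hb : F ≠ ⊥) (ht : F ≠ ⊤) :
    (Rigid 1 C ∧ Rigid (-1) C) ∨ (Rigid 1 C ∧ ¬ Sep (-1) C) ∨ (¬ Sep 1 C ∧ Rigid (-1) C) := by
  by_cases h1 : Sep 1 C
  · by_cases h2 : Sep (-1) C
    · exact Or.inl ⟨Or.inl h1, Or.inl h2⟩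
    · exact Or.inr (Or.inl ⟨Or.inl h1, h2⟩)
  by_cases h2 : Sep (-1) C
  · exact Or.inr (Or.inr ⟨h1, Or.inl h2⟩)
  rcases le_or_ge_of_not_sep hco isSign_one h2 hF with h3 | h3 <;>
    rcases le_or_ge_of_not_sep hco isSign_neg_one (by rwa [neg_neg]) hF with h4 | h4
  · exact absurd (eq_bot_iff.2 fun x hx => (Submodule.mem_bot _).2
      (Vs_inf isSign_one (h3 hx) (h4 hx))) hb
  · exact Or.inr (Or.inl ⟨Or.inr (eq_bot_iff.2 fun x hx => (Submodule.mem_bot _).2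
      (Vs_inf isSign_one (h3 (h4 hx)) hx)), h2⟩)
  · refine Or.inr (Or.inr ⟨h1, Or.inr ?_⟩)
    rw [neg_neg]
    exact eq_bot_iff.2 fun x hx => (Submodule.mem_bot _).2 (Vs_inf isSign_one hx (h4 (h3 hx)))
  · refine absurd (eq_top_iff.2 fun x _ => ?_) ht
    rw [← pr_add_pr isSign_one x]
    exact add_mem (h3 (pr_mem _ _)) (h4 (pr_mem _ _))

end Cycle

/-! ### Diffeomorphisms from cycle spaces to the bounded symmetric domains. -/

theorem Diffeomorphic.symm {X Y : Type*} {d : DiffeologicalSpace X} {d' : DiffeologicalSpace Y}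
    (h : Diffeomorphic d d') : Diffeomorphic d' d := by
  obtain ⟨e, h1, h2⟩ := h
  exact ⟨e.symm, h2, h1⟩

theorem Diffeomorphic.trans {X Y Z : Type*} {d : DiffeologicalSpace X} {d' : DiffeologicalSpace Y}
    {d'' : DiffeologicalSpace Z} (h : Diffeomorphic d d') (h' : Diffeomorphic d' d'') :
    Diffeomorphic d d'' := by
  obtain ⟨e, h1, h2⟩ := h
  obtain ⟨e', h1', h2'⟩ := h'
  exact ⟨e.trans e', h1'.comp h1, h2.comp h2'⟩

theorem Diffeomorphic.prod {X Y X' Y' : Type*} {d : DiffeologicalSpace X} {e : DiffeologicalSpace Y}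
    {d' : DiffeologicalSpace X'} {e' : DiffeologicalSpace Y'} (h : Diffeomorphic d d')
    (h' : Diffeomorphic e e') : Diffeomorphic (prodDiffeology d e) (prodDiffeology d' e') := by
  obtain ⟨f, h1, h2⟩ := h
  obtain ⟨f', h1', h2'⟩ := h'
  exact ⟨f.prodCongr f', fun n p hp => ⟨h1 n _ hp.1, h1' n _ hp.2⟩,
    fun n p hp => ⟨h2 n _ hp.1, h2' n _ hp.2⟩⟩

/-- The smooth structure of the bounded symmetric domains. -/
@[reducible]
def bsDiffeology (q : ℕ∞) (ε : ℝ) : DiffeologicalSpace (Bs q ε) :=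
  subDiffeology (orbitDiffeology q (Sub q)) (Bs q ε)

section Cycle
variable {C : Chain q}

/-- The map is `g • Y ↦ g • V_ε`. Rigidity makes it well defined; the missing separation for the
other sign makes it injective and lets every definite translate be lifted. -/
theorem diffeomorphic_of_rigid (hC : IsChain (· ≤ ·) C) (hco : ∀ F ∈ C, Coord F) {ε : ℝ}
    (hε : IsSign ε) (hr : Rigid ε C) (hs : ¬ Sep (-ε) C) {s : Set (Set (Chain q))}
    (hsC : s = admTranslates C) :
    Diffeomorphic (subDiffeology (orbitDiffeology q (Set (Chain q))) s) (bsDiffeology q ε) := by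
  have hex : ∀ Z : s, ∃ g ∈ G q, Adm g ∧ (Z : Set (Chain q)) = g • MulAction.orbit (K₀ q) C :=
    fun Z => hsC.subset Z.2
  choose γ hγ hadm hγZ using hex
  let f : s → Bs q ε := fun Z => ⟨γ Z • Vs q ε, ⟨γ Z, hγ Z, rfl⟩, hadm Z ε hε⟩
  have hf : ∀ g ∈ G q, ∀ h : g • MulAction.orbit (K₀ q) C ∈ s,
      (f ⟨g • MulAction.orbit (K₀ q) C, h⟩ : Sub q) = g • Vs q ε := fun g hg h =>
    (hr.smul_Vs hC hco hε hg (hγ _) (hγZ ⟨_, h⟩)).symm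
  have hlift : ∀ g ∈ G q, g • Vs q ε ∈ Bs q ε → g • MulAction.orbit (K₀ q) C ∈ s := by
    intro g hg h
    obtain ⟨g₀, hg₀, -, h1⟩ := exists_adm_of_def hC hco hε hs hg h.2
    rw [hsC]
    exact ⟨g₀, G₀_le hg₀, Adm.of_G₀ hg₀, h1⟩
  have hbij : Function.Bijective f := by
    constructor
    · intro Z Z' h
      have h1 : γ Z • Vs q ε = γ Z' • Vs q ε := congrArg Subtype.val h
      have h2 := smul_cycle_of_not_sep hC hco hε hs (mul_mem (inv_mem (hγ Z')) (hγ Z))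
        (by rw [mul_smul, h1, inv_smul_smul])
      rw [mul_smul, inv_smul_eq_iff] at h2
      exact Subtype.ext ((hγZ Z).trans (h2.trans (hγZ Z').symm))
    · rintro ⟨_, ⟨g, hg, rfl⟩, hd⟩
      exact ⟨⟨_, hlift g hg ⟨⟨g, hg, rfl⟩, hd⟩⟩, Subtype.ext (hf g hg _)⟩
  let e := Equiv.ofBijective f hbij
  refine ⟨e, dSmooth_of_orbit (x₁ := MulAction.orbit (K₀ q) C) (x₂ := Vs q ε) f
    (fun Z hZ => ⟨γ ⟨Z, hZ⟩, hγ _, hγZ ⟨Z, hZ⟩⟩) hf, ?_⟩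
  refine dSmooth_of_orbit (x₁ := Vs q ε) (x₂ := MulAction.orbit (K₀ q) C) e.symm
    (fun W hW => hW.1) fun g hg h => ?_
  have h1 : e.symm ⟨g • Vs q ε, h⟩ = ⟨_, hlift g hg h⟩ := by
    rw [Equiv.symm_apply_eq]
    exact Subtype.ext (hf g hg _).symm
  rw [h1]

/-- Now `g • Y` determines both translates and is determined by them. A pair of translates is
realized by a single `g`, smoothly in parameters, by `exists_prod_chart`; this gives surjectivity
and the smooth inverse. -/
theorem diffeomorphic_of_rigid_both (hC : IsChain (· ≤ ·) C) (hco : ∀ F ∈ C, Coord F)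
    (hr : Rigid 1 C) (hr' : Rigid (-1) C) {s : Set (Set (Chain q))} (hsC : s = admTranslates C) :
    Diffeomorphic (subDiffeology (orbitDiffeology q (Set (Chain q))) s)
      (prodDiffeology (bsDiffeology q 1) (bsDiffeology q (-1))) := by
  classical
  have hex : ∀ Z : s, ∃ g ∈ G q, Adm g ∧ (Z : Set (Chain q)) = g • MulAction.orbit (K₀ q) C :=
    fun Z => hsC.subset Z.2
  choose γ hγ hadm hγZ using hex
  have hrig : ∀ ε, IsSign ε → Rigid ε C := by rintro ε (rfl | rfl); exacts [hr, hr']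
  let f : ∀ ε, IsSign ε → s → Bs q ε := fun ε hε Z =>
    ⟨γ Z • Vs q ε, ⟨γ Z, hγ Z, rfl⟩, hadm Z ε hε⟩
  have hf : ∀ ε hε, ∀ g ∈ G q, ∀ h : g • MulAction.orbit (K₀ q) C ∈ s,
      (f ε hε ⟨g • MulAction.orbit (K₀ q) C, h⟩ : Sub q) = g • Vs q ε := fun ε hε g hg h =>
    ((hrig ε hε).smul_Vs hC hco hε hg (hγ _) (hγZ ⟨_, h⟩)).symm
  have hfs : ∀ ε hε, @Diffeology.DSmooth _ _ (subDiffeology (orbitDiffeology q (Set (Chain q))) s)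
      (bsDiffeology q ε) (f ε hε) := fun ε hε =>
    dSmooth_of_orbit (x₁ := MulAction.orbit (K₀ q) C) (x₂ := Vs q ε) _
      (fun Z hZ => ⟨γ ⟨Z, hZ⟩, hγ _, hγZ ⟨Z, hZ⟩⟩) (hf ε hε)
  let F : s → Bs q 1 × Bs q (-1) := fun Z => (f 1 isSign_one Z, f (-1) isSign_neg_one Z)
  have hmem : ∀ g ∈ G q, Adm g → g • MulAction.orbit (K₀ q) C ∈ s := fun g hg h => by
    rw [hsC]; exact ⟨g, hg, h, rfl⟩
  have hbij : Function.Bijective F := by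
    constructor
    · intro Z Z' h
      have h1 : γ Z • Vs q 1 = γ Z' • Vs q 1 := congrArg (fun a => (a.1 : Sub q)) h
      have h2 : γ Z • Vs q (-1) = γ Z' • Vs q (-1) := congrArg (fun a => (a.2 : Sub q)) h
      have h3 := smul_cycle_congr hC hco (hγ Z) (hγ Z')
        (by rintro ε (rfl | rfl); exacts [h1, h2])
      exact Subtype.ext ((hγZ Z).trans (h3.trans (hγZ Z').symm))
    · rintro ⟨⟨_, ⟨g, ⟨S, hS⟩, rfl⟩, hd⟩, ⟨_, ⟨g', ⟨S', hS'⟩, rfl⟩, hd'⟩⟩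
      obtain ⟨δ, hδ, -, hδV⟩ := exists_prod_chart isSign_one (X := ℝ) (w := Set.univ)
        (g := fun _ => g) (g' := fun _ => g') (S := S ∪ S')
        (fun _ _ => levelSL_mono Finset.subset_union_left hS) (SmoothLin.const _)
        (fun _ _ => levelSL_mono Finset.subset_union_right hS') (SmoothLin.const _)
        (fun _ _ => hd) (fun _ _ => hd')
      have hG : δ 0 ∈ G q := ⟨_, hδ 0 trivial⟩
      obtain ⟨h1, h2⟩ := hδV 0 trivial
      have hadm : Adm (δ 0) := by
        rintro ε (rfl | rfl)
        · rw [h1]; exact hd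
        · rw [h2]; exact hd'
      exact ⟨⟨_, hmem _ hG hadm⟩, Prod.ext (Subtype.ext ((hf 1 isSign_one _ hG _).trans h1))
        (Subtype.ext ((hf (-1) isSign_neg_one _ hG _).trans h2))⟩
  let e := Equiv.ofBijective F hbij
  refine ⟨e, fun n p hp => ⟨hfs 1 isSign_one n p hp, hfs (-1) isSign_neg_one n p hp⟩, ?_⟩
  intro n p hp
  refine mem_plots_iff.2 fun y => ?_
  obtain ⟨g, hg, hgx⟩ := (p y).1.2.1
  obtain ⟨g', hg', hgx'⟩ := (p y).2.2.1
  obtain ⟨w, hw, hy, α, hα, -, hz⟩ := exists_family_of_plot hp.1 hg hgx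
  obtain ⟨w', hw', hy', α', hα', -, hz'⟩ := exists_family_of_plot hp.2 hg' hgx'
  replace hα := hα.mono (Set.inter_subset_left (t := w'))
  replace hα' := hα'.mono (Set.inter_subset_right (s := w))
  have hαs := hα.smoothLin
  have hαs' := hα'.smoothLin
  obtain ⟨S, hS, -⟩ := hα
  obtain ⟨S', hS', -⟩ := hα'
  have hpz : ∀ z ∈ w ∩ w', ((p z).1 : Sub q) = α z • Vs q 1 ∧ ((p z).2 : Sub q) = α' z • Vs q (-1) :=
    fun z h => ⟨hz z h.1, hz' z h.2⟩
  obtain ⟨δ, hδ, hδs, hδV⟩ := exists_prod_chart isSign_one (w := w ∩ w') (g := α) (g' := α')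
    (S := S ∪ S')
    (fun z hz => levelSL_mono Finset.subset_union_left (hS z hz)) hαs
    (fun z hz => levelSL_mono Finset.subset_union_right (hS' z hz)) hαs'
    (fun z hz => by rw [← (hpz z hz).1]; exact (p z).1.2.2)
    (fun z hz => by rw [← (hpz z hz).2]; exact (p z).2.2.2)
  refine ⟨w ∩ w', hw.inter hw', ⟨hy, hy'⟩, δ, MulAction.orbit (K₀ q) C,
    ⟨S ∪ S', hδ, fun i => (hδs i).2⟩, fun z hzw => ?_⟩
  have hG : δ z ∈ G q := ⟨_, hδ z hzw⟩
  obtain ⟨h1, h2⟩ := hδV z hzw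
  rw [← (hpz z hzw).1] at h1
  rw [← (hpz z hzw).2] at h2
  have hadm : Adm (δ z) := by
    rintro ε (rfl | rfl)
    · rw [h1]; exact (p z).1.2.2
    · rw [h2]; exact (p z).2.2.2
  have h3 : e.symm (p z) = ⟨_, hmem _ hG hadm⟩ := by
    rw [Equiv.symm_apply_eq]
    exact Prod.ext (Subtype.ext (h1.symm.trans (hf 1 isSign_one _ hG _).symm))
      (Subtype.ext (h2.symm.trans (hf (-1) isSign_neg_one _ hG _).symm))
  exact congrArg Subtype.val h3

end Cycle

/-! ### Flag domains -/

/-- A vector inside `F` and one outside have immediate neighbours in the chain, which provide a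
member strictly below `F` and one strictly above. Counting members transfers along a bijection,
unlike the inequality `F ≠ ⊥ ∧ F ≠ ⊤`. -/
theorem exists_three {C : Chain q} (hC : IsGenFlag C) {F : Sub q} (hF : F ∈ C) (hb : F ≠ ⊥)
    (ht : F ≠ ⊤) : ∃ a b c : C, a ≠ b ∧ b ≠ c ∧ a ≠ c := by
  obtain ⟨v, hv, hv0⟩ := Submodule.exists_mem_ne_zero_of_ne_bot hb
  obtain ⟨A, A', ⟨hA, hA', -, -⟩, -, hvA⟩ := hC.cover v hv0
  obtain ⟨u, hu⟩ : ∃ u, u ∉ F := by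
    by_contra h
    push Not at h
    exact ht (eq_top_iff.2 fun x _ => h x)
  obtain ⟨B, B', ⟨hB, hB', -, -⟩, huB', -⟩ := hC.cover u fun h => hu (h ▸ zero_mem F)
  have h1 : A ≤ F := (hC.chain.total hA hF).resolve_right fun h => hvA (h hv)
  have h2 : F ≤ B' := (hC.chain.total hF hB').resolve_right fun h => hu (h huB')
  refine ⟨⟨A, hA⟩, ⟨F, hF⟩, ⟨B', hB'⟩, fun h => ?_, fun h => ?_, fun h => ?_⟩
  · have h3 : A = F := congrArg Subtype.val h
    exact hvA (h3 ▸ hv)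
  · have h3 : F = B' := congrArg Subtype.val h
    exact hu (h3 ▸ huB')
  · have h3 : A = B' := congrArg Subtype.val h
    exact hu (h1 (h3 ▸ huB'))

theorem exists_nontrivial_mem {C C' : Chain q} (hC : IsGenFlag C) (φ : C ≃ C')
    (h : ∃ F ∈ C, F ≠ ⊥ ∧ F ≠ ⊤) : ∃ F ∈ C', F ≠ ⊥ ∧ F ≠ ⊤ := by
  obtain ⟨F, hF, hb, ht⟩ := h
  obtain ⟨a, b, c, hab, hbc, hac⟩ := exists_three hC hF hb ht
  by_contra h
  push Not at h
  have key : ∀ x : C, (φ x : Sub q) = ⊥ ∨ (φ x : Sub q) = ⊤ := fun x => by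
    by_cases h1 : (φ x : Sub q) = ⊥
    · exact Or.inl h1
    · exact Or.inr (h _ (φ x).2 h1)
  have heq : ∀ x y : C, (φ x : Sub q) = φ y → x = y := fun x y h => φ.injective (Subtype.ext h)
  rcases key a with ha | ha <;> rcases key b with hb | hb <;> rcases key c with hc | hc
  · exact hab (heq _ _ (ha.trans hb.symm))
  · exact hab (heq _ _ (ha.trans hb.symm))
  · exact hac (heq _ _ (ha.trans hc.symm))
  · exact hbc (heq _ _ (hb.trans hc.symm))
  · exact hbc (heq _ _ (hb.trans hc.symm))
  · exact hac (heq _ _ (ha.trans hc.symm))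
  · exact hab (heq _ _ (ha.trans hb.symm))
  · exact hab (heq _ _ (ha.trans hb.symm))

/-- Openness gives nondegenerate members, so the flag is `G₀`-conjugate to a coordinate flag, and
coordinate flags split. -/
theorem exists_isBaseCycle {C : Chain q} {D : Set (Chain q)} (hD : IsFlagDomain C D) :
    ∃ Y, IsBaseCycle D Y := by
  obtain ⟨⟨C₁, ⟨hC₁, -, hw, -⟩, rfl⟩, ho⟩ := hD
  obtain ⟨T, hT⟩ := hw.exists_lev
  obtain ⟨g, hg, hgC⟩ := exists_G₀_coord hC₁.chain hT fun F hF => nondeg_of_isOpen hC₁.chain ho hF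
  refine ⟨_, g • C₁, mem_orbit_subgroup.2 ⟨g, hg, rfl⟩, splits_iff.2 ?_, rfl⟩
  rintro _ ⟨F, hF, rfl⟩
  exact (hgC F hF).split

/-- Every base cycle passes through a flag spanned by basis vectors. -/
theorem IsBaseCycle.exists_coord {C : Chain q} (hC : IsGenFlag C) (hn : ∃ F ∈ C, F ≠ ⊥ ∧ F ≠ ⊤)
    {D Y : Set (Chain q)} (hD : IsFlagDomain C D) (hY : IsBaseCycle D Y) :
    ∃ C₀ : Chain q, IsChain (· ≤ ·) C₀ ∧ (∀ F ∈ C₀, Coord F) ∧ (∃ F ∈ C₀, F ≠ ⊥ ∧ F ≠ ⊤) ∧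
      D = MulAction.orbit (G₀ q) C₀ ∧ Y = MulAction.orbit (K₀ q) C₀ := by
  obtain ⟨⟨C₁, ⟨hC₁, -, hw, φ, -⟩, rfl⟩, -⟩ := hD
  obtain ⟨C₂, hC₂, hsp, rfl⟩ := hY
  obtain ⟨g, hg, rfl⟩ := mem_orbit_subgroup.1 hC₂
  obtain ⟨T, hT⟩ := hw.exists_lev
  obtain ⟨T', hT'⟩ := exists_lev_smul hT (G₀_le hg)
  obtain ⟨k, hk, hkC⟩ := exists_K₀_coord (smul_isChain hC₁.chain g) hT' (splits_iff.1 hsp)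
  refine ⟨k • g • C₁, smul_isChain (smul_isChain hC₁.chain g) k, ?_, ?_, ?_,
    (orbit_subgroup_eq hk).symm⟩
  · rintro _ ⟨F, hF, rfl⟩
    exact hkC F hF
  · obtain ⟨F, hF, hb, ht⟩ := exists_nontrivial_mem hC φ hn
    refine ⟨k • g • F, ⟨_, ⟨F, hF, rfl⟩, rfl⟩, fun h => hb ?_, fun h => ht ?_⟩
    · rwa [smul_eq_iff_eq_inv_smul, smul_bot', smul_eq_iff_eq_inv_smul, smul_bot'] at h
    · rwa [smul_eq_iff_eq_inv_smul, smul_top', smul_eq_iff_eq_inv_smul, smul_top'] at h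
  · rw [orbit_subgroup_eq (K₀_le hk), orbit_subgroup_eq hg]

/-- The cycle space is one of the bounded symmetric domains or their product. -/
theorem cycleSpace_diffeomorphic {C : Chain q} (hC : IsGenFlag C) (hn : ∃ F ∈ C, F ≠ ⊥ ∧ F ≠ ⊤)
    {D Y : Set (Chain q)} (hD : IsFlagDomain C D) (hY : IsBaseCycle D Y) :
    Diffeomorphic (cycleSpaceDiffeology D Y) (bsDiffeology q 1) ∨
      Diffeomorphic (cycleSpaceDiffeology D Y) (bsDiffeology q (-1)) ∨
      Diffeomorphic (cycleSpaceDiffeology D Y)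
        (prodDiffeology (bsDiffeology q 1) (bsDiffeology q (-1))) := by
  obtain ⟨C₀, hC₀, hco, ⟨F, hF, hb, ht⟩, rfl, rfl⟩ := hY.exists_coord hC hn hD
  have hr := rigid_cases hco hF hb ht
  have hT := cycleSpace_eq hC₀ hco hr
  rcases hr with ⟨h1, h2⟩ | ⟨h1, h2⟩ | ⟨h1, h2⟩
  · exact Or.inr (Or.inr (diffeomorphic_of_rigid_both hC₀ hco h1 h2 hT))
  · exact Or.inl (diffeomorphic_of_rigid hC₀ hco isSign_one h1 h2 hT)
  · exact Or.inr (Or.inl (diffeomorphic_of_rigid hC₀ hco isSign_neg_one h2 (by rwa [neg_neg]) hT))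

/-! ### Radial rescaling of star-shaped domains -/

section Radial

/-- A function on a star-shaped domain for which `x ↦ f x • x` is a bijection to the whole space. -/
structure RadialData {M : Type*} [AddCommGroup M] [Module ℝ M] (U : Set M) (f : M → ℝ) : Prop where
  star : ∀ x ∈ U, ∀ t : ℝ, 0 ≤ t → t ≤ 1 → t • x ∈ U
  one_le : ∀ x ∈ U, 1 ≤ f x
  mono : ∀ x ∈ U, ∀ t : ℝ, 0 ≤ t → t ≤ 1 → f (t • x) ≤ f x
  blow : ∀ x, ∃ t : ℝ, 0 ≤ t ∧ t • x ∈ U ∧ 1 ≤ t * f (t • x)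

/-- Both points are on one ray; if `f a ≤ f b`, then `b` is a multiple of `a` by a factor in `[0,
1]`, and monotonicity gives `f b ≤ f a`. -/
theorem RadialData.injOn {M : Type*} [AddCommGroup M] [Module ℝ M] {U : Set M} {f : M → ℝ}
    (h : RadialData U f) {a b : M} (ha : a ∈ U) (hb : b ∈ U) (hab : f a • a = f b • b) : a = b := by
  wlog hle : f a ≤ f b generalizing a b
  · exact (this hb ha hab.symm (not_le.1 hle).le).symm
  have ha1 := h.one_le a ha
  have hb1 := h.one_le b hb
  have hb0 : f b ≠ 0 := by linarith
  have h1 : b = (f a / f b) • a := by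
    rw [div_eq_inv_mul, mul_smul, hab, smul_smul, inv_mul_cancel₀ hb0, one_smul]
  have h2 := h.mono a ha (f a / f b) (div_nonneg (by linarith) (by linarith))
    ((div_le_one (by linarith)).2 hle)
  rw [← h1] at h2
  have h3 : f a = f b := le_antisymm hle h2
  rw [h3, div_self hb0, one_smul] at h1
  exact h1.symm

variable {E : Type*} [NormedAddCommGroup E] [NormedSpace ℝ E] {U : Set E}
  {f : E → ℝ}

/-- Intermediate value theorem for `t * f (t • x)` along the ray through `x`. -/
theorem RadialData.exists_preimage (h : RadialData U f) (hf : ContinuousOn f U) (x : E) :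
    ∃ a ∈ U, f a • a = x := by
  obtain ⟨t₀, ht₀, htU, h1⟩ := h.blow x
  have ht0 : 0 < t₀ := lt_of_le_of_ne ht₀ fun h0 => by
    rw [← h0, zero_mul] at h1
    exact absurd h1 (by norm_num)
  have hmem : ∀ t ∈ Set.Icc 0 t₀, t • x ∈ U := fun t ht => by
    have := h.star _ htU (t / t₀) (div_nonneg ht.1 ht₀) ((div_le_one ht0).2 ht.2)
    rwa [smul_smul, div_mul_cancel₀ _ ht0.ne'] at this
  have hc : ContinuousOn (fun t : ℝ => t * f (t • x)) (Set.Icc 0 t₀) :=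
    continuousOn_id.mul (hf.comp (continuous_id.smul continuous_const).continuousOn hmem)
  obtain ⟨t, ht, h2⟩ := intermediate_value_Icc ht₀ hc ⟨by simp, h1⟩
  refine ⟨t • x, hmem t ht, ?_⟩
  rw [smul_smul, mul_comm]
  have h3 : t * f (t • x) = 1 := h2
  rw [h3, one_smul]

/-- The derivative at `a` is `f a` times the identity plus the rank-one map with image spanned by
`a`. It is injective because `f a > 0` and the radial derivative of `f` is nonnegative. The inverse
function theorem then gives smooth local inverses. -/
theorem RadialData.exists_smooth_inverse [FiniteDimensional ℝ E] (h : RadialData U f) (hU : IsOpen U)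
    (hf : ContDiffOn ℝ ∞ f U) :
    ∃ ψ : E → E, ContDiff ℝ ∞ ψ ∧ ∀ x, ψ x ∈ U ∧ f (ψ x) • ψ x = x := by
  have := FiniteDimensional.complete ℝ E
  choose ψ hψU hψ using h.exists_preimage hf.continuousOn
  refine ⟨ψ, contDiff_iff_contDiffAt.2 fun x => ?_, fun x => ⟨hψU x, hψ x⟩⟩
  obtain ⟨a, ha⟩ : ∃ a, a = ψ x := ⟨_, rfl⟩
  have haU : a ∈ U := by rw [ha]; exact hψU x
  have hax : f a • a = x := by rw [ha]; exact hψ x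
  have hfa : ContDiffAt ℝ ∞ f a := hf.contDiffAt (hU.mem_nhds haU)
  have hΦ : ContDiffAt ℝ ∞ (fun y => f y • y) a := hfa.smul contDiffAt_id
  have hfd : HasFDerivAt f (fderiv ℝ f a) a := (hfa.differentiableAt (by simp)).hasFDerivAt
  have hΦd : HasFDerivAt (fun y => f y • y)
      (f a • ContinuousLinearMap.id ℝ E + (fderiv ℝ f a).smulRight a) a := hfd.smul (hasFDerivAt_id a)
  have hnonneg : 0 ≤ fderiv ℝ f a a := by
    have hline : HasDerivAt (fun t : ℝ => t • a) a 1 := by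
      simpa using (hasDerivAt_id (1 : ℝ)).smul_const a
    have h1 : HasDerivAt (fun t : ℝ => f (t • a)) (fderiv ℝ f a a) 1 := by
      have h2 : HasFDerivAt f (fderiv ℝ f a) ((1 : ℝ) • a) := by rwa [one_smul]
      exact h2.comp_hasDerivAt 1 hline
    have h3 := (hasDerivWithinAt_iff_tendsto_slope' (by simp)).1 (h1.hasDerivWithinAt (s := Set.Iio 1))
    refine ge_of_tendsto h3 ?_
    filter_upwards [self_mem_nhdsWithin,
      mem_nhdsWithin_of_mem_nhds (lt_mem_nhds (zero_lt_one (α := ℝ)))] with t ht ht0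
    have ht1 : t < 1 := ht
    rw [slope_def_field, one_smul]
    refine div_nonneg_of_nonpos ?_ (by linarith)
    have := h.mono a haU t (le_of_lt ht0) ht1.le
    linarith
  have hinj : Function.Injective
      (f a • ContinuousLinearMap.id ℝ E + (fderiv ℝ f a).smulRight a : E →L[ℝ] E).toLinearMap := by
    rw [injective_iff_map_eq_zero]
    intro v hv
    have hv' : f a • v + (fderiv ℝ f a v) • a = 0 := hv
    have hfa0 : 0 < f a := by linarith [h.one_le a haU]
    -- A kernel vector is radial, and on radial vectors the derivative is multiplication by `f a +
    -- fderiv ℝ f a a > 0`.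
    obtain ⟨c, hc⟩ : ∃ c : ℝ, v = c • a := by
      generalize fderiv ℝ f a v = d at hv'
      have h1 : f a • v = -(d • a) := eq_neg_of_add_eq_zero_left hv'
      have h2 : v = (f a)⁻¹ • f a • v := by rw [smul_smul, inv_mul_cancel₀ hfa0.ne', one_smul]
      rw [h1] at h2
      exact ⟨-(f a)⁻¹ * d, h2.trans (by rw [smul_neg, smul_smul, ← neg_smul, neg_mul])⟩
    rw [hc, map_smul, smul_smul, smul_eq_mul, ← add_smul] at hv'
    have h1 : (f a * c + c * fderiv ℝ f a a) = c * (f a + fderiv ℝ f a a) := by ring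
    rw [h1, mul_smul] at hv'
    rw [hc]
    have h2 : f a + fderiv ℝ f a a ≠ 0 := by linarith [hnonneg, hfa0] |> ne_of_gt
    rw [smul_comm] at hv'
    exact (smul_eq_zero.1 hv').resolve_left h2
  let e : E ≃L[ℝ] E := (LinearEquiv.ofInjectiveEndo _ hinj).toContinuousLinearEquiv
  have he : HasFDerivAt (fun y => f y • y) (e : E →L[ℝ] E) a := by
    have : (e : E →L[ℝ] E) = f a • ContinuousLinearMap.id ℝ E + (fderiv ℝ f a).smulRight a := by
      ext v; rfl
    rwa [this]
  have hn : (∞ : WithTop ℕ∞) ≠ 0 := by simp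
  have hloc := hΦ.to_localInverse he hn
  have hst := hΦ.hasStrictFDerivAt' he hn
  rw [hax] at hloc
  -- By injectivity on `U`, the chosen preimages coincide with the local inverse near `x`.
  refine hloc.congr_of_eventuallyEq ?_
  have h1 := hst.eventually_right_inverse
  have h2 := hst.localInverse_tendsto.eventually (hU.mem_nhds haU)
  rw [hax] at h1 h2
  filter_upwards [h1, h2] with y hy1 hy2
  exact h.injOn (hψU y) hy2 ((hψ y).trans hy1.symm)

end Radial

/-! ### The space of finitely supported matrices -/

section Mat

/-- A family of finitely supported functions is smooth if the supports are contained in a common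
finite set and the coordinates are smooth. -/
def SmoothMat {X A : Type*} [NormedAddCommGroup X] [NormedSpace ℝ X] (p : X → A →₀ ℍ[ℝ])
    (w : Set X) : Prop :=
  (∃ B : Finset A, ∀ z ∈ w, ∀ a ∉ B, p z a = 0) ∧ ∀ a, ContDiffOn ℝ ∞ (fun z => p z a) w

/-- The direct limit of the spaces of functions supported in finite subsets of `A`. -/
@[reducible]
def matDiffeology (A : Type*) : DiffeologicalSpace (A →₀ ℍ[ℝ]) :=
  .ofCorePlotsOn
    { isPlotOn := fun {n u} _ p => ∀ y ∈ u, ∃ w, IsOpen w ∧ y ∈ w ∧ w ⊆ u ∧ SmoothMat p w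
      isPlotOn_congr := by
        have key : ∀ {n : ℕ} {u : Set (EuclideanSpace ℝ (Fin n))}
            {p r : EuclideanSpace ℝ (Fin n) → A →₀ ℍ[ℝ]}, Set.EqOn p r u →
            (∀ y ∈ u, ∃ w, IsOpen w ∧ y ∈ w ∧ w ⊆ u ∧ SmoothMat p w) →
            ∀ y ∈ u, ∃ w, IsOpen w ∧ y ∈ w ∧ w ⊆ u ∧ SmoothMat r w := by
          intro n u p r h hp y hy
          obtain ⟨w, hw, hyw, hwu, ⟨B, hB⟩, hs⟩ := hp y hy
          exact ⟨w, hw, hyw, hwu, ⟨B, fun z hz a ha => by rw [← h (hwu hz)]; exact hB z hz a ha⟩,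
            fun a => (hs a).congr fun z hz => by rw [h (hwu hz)]⟩
        intro n u _ p r h
        exact ⟨key h, key h.symm⟩
      isPlot_const := fun x y _ => ⟨Set.univ, isOpen_univ, trivial, le_rfl,
        ⟨x.support, fun _ _ a ha => Finsupp.notMem_support_iff.1 ha⟩, fun _ => contDiffOn_const⟩
      isPlotOn_reparam := by
        intro n m u v hu hv p f h hp hf y hy
        obtain ⟨w, hw, hyw, hwu, ⟨B, hB⟩, hs⟩ := hp (f y) (h hy)
        exact ⟨v ∩ f ⁻¹' w, hf.continuousOn.isOpen_inter_preimage hv hw, ⟨hy, hyw⟩,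
          Set.inter_subset_left, ⟨B, fun z hz => hB _ hz.2⟩,
          fun a => (hs a).comp (hf.mono Set.inter_subset_left) fun z hz => hz.2⟩
      locality := by
        intro n u hu p hp y hy
        obtain ⟨v, hv, hyv, hpv⟩ := hp y hy
        obtain ⟨w, hw, hyw, hwv, ⟨B, hB⟩, hs⟩ := hpv y hyv
        exact ⟨w ∩ u, hw.inter hu, ⟨hyw, hy⟩, Set.inter_subset_right,
          ⟨B, fun z hz => hB z hz.1⟩, fun a => (hs a).mono Set.inter_subset_left⟩ }

theorem mem_mat_plots_iff {A : Type*} {n : ℕ} {p : EuclideanSpace ℝ (Fin n) → A →₀ ℍ[ℝ]} :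
    p ∈ (matDiffeology A).plots n ↔ ∀ y, ∃ w, IsOpen w ∧ y ∈ w ∧ SmoothMat p w :=
  ⟨fun h y => (h y trivial).imp fun _ hw => ⟨hw.1, hw.2.1, hw.2.2.2⟩,
    fun h y _ => (h y).imp fun _ hw => ⟨hw.1, hw.2.1, Set.subset_univ _, hw.2.2⟩⟩

theorem dSmooth_equivMapDomain {A A' : Type*} (σ : A ≃ A') : @Diffeology.DSmooth _ _
    (matDiffeology A) (matDiffeology A') (Finsupp.equivMapDomain σ) := by
  intro n p hp
  refine mem_mat_plots_iff.2 fun y => ?_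
  obtain ⟨w, hw, hy, ⟨B, hB⟩, hs⟩ := mem_mat_plots_iff.1 hp y
  exact ⟨w, hw, hy, ⟨B.map σ.toEmbedding, fun z hz a ha => hB z hz _ fun h => ha
    (Finset.mem_map.2 ⟨_, h, σ.apply_symm_apply a⟩)⟩, fun a => hs (σ.symm a)⟩

theorem mat_equiv {A A' : Type*} (σ : A ≃ A') : Diffeomorphic (matDiffeology A) (matDiffeology A') :=
  ⟨Finsupp.equivCongrLeft σ, dSmooth_equivMapDomain σ, dSmooth_equivMapDomain σ.symm⟩

theorem mat_prod (A B : Type*) : Diffeomorphic (prodDiffeology (matDiffeology A) (matDiffeology B))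
    (matDiffeology (A ⊕ B)) := by
  classical
  refine ⟨Finsupp.sumFinsuppEquivProdFinsupp.symm, fun n p hp => ?_, fun n p hp => ⟨?_, ?_⟩⟩
  · refine mem_mat_plots_iff.2 fun y => ?_
    obtain ⟨w, hw, hy, ⟨S, hS⟩, hs⟩ := mem_mat_plots_iff.1 hp.1 y
    obtain ⟨w', hw', hy', ⟨S', hS'⟩, hs'⟩ := mem_mat_plots_iff.1 hp.2 y
    refine ⟨w ∩ w', hw.inter hw', ⟨hy, hy'⟩, ⟨S.disjSum S', fun z hz a ha => ?_⟩, fun a => ?_⟩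
    · rcases a with a | a
      · exact hS z hz.1 a fun h => ha (Finset.inl_mem_disjSum.2 h)
      · exact hS' z hz.2 a fun h => ha (Finset.inr_mem_disjSum.2 h)
    · rcases a with a | a
      · exact (hs a).mono Set.inter_subset_left
      · exact (hs' a).mono Set.inter_subset_right
  · refine mem_mat_plots_iff.2 fun y => ?_
    obtain ⟨w, hw, hy, ⟨S, hS⟩, hs⟩ := mem_mat_plots_iff.1 hp y
    exact ⟨w, hw, hy, ⟨S.preimage Sum.inl Sum.inl_injective.injOn, fun z hz a ha =>
      hS z hz (Sum.inl a) fun h => ha (Finset.mem_preimage.2 h)⟩, fun a => hs (Sum.inl a)⟩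
  · refine mem_mat_plots_iff.2 fun y => ?_
    obtain ⟨w, hw, hy, ⟨S, hS⟩, hs⟩ := mem_mat_plots_iff.1 hp y
    exact ⟨w, hw, hy, ⟨S.preimage Sum.inr Sum.inr_injective.injOn, fun z hz a ha =>
      hS z hz (Sum.inr a) fun h => ha (Finset.mem_preimage.2 h)⟩, fun a => hs (Sum.inr a)⟩

/-- Extension by zero. -/
def emb {A : Type*} (B : Finset A) (a : B → ℍ[ℝ]) : A →₀ ℍ[ℝ] :=
  open Classical in
  Finsupp.onFinset B (fun i => if h : i ∈ B then a ⟨i, h⟩ else 0) fun i hi => by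
    by_contra h
    exact hi (dif_neg h)

theorem emb_apply {A : Type*} (B : Finset A) (a : B → ℍ[ℝ]) (i : B) : emb B a i = a i :=
  dif_pos i.2

theorem emb_apply_of_notMem {A : Type*} (B : Finset A) (a : B → ℍ[ℝ]) {i : A} (hi : i ∉ B) :
    emb B a i = 0 :=
  dif_neg hi

theorem emb_coords {A : Type*} {B : Finset A} {x : A →₀ ℍ[ℝ]} (hx : ∀ i ∉ B, x i = 0) :
    emb B (fun i => x i) = x := by
  ext1 i
  by_cases hi : i ∈ B
  · exact emb_apply B _ ⟨i, hi⟩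
  · rw [emb_apply_of_notMem B _ hi, hx i hi]

theorem emb_smul {A : Type*} (B : Finset A) (t : ℝ) (a : B → ℍ[ℝ]) :
    emb B (t • a) = t • emb B a := by
  ext1 i
  by_cases hi : i ∈ B
  · exact (emb_apply B _ ⟨i, hi⟩).trans (congrArg (t • ·) (emb_apply B a ⟨i, hi⟩).symm)
  · rw [emb_apply_of_notMem B _ hi, Finsupp.smul_apply, emb_apply_of_notMem B _ hi, smul_zero]

theorem smoothMat_emb {A : Type*} (B : Finset A) : SmoothMat (emb B) Set.univ := by
  refine ⟨⟨B, fun z _ a ha => emb_apply_of_notMem B z ha⟩, fun i => ?_⟩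
  by_cases hi : i ∈ B
  · refine (contDiff_apply ℝ ℍ[ℝ] (⟨i, hi⟩ : B)).contDiffOn.congr fun a _ => ?_
    exact emb_apply B a ⟨i, hi⟩
  · exact contDiffOn_const.congr fun a _ => emb_apply_of_notMem B a hi

/-- The map `Z ↦ f Z • Z` and its inverse do not enlarge supports, so the finite dimensional inverse
on each finite set of positions is the restriction of the global one. -/
theorem diffeomorphic_of_radialData {A : Type*} {U : Set (A →₀ ℍ[ℝ])} {f : (A →₀ ℍ[ℝ]) → ℝ}
    (h : RadialData U f) (hU : ∀ B : Finset A, IsOpen {a : B → ℍ[ℝ] | emb B a ∈ U})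
    (hf : ∀ B : Finset A, ContDiffOn ℝ ∞ (fun a => f (emb B a)) {a : B → ℍ[ℝ] | emb B a ∈ U}) :
    Diffeomorphic (subDiffeology (matDiffeology A) U) (matDiffeology A) := by
  classical
  have hB : ∀ B : Finset A, RadialData {a : B → ℍ[ℝ] | emb B a ∈ U} fun a => f (emb B a) :=
    fun B => ⟨fun a ha t h0 h1 => by
        change emb B (t • a) ∈ U
        rw [emb_smul]; exact h.star _ ha t h0 h1,
      fun a ha => h.one_le _ ha,
      fun a ha t h0 h1 => by
        rw [emb_smul]; exact h.mono _ ha t h0 h1,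
      fun a => by
        obtain ⟨t, h0, h1, h2⟩ := h.blow (emb B a)
        refine ⟨t, h0, ?_, ?_⟩
        · change emb B (t • a) ∈ U
          rwa [emb_smul]
        · rwa [emb_smul]⟩
  choose ψ hψs hψ using fun B : Finset A => (hB B).exists_smooth_inverse (hU B) (hf B)
  have hψe : ∀ (B : Finset A) (c : B → ℍ[ℝ]), emb B (ψ B c) ∈ U ∧
      f (emb B (ψ B c)) • emb B (ψ B c) = emb B c := fun B c =>
    ⟨(hψ B c).1, by rw [← emb_smul, (hψ B c).2]⟩
  let F : U → A →₀ ℍ[ℝ] := fun Z => f Z • (Z : A →₀ ℍ[ℝ])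
  have hbij : Function.Bijective F := by
    refine ⟨fun Z Z' hZ => Subtype.ext (h.injOn Z.2 Z'.2 hZ), fun x => ?_⟩
    have hx : emb x.support (fun i => x i) = x := emb_coords fun i hi => Finsupp.notMem_support_iff.1 hi
    exact ⟨⟨_, (hψe x.support fun i => x i).1⟩, (hψe x.support fun i => x i).2.trans hx⟩
  let e := Equiv.ofBijective F hbij
  have he : ∀ (B : Finset A) (c : B → ℍ[ℝ]), e.symm (emb B c) = ⟨_, (hψe B c).1⟩ := fun B c => by
    rw [Equiv.symm_apply_eq]
    exact (hψe B c).2.symm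
  refine ⟨e, fun n p hp => mem_mat_plots_iff.2 fun y => ?_,
    fun n p hp => mem_mat_plots_iff.2 fun y => ?_⟩
  · obtain ⟨w, hw, hy, ⟨B, hBz⟩, hs⟩ := mem_mat_plots_iff.1 hp y
    replace hBz : ∀ z ∈ w, ∀ a ∉ B, (p z : A →₀ ℍ[ℝ]) a = 0 := hBz
    replace hs : ∀ a, ContDiffOn ℝ ∞ (fun z => (p z : A →₀ ℍ[ℝ]) a) w := hs
    refine ⟨w, hw, hy, ⟨B, fun z hz a ha => ?_⟩, fun a => ?_⟩
    · change f (p z) • (p z : A →₀ ℍ[ℝ]) a = 0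
      rw [hBz z hz a ha, smul_zero]
    · have hc : ContDiffOn ℝ ∞ (fun z => fun i : B => (p z : A →₀ ℍ[ℝ]) i) w :=
        contDiffOn_pi.2 fun i => hs i
      have h1 : ContDiffOn ℝ ∞ (fun z => f (p z)) w := by
        refine ((hf B).comp hc fun z hz => ?_).congr fun z hz => ?_
        · change emb B _ ∈ U
          rw [emb_coords (hBz z hz)]; exact (p z).2
        · change _ = f (emb B _)
          rw [emb_coords (hBz z hz)]
      exact h1.smul (hs a)
  · obtain ⟨w, hw, hy, ⟨B, hBz⟩, hs⟩ := mem_mat_plots_iff.1 hp y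
    have hc : ContDiffOn ℝ ∞ (fun z => fun i : B => p z i) w := contDiffOn_pi.2 fun i => hs i
    have hpz : ∀ z ∈ w, ((e.symm (p z) : U) : A →₀ ℍ[ℝ]) = emb B (ψ B fun i => p z i) := fun z hz => by
      conv_lhs => rw [← emb_coords (hBz z hz), he]
    refine ⟨w, hw, hy, ⟨B, fun z hz a ha => ?_⟩, fun a => ?_⟩
    · change ((e.symm (p z) : U) : A →₀ ℍ[ℝ]) a = 0
      rw [hpz z hz, emb_apply_of_notMem B _ ha]
    · change ContDiffOn ℝ ∞ (fun z => ((e.symm (p z) : U) : A →₀ ℍ[ℝ]) a) w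
      have h1 : ContDiffOn ℝ ∞ (fun z => emb B (ψ B fun i => p z i) a) w :=
        ((smoothMat_emb B).2 a).comp ((hψs B).comp_contDiffOn hc) fun _ _ => trivial
      exact h1.congr fun z hz => by rw [hpz z hz]

end Mat

/-! ### Matrix coordinates on the bounded symmetric domains -/

/-- The positions of the entries of a linear map `V_ε → V_{-ε}`. -/
abbrev Entry (q : ℕ∞) (ε : ℝ) : Type := {a : Idx q × Idx q // sgn a.1 = ε ∧ sgn a.2 = -ε}

variable {ε : ℝ}

/-- The basis vectors which are involved in some entry in `B`. -/
def entryIdx (B : Finset (Entry q ε)) : Finset (Idx q) :=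
  open Classical in B.image (fun a => a.1.1) ∪ B.image (fun a => a.1.2)

theorem fst_mem_entryIdx {B : Finset (Entry q ε)} {a : Entry q ε} (h : a ∈ B) :
    a.1.1 ∈ entryIdx B := by
  classical
  exact Finset.mem_union_left _ (Finset.mem_image_of_mem (fun a : Entry q ε => a.1.1) h)

theorem snd_mem_entryIdx {B : Finset (Entry q ε)} {a : Entry q ε} (h : a ∈ B) :
    a.1.2 ∈ entryIdx B := by
  classical
  exact Finset.mem_union_right _ (Finset.mem_image_of_mem (fun a : Entry q ε => a.1.2) h)

/-- The linear map with matrix `Z`. -/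
def opN (Z : Entry q ε →₀ ℍ[ℝ]) : V q →ₗ[ℍ[ℝ]] V q where
  toFun x := Z.sum fun a c => (x a.1.1 * c) • vec a.1.2
  map_add' x y := by
    simp only [Finsupp.sum, Finsupp.add_apply, add_mul, add_smul, Finset.sum_add_distrib]
  map_smul' c x := by
    simp only [Finsupp.sum, Finsupp.smul_apply, smul_eq_mul, mul_assoc, mul_smul, Finset.smul_sum,
      RingHom.id_apply]

/-- The adjoint of `opN Z` with respect to the hermitian form. -/
def opD (Z : Entry q ε →₀ ℍ[ℝ]) : V q →ₗ[ℍ[ℝ]] V q where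
  toFun x := Z.sum fun a c => -((x a.1.2 * star c) • vec a.1.1)
  map_add' x y := by
    simp only [Finsupp.sum, Finsupp.add_apply, add_mul, add_smul, neg_add, Finset.sum_add_distrib]
  map_smul' c x := by
    simp only [Finsupp.sum, Finsupp.smul_apply, smul_eq_mul, mul_assoc, mul_smul, Finset.smul_sum,
      RingHom.id_apply, smul_neg]

section Op
variable {Z : Entry q ε →₀ ℍ[ℝ]} {B : Finset (Entry q ε)}

theorem support_subset_of_forall (hB : ∀ a ∉ B, Z a = 0) : Z.support ⊆ B := fun a ha => by
  by_contra h
  exact Finsupp.mem_support_iff.1 ha (hB a h)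

theorem opN_eq_sum (hB : ∀ a ∉ B, Z a = 0) (x : V q) :
    opN Z x = ∑ a ∈ B, (x a.1.1 * Z a) • vec a.1.2 :=
  Finsupp.sum_of_support_subset Z (support_subset_of_forall hB)
    (fun a c => (x a.1.1 * c) • (vec a.1.2 : V q)) fun a _ => by rw [mul_zero, zero_smul]

theorem opD_eq_sum (hB : ∀ a ∉ B, Z a = 0) (x : V q) :
    opD Z x = ∑ a ∈ B, -((x a.1.2 * star (Z a)) • (vec a.1.1 : V q)) :=
  Finsupp.sum_of_support_subset Z (support_subset_of_forall hB)
    (fun a c => -((x a.1.2 * star c) • (vec a.1.1 : V q))) fun a _ => by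
      rw [star_zero, mul_zero, zero_smul, neg_zero]

theorem opN_smul (t : ℝ) (Z : Entry q ε →₀ ℍ[ℝ]) : opN (t • Z) = t • opN Z := by
  refine LinearMap.ext fun x => ?_
  have hB : ∀ a ∉ Z.support, Z a = 0 := fun a ha => Finsupp.notMem_support_iff.1 ha
  rw [LinearMap.smul_apply, opN_eq_sum hB, opN_eq_sum (B := Z.support) (fun a ha => by
    rw [Finsupp.smul_apply, hB a ha, smul_zero]), Finset.smul_sum]
  refine Finset.sum_congr rfl fun a _ => ?_
  rw [Finsupp.smul_apply, mul_smul_comm, smul_assoc]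

theorem opN_off (hB : ∀ a ∉ B, Z a = 0) : Off ε (entryIdx B) (opN Z) := by
  refine ⟨fun x => ?_, fun x hx => ?_, fun i hi => ?_, fun x => ?_⟩
  · rw [opN_eq_sum hB]
    exact sum_mem fun a _ => Submodule.smul_mem _ _ (vec_mem_Vs a.2.2)
  · rw [opN_eq_sum hB]
    refine Finset.sum_eq_zero fun a _ => ?_
    by_cases h0 : x a.1.1 = 0
    · rw [h0, zero_mul, zero_smul]
    · have h1 : sgn a.1.1 = -ε := by
        by_contra h1
        exact h0 (mem_Vs.1 hx _ h1)
      have h2 := a.2.1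
      have h3 := sgn_ne_zero a.1.1
      rw [h2] at h1 h3
      exact absurd (by linarith) h3
  · rw [opN_eq_sum hB]
    refine Finset.sum_eq_zero fun a ha => ?_
    rw [vec_apply_ne (i := i) (j := a.1.1) fun h => hi (h ▸ fst_mem_entryIdx ha), zero_mul, zero_smul]
  · rw [opN_eq_sum hB]
    exact sum_mem fun a ha => Submodule.smul_mem _ _ (vec_mem_spanOf (snd_mem_entryIdx ha))

theorem opD_mem (x : V q) : opD Z x ∈ Vs q ε :=
  sum_mem fun a _ => neg_mem (Submodule.smul_mem _ _ (vec_mem_Vs a.2.1))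

theorem opD_span (hB : ∀ a ∉ B, Z a = 0) (x : V q) : opD Z x ∈ spanOf (entryIdx B) := by
  rw [opD_eq_sum hB]
  exact sum_mem fun a ha => neg_mem (Submodule.smul_mem _ _ (vec_mem_spanOf (fst_mem_entryIdx ha)))

theorem herm_opN (x y : V q) : herm (opN Z x) y = herm x (opD Z y) := by
  have hB : ∀ a ∉ Z.support, Z a = 0 := fun a ha => Finsupp.notMem_support_iff.1 ha
  rw [opN_eq_sum hB, opD_eq_sum hB, herm_sum_left, herm_sum_right]
  refine Finset.sum_congr rfl fun a _ => ?_
  rw [herm_smul_left, herm_vec_left, herm_neg_right, herm_smul_right, herm_vec_right, a.2.1, a.2.2,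
    star_mul, star_star, neg_smul, mul_neg, mul_smul_comm, smul_mul_assoc, mul_assoc]

theorem opN_vec_apply (a : Entry q ε) : opN Z (vec a.1.1) a.1.2 = Z a := by
  classical
  have hB : ∀ b ∉ insert a Z.support, Z b = 0 := fun b hb =>
    Finsupp.notMem_support_iff.1 fun h => hb (Finset.mem_insert_of_mem h)
  rw [opN_eq_sum hB, Finsupp.finsetSum_apply, Finset.sum_eq_single a]
  · rw [Finsupp.smul_apply, vec_apply_self, vec_apply_self, one_mul, smul_eq_mul, mul_one]
  · intro b _ hba
    rw [Finsupp.smul_apply]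
    by_cases h1 : a.1.1 = b.1.1
    · by_cases h2 : b.1.2 = a.1.2
      · exact absurd (Subtype.ext (Prod.ext h1.symm h2)) hba
      · rw [vec_apply_ne h2, smul_zero]
    · rw [vec_apply_ne h1, zero_mul, zero_smul]
  · exact fun h => absurd (Finset.mem_insert_self _ _) h

section Smooth
variable {X : Type*} [NormedAddCommGroup X] [NormedSpace ℝ X] {w : Set X}

theorem SmoothMat.opN {p : X → Entry q ε →₀ ℍ[ℝ]} (h : SmoothMat p w) :
    SmoothLin (fun z => opN (p z)) w := by
  obtain ⟨⟨B, hB⟩, hs⟩ := h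
  refine fun i => ⟨⟨entryIdx B, fun z hz => (opN_off (hB z hz)).span _⟩, fun j => ?_⟩
  refine (ContDiffOn.sum (s := B) (f := fun a z => ((vec i : V q) a.1.1 * p z a) * (vec a.1.2 : V q) j)
    fun a _ => (contDiffOn_const.mul (hs a)).mul contDiffOn_const).congr fun z hz => ?_
  rw [opN_eq_sum (hB z hz), Finsupp.finsetSum_apply]
  rfl

theorem SmoothMat.opD {p : X → Entry q ε →₀ ℍ[ℝ]} (h : SmoothMat p w) :
    SmoothLin (fun z => opD (p z)) w := by
  obtain ⟨⟨B, hB⟩, hs⟩ := h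
  refine fun i => ⟨⟨entryIdx B, fun z hz => opD_span (hB z hz) _⟩, fun j => ?_⟩
  refine (ContDiffOn.sum (s := B)
    (f := fun a z => -(((vec i : V q) a.1.2 * star (p z a)) * (vec a.1.1 : V q) j))
    fun a _ => ((contDiffOn_const.mul (contDiffOn_star (hs a))).mul contDiffOn_const).neg).congr
      fun z hz => ?_
  rw [opD_eq_sum (hB z hz), Finsupp.finsetSum_apply]
  rfl

end Smooth
end Op

/-- The matrices of which the graph is definite. -/
def matDomain (q : ℕ∞) (ε : ℝ) : Set (Entry q ε →₀ ℍ[ℝ]) := {Z | Def ε (uni (opN Z) • Vs q ε)}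

/-- The matrix of an endomorphism at level `S`. -/
def matOf (ε : ℝ) (S : Finset (Idx q)) (N : V q →ₗ[ℍ[ℝ]] V q) : Entry q ε →₀ ℍ[ℝ] :=
  open Classical in emb ((S ×ˢ S).subtype _) fun a => N (vec a.1.1.1) a.1.1.2

theorem matOf_apply {S : Finset (Idx q)} {N : V q →ₗ[ℍ[ℝ]] V q} (hN : Off ε S N)
    (a : Entry q ε) : matOf ε S N a = N (vec a.1.1) a.1.2 := by
  classical
  by_cases h : a ∈ (S ×ˢ S).subtype fun a : Idx q × Idx q => sgn a.1 = ε ∧ sgn a.2 = -ε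
  · exact emb_apply _ _ ⟨a, h⟩
  · refine (emb_apply_of_notMem _ _ h).trans ?_
    rw [Finset.mem_subtype, Finset.mem_product, not_and_or] at h
    rcases h with h | h
    · rw [hN.fix _ h]; rfl
    · exact (mem_spanOf.1 (hN.span _) _ h).symm

theorem opN_matOf (hε : IsSign ε) {S : Finset (Idx q)} {N : V q →ₗ[ℍ[ℝ]] V q} (hN : Off ε S N) :
    opN (matOf ε S N) = N := by
  have hO := opN_off (Z := matOf ε S N) (B := (matOf ε S N).support)
    fun a ha => Finsupp.notMem_support_iff.1 ha
  refine lin_ext fun i => ?_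
  rcases hε.sgn_or i with hi | hi
  · ext1 j
    rcases hε.sgn_or j with hj | hj
    · have hj' : sgn j ≠ -ε := by rw [hj]; exact hε.ne_neg
      rw [mem_Vs.1 (hO.mem _) j hj', mem_Vs.1 (hN.mem _) j hj']
    · exact (opN_vec_apply (Z := matOf ε S N) ⟨(i, j), hi, hj⟩).trans (matOf_apply hN _)
  · rw [hO.ker _ (vec_mem_Vs hi), hN.ker _ (vec_mem_Vs hi)]

theorem Off.eq_of_smul_eq (hε : IsSign ε) {S S' : Finset (Idx q)} {N N' : V q →ₗ[ℍ[ℝ]] V q}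
    (hN : Off ε S N) (hN' : Off ε S' N') (h : uni N • Vs q ε = uni N' • Vs q ε) {x : V q}
    (hx : x ∈ Vs q ε) : N x = N' x := by
  have h1 : uni N x ∈ uni N' • Vs q ε := by rw [← h]; exact apply_mem_smul.2 hx
  obtain ⟨y, hy, h2⟩ := (Submodule.mem_smul_pointwise_iff_exists _ _ _).1 h1
  have h3 : y + N' y = x + N x := by rw [← hN'.uni_apply, ← hN.uni_apply]; exact h2
  have key : ∀ (M : V q →ₗ[ℍ[ℝ]] V q) (R : Finset (Idx q)), Off ε R M → ∀ z, pr q ε (M z) = 0 :=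
    fun M R hM z => by
      have := pr_neg_of_mem hε.neg (hM.mem z)
      rwa [neg_neg] at this
  have h4 := congrArg (pr q ε) h3
  rw [map_add, map_add, key _ _ hN', key _ _ hN, add_zero, add_zero, pr_of_mem hx, pr_of_mem hy] at h4
  rw [h4] at h3
  exact (add_left_cancel h3).symm

/-- A matrix is sent to the graph of its linear map. Transversality of a definite subspace to
`V_{-ε}` makes it a graph, and `exists_chart` gives the smooth dependence of the matrix on the
subspace. -/
theorem matDomain_diffeomorphic (hε : IsSign ε) :
    Diffeomorphic (subDiffeology (matDiffeology (Entry q ε)) (matDomain q ε)) (bsDiffeology q ε) := by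
  classical
  have hsupp : ∀ Z : Entry q ε →₀ ℍ[ℝ], Off ε (entryIdx Z.support) (opN Z) := fun Z =>
    opN_off fun a ha => Finsupp.notMem_support_iff.1 ha
  let F : matDomain q ε → Bs q ε := fun Z =>
    ⟨uni (opN (Z : Entry q ε →₀ ℍ[ℝ])) • Vs q ε, ⟨_, ⟨_, (hsupp Z).uni_mem⟩, rfl⟩, Z.2⟩
  have hmem : ∀ {S : Finset (Idx q)} {N : V q →ₗ[ℍ[ℝ]] V q}, Off ε S N →
      Def ε (uni N • Vs q ε) → matOf ε S N ∈ matDomain q ε := fun hN hd => by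
    change Def ε (uni (opN (matOf ε _ _)) • Vs q ε)
    rwa [opN_matOf hε hN]
  have hF : ∀ {S : Finset (Idx q)} {N : V q →ₗ[ℍ[ℝ]] V q} (hN : Off ε S N)
      (hd : Def ε (uni N • Vs q ε)), (F ⟨_, hmem hN hd⟩ : Sub q) = uni N • Vs q ε := fun hN hd => by
    change uni (opN (matOf ε _ _)) • Vs q ε = _
    rw [opN_matOf hε hN]
  have hbij : Function.Bijective F := by
    refine ⟨fun Z Z' h => Subtype.ext (Finsupp.ext fun a => ?_), ?_⟩
    · have h1 : uni (opN (Z : Entry q ε →₀ ℍ[ℝ])) • Vs q ε =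
          uni (opN (Z' : Entry q ε →₀ ℍ[ℝ])) • Vs q ε := congrArg Subtype.val h
      rw [← opN_vec_apply a, ← opN_vec_apply a,
        Off.eq_of_smul_eq hε (hsupp _) (hsupp _) h1 (vec_mem_Vs a.2.1)]
    · rintro ⟨_, ⟨g, ⟨S, hS⟩, rfl⟩, hd⟩
      obtain ⟨N, hN, -, hNg⟩ := exists_chart (X := ℝ) (w := Set.univ) hε (g := fun _ => g) (S := S)
        (fun _ _ => hS) (SmoothLin.const _) fun _ _ => Off.def_inj hε hd
      have h1 := hNg 0 trivial
      have hd' : Def ε (uni (N 0) • Vs q ε) := by rw [h1]; exact hd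
      exact ⟨⟨_, hmem (hN 0) hd'⟩, Subtype.ext ((hF (hN 0) hd').trans h1)⟩
  let e := Equiv.ofBijective F hbij
  refine ⟨e, fun n p hp => mem_plots_iff.2 fun y => ?_, fun n p hp => mem_mat_plots_iff.2 fun y => ?_⟩
  · obtain ⟨w, hw, hy, hs⟩ := mem_mat_plots_iff.1 hp y
    have hsN := hs.opN
    obtain ⟨⟨B, hB⟩, -⟩ := hs
    refine ⟨w, hw, hy, fun z => uni (opN (p z : Entry q ε →₀ ℍ[ℝ])), Vs q ε,
      ⟨entryIdx B, fun z hz => (opN_off (hB z hz)).uni_mem, fun i => ?_⟩, fun z _ => rfl⟩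
    exact ((((SmoothLin.const LinearMap.id).add hsN).congr
      fun z hz => (opN_off (hB z hz)).toLinearMap_uni) i).2
  · obtain ⟨g, hg, hgx⟩ := (p y).2.1
    obtain ⟨w, hw, hy, γ, hγ, -, hz⟩ := exists_family_of_plot (p := Subtype.val ∘ p) hp hg hgx
    have hγs := hγ.smoothLin
    obtain ⟨S, hS, -⟩ := hγ
    have hpz : ∀ z ∈ w, (p z : Sub q) = γ z • Vs q ε := hz
    obtain ⟨N, hN, hNs, hNg⟩ := exists_chart hε hS hγs fun z hzw => Off.def_inj hε (by
      rw [← hpz z hzw]; exact (p z).2.2)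
    have hd : ∀ z ∈ w, Def ε (uni (N z) • Vs q ε) := fun z hzw => by
      rw [hNg z hzw, ← hpz z hzw]; exact (p z).2.2
    have he : ∀ z ∈ w, ((e.symm (p z) : matDomain q ε) : Entry q ε →₀ ℍ[ℝ]) = matOf ε S (N z) :=
      fun z hzw => by
        have h1 : e.symm (p z) = ⟨_, hmem (hN z) (hd z hzw)⟩ := by
          rw [Equiv.symm_apply_eq]
          exact Subtype.ext ((hpz z hzw).trans ((hNg z hzw).symm.trans (hF (hN z) (hd z hzw)).symm))
        rw [h1]
    refine ⟨w, hw, hy, ⟨(S ×ˢ S).subtype _, fun z hzw a ha => ?_⟩, fun a => ?_⟩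
    · change ((e.symm (p z) : matDomain q ε) : Entry q ε →₀ ℍ[ℝ]) a = 0
      rw [he z hzw]
      exact emb_apply_of_notMem _ _ ha
    · change ContDiffOn ℝ ∞ (fun z => ((e.symm (p z) : matDomain q ε) : Entry q ε →₀ ℍ[ℝ]) a) w
      exact ((hNs a.1.1).2 a.1.2).congr fun z hzw => by rw [he z hzw, matOf_apply (hN z)]

/-! ### The form on a graph, the diagonal of its inverse, and the gauge. -/

variable {ε : ℝ}

theorem IsSign.ne_zero (hε : IsSign ε) : ε ≠ 0 := by
  rcases hε with rfl | rfl <;> norm_num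

/-- The real part of the hermitian form on the graph of `opN Z`, up to the sign `ε`. -/
def graphForm (Z : Entry q ε →₀ ℍ[ℝ]) (x y : V q) : ℝ :=
  ε * ((herm x y).re + (herm (opN Z x) (opN Z y)).re)

theorem graphForm_comm (Z : Entry q ε →₀ ℍ[ℝ]) (x y : V q) : graphForm Z x y = graphForm Z y x := by
  unfold graphForm
  rw [herm_re_comm x y, herm_re_comm (opN Z x)]

theorem graphForm_add_self (Z : Entry q ε →₀ ℍ[ℝ]) (x y : V q) :
    graphForm Z (x + y) (x + y) = graphForm Z x x + 2 * graphForm Z x y + graphForm Z y y := by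
  unfold graphForm
  rw [map_add, herm_add_self_re, herm_add_self_re]
  ring

theorem graphForm_neg_self (Z : Entry q ε →₀ ℍ[ℝ]) (x : V q) :
    graphForm Z (-x) (-x) = graphForm Z x x := by
  unfold graphForm
  rw [map_neg, herm_neg_left, herm_neg_right, herm_neg_left, herm_neg_right, neg_neg, neg_neg]

theorem graphForm_neg_right (Z : Entry q ε →₀ ℍ[ℝ]) (x y : V q) :
    graphForm Z x (-y) = -graphForm Z x y := by
  unfold graphForm
  rw [map_neg, herm_neg_right, herm_neg_right, Quaternion.re_neg, Quaternion.re_neg]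
  ring

/-- Along a ray the form is quadratic in `t` and, by `opN_form_nonpos`, decreasing for `t ≥ 0`: this
makes the domain star-shaped. -/
theorem graphForm_smul_self (Z : Entry q ε →₀ ℍ[ℝ]) (t : ℝ) (x : V q) :
    graphForm (t • Z) x x = ε * (herm x x).re + t ^ 2 * (ε * (herm (opN Z x) (opN Z x)).re) := by
  unfold graphForm
  rw [opN_smul, LinearMap.smul_apply, real_smul_eq, herm_smul_smul_re, Quaternion.normSq_coe]
  ring

theorem mem_matDomain_iff (hε : IsSign ε) {Z : Entry q ε →₀ ℍ[ℝ]} :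
    Z ∈ matDomain q ε ↔ ∀ x ∈ Vs q ε, x ≠ 0 → 0 < graphForm Z x x := by
  have hO := opN_off (Z := Z) (B := Z.support) fun a ha => Finsupp.notMem_support_iff.1 ha
  have key : ∀ x ∈ Vs q ε, ε * (herm (uni (opN Z) x) (uni (opN Z) x)).re = graphForm Z x x := by
    intro x hx
    unfold graphForm
    rw [hO.uni_apply, herm_add_self_re, herm_Vs_Vs hε hx (hO.mem x)]
    simp
  constructor
  · intro h x hx hx0
    rw [← key x hx]
    exact h _ (apply_mem_smul.2 hx) fun h0 => hx0 (by simpa using h0)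
  · intro h y hy hy0
    obtain ⟨x, hx, rfl⟩ := (Submodule.mem_smul_pointwise_iff_exists _ _ _).1 hy
    have h1 := h x hx fun h0 => hy0 (by rw [h0]; exact map_zero (uni (opN Z)))
    rw [← key x hx] at h1
    exact h1

theorem graphForm_nonneg (hε : IsSign ε) {Z : Entry q ε →₀ ℍ[ℝ]} (hZ : Z ∈ matDomain q ε) {x : V q}
    (hx : x ∈ Vs q ε) : 0 ≤ graphForm Z x x := by
  by_cases h0 : x = 0
  · unfold graphForm
    rw [h0, map_zero, herm_zero_left]
    simp
  · exact ((mem_matDomain_iff hε).1 hZ x hx h0).le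

theorem opN_form_nonpos (hε : IsSign ε) (Z : Entry q ε →₀ ℍ[ℝ]) (x : V q) :
    ε * (herm (opN Z x) (opN Z x)).re ≤ 0 := by
  have hO := opN_off (Z := Z) (B := Z.support) fun a ha => Finsupp.notMem_support_iff.1 ha
  have := (def_Vs hε.neg).nonneg (hO.mem x)
  linarith

theorem graphForm_smul_le (hε : IsSign ε) (Z : Entry q ε →₀ ℍ[ℝ]) {t : ℝ} (h0 : 0 ≤ t) (h1 : t ≤ 1)
    (x : V q) : graphForm Z x x ≤ graphForm (t • Z) x x := by
  have h2 := graphForm_smul_self Z 1 x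
  rw [one_smul] at h2
  rw [h2, graphForm_smul_self]
  have h3 := opN_form_nonpos hε Z x
  have h4 : t ^ 2 ≤ 1 := pow_le_one₀ h0 h1
  nlinarith [mul_nonneg (sub_nonneg.2 h4) (neg_nonneg.2 h3)]

theorem smul_mem_matDomain (hε : IsSign ε) {Z : Entry q ε →₀ ℍ[ℝ]} (hZ : Z ∈ matDomain q ε) {t : ℝ}
    (h0 : 0 ≤ t) (h1 : t ≤ 1) : t • Z ∈ matDomain q ε :=
  (mem_matDomain_iff hε).2 fun x hx hx0 =>
    ((mem_matDomain_iff hε).1 hZ x hx hx0).trans_le (graphForm_smul_le hε Z h0 h1 x)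

/-- The endomorphism representing `graphForm Z`. -/
def formOp (Z : Entry q ε →₀ ℍ[ℝ]) : V q →ₗ[ℍ[ℝ]] V q := LinearMap.id + opD Z ∘ₗ opN Z

theorem formOp_apply (Z : Entry q ε →₀ ℍ[ℝ]) (x : V q) : formOp Z x = x + opD Z (opN Z x) := rfl

theorem graphForm_eq (Z : Entry q ε →₀ ℍ[ℝ]) (x y : V q) :
    graphForm Z x y = ε * (herm (formOp Z x) y).re := by
  unfold graphForm
  rw [formOp_apply, herm_add_left, ← star_herm y (opD Z _), ← herm_opN, star_herm, Quaternion.re_add]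

theorem formOp_atLevel {Z : Entry q ε →₀ ℍ[ℝ]} {B : Finset (Entry q ε)} (hB : ∀ a ∉ B, Z a = 0) :
    AtLevel (entryIdx B) (formOp Z) :=
  .of_vec (fun i hi => by rw [formOp_apply, (opN_off hB).fix i hi, map_zero, add_zero])
    fun i hi => add_mem (vec_mem_spanOf hi) (opD_span hB _)

theorem mem_Vs_of_formOp {Z : Entry q ε →₀ ℍ[ℝ]} {x : V q} (h : formOp Z x ∈ Vs q ε) :
    x ∈ Vs q ε := by
  rw [formOp_apply] at h
  exact (Submodule.add_mem_iff_left _ (opD_mem _)).1 h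

theorem formOp_bijective (hε : IsSign ε) {Z : Entry q ε →₀ ℍ[ℝ]} (hZ : Z ∈ matDomain q ε) :
    Function.Bijective (formOp Z) :=
  (formOp_atLevel (B := Z.support) fun a ha => Finsupp.notMem_support_iff.1 ha).bijective
    fun x _ hx => by
      by_contra hx0
      have h1 := (mem_matDomain_iff hε).1 hZ x (mem_Vs_of_formOp (by rw [hx]; exact zero_mem _)) hx0
      rw [graphForm_eq, hx, herm_zero_left] at h1
      simp at h1

/-- The automorphism representing `graphForm Z`, if it is nondegenerate. -/
def formAut (Z : Entry q ε →₀ ℍ[ℝ]) : GLV q :=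
  open Classical in if h : Function.Bijective (formOp Z) then LinearEquiv.ofBijective _ h else 1

theorem formAut_toLinearMap (hε : IsSign ε) {Z : Entry q ε →₀ ℍ[ℝ]} (hZ : Z ∈ matDomain q ε) :
    (formAut Z).toLinearMap = formOp Z := by
  unfold formAut
  rw [dif_pos (formOp_bijective hε hZ)]; rfl

theorem formOp_inv (hε : IsSign ε) {Z : Entry q ε →₀ ℍ[ℝ]} (hZ : Z ∈ matDomain q ε) (x : V q) :
    formOp Z ((formAut Z)⁻¹ x) = x := by
  rw [← formAut_toLinearMap hε hZ]
  exact apply_inv_self _ x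

/-- The diagonal entries of the inverse of the matrix of `graphForm Z`. -/
def invDiag (Z : Entry q ε →₀ ℍ[ℝ]) (i : Idx q) : ℝ := ((formAut Z)⁻¹ (vec i) i).re

section InvDiag
variable {Z : Entry q ε →₀ ℍ[ℝ]} {i : Idx q}

theorem inv_vec_mem (hε : IsSign ε) (hZ : Z ∈ matDomain q ε) (hi : sgn i = ε) :
    (formAut Z)⁻¹ (vec i) ∈ Vs q ε :=
  mem_Vs_of_formOp (by rw [formOp_inv hε hZ]; exact vec_mem_Vs hi)

/-- The vector `(formAut Z)⁻¹ (vec i)` represents the real part of the `i`-th coordinate with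
respect to `graphForm Z`. -/
theorem graphForm_inv (hε : IsSign ε) (hZ : Z ∈ matDomain q ε) (x : V q) (hi : sgn i = ε) :
    graphForm Z ((formAut Z)⁻¹ (vec i)) x = (x i).re := by
  rw [graphForm_eq, formOp_inv hε hZ, herm_vec_left, hi, Quaternion.re_smul, Quaternion.re_star,
    smul_eq_mul, ← mul_assoc, hε.mul_self, one_mul]

/-- A larger form has a smaller inverse. With `a`, `b` representing the coordinate for `Z` and `t •
Z`, positivity gives `0 ≤ graphForm Z (a - b) (a - b) ≤ Re a_i - 2 Re b_i + Re b_i`. -/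
theorem invDiag_smul_le (hε : IsSign ε) (hZ : Z ∈ matDomain q ε) (hi : sgn i = ε) {t : ℝ}
    (h0 : 0 ≤ t) (h1 : t ≤ 1) : invDiag (t • Z) i ≤ invDiag Z i := by
  have hW := smul_mem_matDomain hε hZ h0 h1
  obtain ⟨a, ha⟩ : ∃ a, a = (formAut Z)⁻¹ (vec i) := ⟨_, rfl⟩
  obtain ⟨b, hb⟩ : ∃ b, b = (formAut (t • Z))⁻¹ (vec i) := ⟨_, rfl⟩
  have haV : a ∈ Vs q ε := by rw [ha]; exact inv_vec_mem hε hZ hi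
  have hbV : b ∈ Vs q ε := by rw [hb]; exact inv_vec_mem hε hW hi
  have haf : ∀ x, graphForm Z a x = (x i).re := fun x => by rw [ha]; exact graphForm_inv hε hZ x hi
  have hbf : ∀ x, graphForm (t • Z) b x = (x i).re := fun x => by
    rw [hb]; exact graphForm_inv hε hW x hi
  have h2 := graphForm_nonneg hε hZ (add_mem haV (neg_mem hbV))
  rw [graphForm_add_self, graphForm_neg_self, graphForm_neg_right, haf, haf] at h2
  have h3 := graphForm_smul_le hε Z h0 h1 b
  rw [hbf] at h3
  have e1 : invDiag Z i = (a i).re := by rw [ha]; rfl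
  have e2 : invDiag (t • Z) i = (b i).re := by rw [hb]; rfl
  rw [e1, e2]
  linarith

theorem formAut_inv_of_fix (hε : IsSign ε) (hZ : Z ∈ matDomain q ε) (h : opN Z (vec i) = 0) :
    invDiag Z i = 1 := by
  have h1 : formAut Z (vec i) = vec i := by
    have : (formAut Z).toLinearMap (vec i) = vec i := by
      rw [formAut_toLinearMap hε hZ, formOp_apply, h, map_zero, add_zero]
    exact this
  have h2 : (formAut Z)⁻¹ (vec i) = vec i := by
    conv_lhs => rw [← h1, inv_apply_self]
  unfold invDiag
  rw [h2, vec_apply_self]; rfl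

/-- Monotonicity along the ray, compared with its starting point `0 • Z`, where the entry is `1`. -/
theorem one_le_invDiag (hε : IsSign ε) (hZ : Z ∈ matDomain q ε) (hi : sgn i = ε) :
    1 ≤ invDiag Z i := by
  rw [← formAut_inv_of_fix hε (smul_mem_matDomain hε hZ le_rfl zero_le_one) (i := i)
    (by rw [opN_smul, zero_smul]; rfl)]
  exact invDiag_smul_le hε hZ hi le_rfl zero_le_one

/-- The Cauchy–Schwarz inequality for the form and its inverse. -/
theorem normSq_le_invDiag (hε : IsSign ε) (hZ : Z ∈ matDomain q ε) (hi : sgn i = ε) {x : V q}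
    (hx : x ∈ Vs q ε) : Quaternion.normSq (x i) ≤ invDiag Z i * graphForm Z x x := by
  obtain ⟨a, ha⟩ : ∃ a, a = (formAut Z)⁻¹ (vec i) := ⟨_, rfl⟩
  have haV : a ∈ Vs q ε := by rw [ha]; exact inv_vec_mem hε hZ hi
  have haf : ∀ x, graphForm Z a x = (x i).re := fun x => by rw [ha]; exact graphForm_inv hε hZ x hi
  have hr : invDiag Z i = graphForm Z a a := by rw [haf, ha]; rfl
  have hr1 := one_le_invDiag hε hZ hi
  -- With this `c` the vector `x - c • a` has vanishing `i`-th coordinate and is orthogonal to `a`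
  -- for the form; its nonnegative square is the inequality.
  obtain ⟨c, hc⟩ : ∃ c : ℍ[ℝ], c = ((invDiag Z i)⁻¹ : ℝ) • x i := ⟨_, rfl⟩
  have h1 : ∀ y, graphForm Z y (c • a) = (y i * star c).re := fun y => by
    rw [graphForm_comm, graphForm_eq, map_smul, ha, formOp_inv hε hZ, herm_re_comm, herm_smul_right,
      herm_vec_right, hi, smul_mul_assoc, Quaternion.re_smul, smul_eq_mul, ← mul_assoc, hε.mul_self,
      one_mul]
  have h2 := graphForm_nonneg hε hZ (add_mem hx (neg_mem (Submodule.smul_mem _ c haV)))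
  rw [graphForm_add_self, graphForm_neg_self, graphForm_neg_right, h1, h1, Finsupp.smul_apply,
    smul_eq_mul] at h2
  have h3 : (x i * star c).re = (invDiag Z i)⁻¹ * Quaternion.normSq (x i) := by
    rw [hc, Quaternion.star_smul, mul_smul_comm, Quaternion.re_smul, smul_eq_mul, mul_star_self_re]
  -- The coordinate is real because the operator representing the form is self-adjoint.
  have hai : a i = ((invDiag Z i : ℝ) : ℍ[ℝ]) := by
    have h4 : herm a (formOp Z a) = ε • a i := by
      rw [ha, formOp_inv hε hZ, herm_vec_right, hi]
    have h5 : star (herm a (formOp Z a)) = herm a (formOp Z a) := by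
      rw [formOp_apply, herm_add_right, ← herm_opN, star_add, star_herm, star_herm]
    rw [h4, Quaternion.star_smul] at h5
    have h6 : star (a i) = a i := smul_right_injective _ hε.ne_zero h5
    have h7 : a i = ((a i).re : ℍ[ℝ]) := Quaternion.star_eq_self.1 h6
    rw [h7, ha]; rfl
  have h4 : (c * a i * star c).re = (invDiag Z i)⁻¹ * Quaternion.normSq (x i) := by
    rw [hai, ← Quaternion.coe_commutes, mul_assoc, Quaternion.coe_mul_eq_smul, Quaternion.re_smul,
      mul_star_self_re, hc, Quaternion.normSq_smul, smul_eq_mul]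
    field_simp
  rw [h3, h4] at h2
  have h5 : (invDiag Z i)⁻¹ * Quaternion.normSq (x i) ≤ graphForm Z x x := by linarith
  rwa [inv_mul_le_iff₀ (by linarith)] at h5

end InvDiag

/-- A function on the domain which grows along the rays and explodes at the boundary. -/
def gauge (Z : Entry q ε →₀ ℍ[ℝ]) : ℝ :=
  open Classical in 1 + ∑ i ∈ Z.support.image (fun a => a.1.1), (invDiag Z i - 1)

/-- Indices not involved in `Z` contribute `0`, so the sum may be taken over a fixed finite set as
`Z` varies at one level; this gives smoothness and monotonicity. -/
theorem gauge_eq_sum (hε : IsSign ε) {Z : Entry q ε →₀ ℍ[ℝ]} (hZ : Z ∈ matDomain q ε)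
    {I : Finset (Idx q)} (hI : ∀ a, Z a ≠ 0 → a.1.1 ∈ I) :
    gauge Z = 1 + ∑ i ∈ I, (invDiag Z i - 1) := by
  classical
  unfold gauge
  congr 1
  refine Finset.sum_subset_zero_on_sdiff (fun i hi => ?_) (fun i hi => ?_) fun i _ => rfl
  · obtain ⟨a, ha, rfl⟩ := Finset.mem_image.1 hi
    exact hI a (Finsupp.mem_support_iff.1 ha)
  · have h1 : i ∉ Z.support.image (fun a => a.1.1) := (Finset.mem_sdiff.1 hi).2
    rw [sub_eq_zero]
    refine formAut_inv_of_fix hε hZ ?_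
    rw [opN_eq_sum (B := Z.support) fun a ha => Finsupp.notMem_support_iff.1 ha]
    refine Finset.sum_eq_zero fun a ha => ?_
    rw [vec_apply_ne (i := i) (j := a.1.1)
      fun h => h1 (Finset.mem_image.2 ⟨a, ha, h.symm⟩), zero_mul, zero_smul]

theorem isOpen_matDomain (hε : IsSign ε) (B : Finset (Entry q ε)) :
    IsOpen {a : B → ℍ[ℝ] | emb B a ∈ matDomain q ε} := by
  have hO : ∀ a : B → ℍ[ℝ], Off ε (entryIdx B) (opN (emb B a)) := fun a =>
    opN_off fun i hi => emb_apply_of_notMem B a hi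
  rw [isOpen_iff_mem_nhds]
  intro a ha
  exact eventually_def hε isOpen_univ (fun z _ => (hO z).uni_mem)
    (((SmoothLin.const LinearMap.id).add (smoothMat_emb B).opN).congr
      fun z _ => (hO z).toLinearMap_uni) (Set.mem_univ a) ha

theorem contDiffOn_gauge (hε : IsSign ε) (B : Finset (Entry q ε)) :
    ContDiffOn ℝ ∞ (fun a => gauge (emb B a)) {a : B → ℍ[ℝ] | emb B a ∈ matDomain q ε} := by
  classical
  obtain ⟨w, hw⟩ : ∃ w, w = {a : B → ℍ[ℝ] | emb B a ∈ matDomain q ε} := ⟨_, rfl⟩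
  rw [← hw]
  have hmem : ∀ a ∈ w, emb B a ∈ matDomain q ε := fun a ha => by rw [hw] at ha; exact ha
  have hsm : SmoothMat (emb B) w :=
    ⟨⟨B, fun z _ a ha => emb_apply_of_notMem B z ha⟩,
      fun a => ((smoothMat_emb B).2 a).mono (Set.subset_univ _)⟩
  have h1 : SmoothLin (fun a => (formAut (emb B a)).toLinearMap) w :=
    ((SmoothLin.const LinearMap.id).add (hsm.opD.comp hsm.opN)).congr fun a ha =>
      formAut_toLinearMap hε (hmem a ha)
  have h2 := SmoothLin.inv (S := entryIdx B) (fun a ha => by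
    rw [formAut_toLinearMap hε (hmem a ha)]
    exact formOp_atLevel fun i hi => emb_apply_of_notMem B a hi) h1
  have h3 : ContDiffOn ℝ ∞ (fun a : B → ℍ[ℝ] =>
      1 + ∑ i ∈ B.image (fun a => a.1.1), (invDiag (emb B a) i - 1)) w :=
    contDiffOn_const.add (ContDiffOn.sum fun i _ => (contDiffOn_re ((h2 i).2 i)).sub contDiffOn_const)
  refine h3.congr fun a ha => gauge_eq_sum hε (hmem a ha) fun b hb => ?_
  refine Finset.mem_image_of_mem (fun a : Entry q ε => a.1.1) ?_
  by_contra h4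
  exact hb (emb_apply_of_notMem B a h4)

/-- All summands in the gauge are nonnegative, so it dominates each diagonal entry. -/
theorem invDiag_le_gauge (hε : IsSign ε) {Z : Entry q ε →₀ ℍ[ℝ]} (hZ : Z ∈ matDomain q ε)
    {i : Idx q} (hi : sgn i = ε) : invDiag Z i ≤ gauge Z := by
  classical
  rw [gauge_eq_sum hε hZ (I := insert i (Z.support.image fun a => a.1.1)) fun a ha =>
    Finset.mem_insert_of_mem (Finset.mem_image_of_mem (fun a : Entry q ε => a.1.1)
      (Finsupp.mem_support_iff.2 ha))]
  have h1 := Finset.single_le_sum (f := fun i => invDiag Z i - 1) (fun j hj => ?_)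
    (Finset.mem_insert_self i (Z.support.image fun a => a.1.1))
  · have h2 : invDiag Z i - 1 ≤ ∑ i ∈ insert i (Z.support.image fun a => a.1.1),
      (invDiag Z i - 1) := h1
    linarith
  · have hj' : sgn j = ε := by
      rcases Finset.mem_insert.1 hj with rfl | h
      · exact hi
      · obtain ⟨a, -, rfl⟩ := Finset.mem_image.1 h
        exact a.2.1
    have := one_le_invDiag hε hZ hj'
    change 0 ≤ invDiag Z j - 1
    linarith

theorem zero_mem_matDomain (hε : IsSign ε) : (0 : Entry q ε →₀ ℍ[ℝ]) ∈ matDomain q ε :=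
  (mem_matDomain_iff hε).2 fun x hx hx0 => by
    have h := graphForm_smul_self (0 : Entry q ε →₀ ℍ[ℝ]) 0 x
    rw [zero_smul] at h
    rw [h]
    have := def_Vs hε x hx hx0
    linarith

theorem isClosed_not_mem (hε : IsSign ε) (Z : Entry q ε →₀ ℍ[ℝ]) :
    IsClosed {t : ℝ | t • Z ∉ matDomain q ε} := by
  obtain ⟨a, ha⟩ : ∃ a : Z.support → ℍ[ℝ], emb Z.support a = Z :=
    ⟨_, emb_coords fun i hi => Finsupp.notMem_support_iff.1 hi⟩
  have hc : Continuous fun t : ℝ => t • a := by fun_prop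
  have h := ((isOpen_matDomain hε Z.support).preimage hc).isClosed_compl
  convert h using 1
  ext t
  change t • Z ∉ matDomain q ε ↔ ¬ (emb Z.support (t • a) ∈ matDomain q ε)
  rw [emb_smul, ha]

/-- If the ray leaves the domain, let `s` be the first parameter outside. There some `x ≠ 0` has a
nonpositive value of the form, so for `t` slightly below `s` the value at `x` is positive but small,
and Cauchy–Schwarz makes a diagonal entry of the inverse large. If `Z` itself is in the domain, `t =
1` works. -/
theorem exists_gauge_large (hε : IsSign ε) (Z : Entry q ε →₀ ℍ[ℝ]) :
    ∃ t : ℝ, 0 ≤ t ∧ t • Z ∈ matDomain q ε ∧ 1 ≤ t * gauge (t • Z) := by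
  classical
  have hone : ∀ {W : Entry q ε →₀ ℍ[ℝ]}, W ∈ matDomain q ε → 1 ≤ gauge W := fun {W} hW => by
    unfold gauge
    have : 0 ≤ ∑ i ∈ W.support.image (fun a => a.1.1), (invDiag W i - 1) :=
      Finset.sum_nonneg fun i hi => by
        obtain ⟨a, -, rfl⟩ := Finset.mem_image.1 hi
        have := one_le_invDiag hε hW a.2.1
        linarith
    linarith
  by_cases hZ : Z ∈ matDomain q ε
  · exact ⟨1, zero_le_one, by rwa [one_smul], by rw [one_smul, one_mul]; exact hone hZ⟩
  obtain ⟨T, hT⟩ : ∃ T, T = {t : ℝ | t • Z ∉ matDomain q ε} ∩ Set.Icc 0 1 := ⟨_, rfl⟩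
  have hTc : IsClosed T := by rw [hT]; exact (isClosed_not_mem hε Z).inter isClosed_Icc
  have hTn : T.Nonempty := ⟨1, by
    rw [hT]
    refine ⟨?_, zero_le_one, le_rfl⟩
    change (1 : ℝ) • Z ∉ _
    rwa [one_smul]⟩
  have hTb : BddBelow T := ⟨0, fun t ht => by rw [hT] at ht; exact ht.2.1⟩
  obtain ⟨s, hs⟩ : ∃ s, s = sInf T := ⟨_, rfl⟩
  have hsT : s ∈ T := by rw [hs]; exact hTc.csInf_mem hTn hTb
  have hlt : ∀ t, 0 ≤ t → t < s → t • Z ∈ matDomain q ε := fun t h0 h1 => by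
    by_contra h2
    rw [hT] at hsT
    have : s ≤ t := by
      rw [hs]
      exact csInf_le hTb (by rw [hT]; exact ⟨h2, h0, h1.le.trans hsT.2.2⟩)
    linarith
  have hsT' := hsT
  rw [hT] at hsT'
  have hs0 : 0 < s := lt_of_le_of_ne hsT'.2.1 fun h => hsT'.1 (by
    rw [← h, zero_smul]; exact zero_mem_matDomain hε)
  have hnot : s • Z ∉ matDomain q ε := hsT'.1
  rw [mem_matDomain_iff hε] at hnot
  push Not at hnot
  obtain ⟨x, hx, hx0, hneg⟩ := hnot
  obtain ⟨i, hi⟩ : ∃ i, x i ≠ 0 := by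
    by_contra h
    push Not at h
    exact hx0 (Finsupp.ext h)
  have hiε : sgn i = ε := by
    by_contra h
    exact hi (mem_Vs.1 hx i h)
  have hm : 0 < Quaternion.normSq (x i) :=
    lt_of_le_of_ne Quaternion.normSq_nonneg (Ne.symm (Quaternion.normSq_ne_zero.2 hi))
  have hc : Continuous fun t : ℝ => graphForm (t • Z) x x := by
    simp only [graphForm_smul_self]
    fun_prop
  -- The bound with `s / 2` yields `gauge (t • Z) * (s / 2) > 1`, and `t > s / 2` then suffices.
  have hlim : ∀ᶠ t in nhds s, graphForm (t • Z) x x < Quaternion.normSq (x i) * (s / 2) :=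
    hc.continuousAt.eventually (gt_mem_nhds (lt_of_le_of_lt hneg (by positivity)))
  obtain ⟨t, ⟨h1, h2⟩, h3⟩ := (((hlim.and (lt_mem_nhds (half_lt_self hs0))).filter_mono
    nhdsWithin_le_nhds).and (self_mem_nhdsWithin (a := s) (s := Set.Iio s))).exists
  have h3' : t < s := h3
  have ht0 : 0 < t := (half_pos hs0).trans h2
  have htZ := hlt t ht0.le h3'
  refine ⟨t, ht0.le, htZ, ?_⟩
  have h4 := normSq_le_invDiag hε htZ hiε hx
  have h5 := invDiag_le_gauge hε htZ hiε
  have h6 := (mem_matDomain_iff hε).1 htZ x hx hx0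
  have hg0 : 0 < gauge (t • Z) := by linarith [hone htZ]
  have h7 : Quaternion.normSq (x i) < gauge (t • Z) * (Quaternion.normSq (x i) * (s / 2)) :=
    calc Quaternion.normSq (x i) ≤ invDiag (t • Z) i * graphForm (t • Z) x x := h4
      _ ≤ gauge (t • Z) * graphForm (t • Z) x x := mul_le_mul_of_nonneg_right h5 h6.le
      _ < _ := mul_lt_mul_of_pos_left h1 hg0
  have h8 : 1 < gauge (t • Z) * (s / 2) := by
    by_contra h9
    push Not at h9
    nlinarith
  nlinarith

theorem matDomain_radialData (hε : IsSign ε) :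
    RadialData (matDomain q ε) (gauge (q := q) (ε := ε)) where
  star := fun _ hZ _ h0 h1 => smul_mem_matDomain hε hZ h0 h1
  one_le := fun Z hZ => by
    classical
    unfold gauge
    have : 0 ≤ ∑ i ∈ Z.support.image (fun a => a.1.1), (invDiag Z i - 1) :=
      Finset.sum_nonneg fun i hi => by
        obtain ⟨a, -, rfl⟩ := Finset.mem_image.1 hi
        have := one_le_invDiag hε hZ a.2.1
        linarith
    linarith
  mono := fun Z hZ t h0 h1 => by
    classical
    rw [gauge_eq_sum hε (smul_mem_matDomain hε hZ h0 h1) (I := Z.support.image fun a => a.1.1)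
      fun a ha => Finset.mem_image_of_mem (fun a : Entry q ε => a.1.1)
        (Finsupp.mem_support_iff.2 fun h => ha (by rw [Finsupp.smul_apply, h, smul_zero]))]
    unfold gauge
    refine add_le_add le_rfl (Finset.sum_le_sum fun i hi => ?_)
    obtain ⟨a, -, rfl⟩ := Finset.mem_image.1 hi
    have := invDiag_smul_le hε hZ a.2.1 h0 h1
    linarith
  blow := exists_gauge_large hε

/-- The bounded symmetric domains are diffeomorphic to spaces of finitely supported matrices. -/
theorem bs_diffeomorphic (hε : IsSign ε) :
    Diffeomorphic (bsDiffeology q ε) (matDiffeology (Entry q ε)) :=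
  (matDomain_diffeomorphic hε).symm.trans
    (diffeomorphic_of_radialData (matDomain_radialData hε) (isOpen_matDomain hε)
      (contDiffOn_gauge hε))

/-! ### Comparison of the bounded symmetric domains -/

/-- The positive basis vectors are infinite in number, so one negative basis vector already gives
infinitely many positions. -/
theorem infinite_entry [Nonempty (Entry q 1)] : Infinite (Entry q 1) := by
  obtain ⟨⟨⟨_, j⟩, _, hj⟩⟩ := ‹Nonempty (Entry q 1)›
  exact Infinite.of_injective (fun n : ℕ => (⟨(Sum.inl n, j), rfl, hj⟩ : Entry q 1)) fun n m h => by
    simpa using h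

/-- Both domains are spaces of finitely supported matrices, and transposition matches their
positions. -/
theorem bs_one_diffeomorphic_bs_neg_one :
    Diffeomorphic (bsDiffeology q 1) (bsDiffeology q (-1)) := by
  let σ : Entry q 1 ≃ Entry q (-1) :=
    { toFun := fun a => ⟨(a.1.2, a.1.1), a.2.2, by rw [neg_neg]; exact a.2.1⟩
      invFun := fun a => ⟨(a.1.2, a.1.1), a.2.2.trans (neg_neg 1), a.2.1⟩
      left_inv := fun _ => rfl
      right_inv := fun _ => rfl }
  exact (bs_diffeomorphic isSign_one).trans
    ((mat_equiv σ).trans (bs_diffeomorphic isSign_neg_one).symm)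

/-- The product is the space of matrices on two copies of the positions, and a countably infinite
set is in bijection with two copies of itself. Without negative basis vectors there are no positions
at all. -/
theorem bs_prod_diffeomorphic :
    Diffeomorphic (prodDiffeology (bsDiffeology q 1) (bsDiffeology q (-1))) (bsDiffeology q 1) := by
  have h1 : Diffeomorphic (prodDiffeology (bsDiffeology q 1) (bsDiffeology q (-1)))
      (matDiffeology (Entry q 1 ⊕ Entry q 1)) :=
    ((bs_diffeomorphic isSign_one).prod
      (bs_one_diffeomorphic_bs_neg_one.symm.trans (bs_diffeomorphic isSign_one))).trans (mat_prod _ _)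
  refine h1.trans (Diffeomorphic.trans ?_ (bs_diffeomorphic isSign_one).symm)
  cases isEmpty_or_nonempty (Entry q 1)
  · exact mat_equiv (Equiv.equivOfIsEmpty _ _)
  · have := infinite_entry (q := q)
    obtain ⟨σ⟩ := nonempty_equiv_of_countable (α := Entry q 1 ⊕ Entry q 1) (β := Entry q 1)
    exact mat_equiv σ

theorem bpos_diffeomorphic : Diffeomorphic (BposDiffeology q) (bsDiffeology q 1) := by
  have key : ∀ s : Set (Sub q), s = Bs q 1 →
      Diffeomorphic (subDiffeology (orbitDiffeology q (Sub q)) s) (bsDiffeology q 1) := by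
    rintro _ rfl
    exact ⟨Equiv.refl _, fun _ _ hp => hp, fun _ _ hp => hp⟩
  exact key _ Bpos_eq

theorem bneg_diffeomorphic : Diffeomorphic (BnegDiffeology q) (bsDiffeology q (-1)) := by
  have key : ∀ s : Set (Sub q), s = Bs q (-1) →
      Diffeomorphic (subDiffeology (orbitDiffeology q (Sub q)) s) (bsDiffeology q (-1)) := by
    rintro _ rfl
    exact ⟨Equiv.refl _, fun _ _ hp => hp, fun _ _ hp => hp⟩
  exact key _ Bneg_eq

end QuatCycle

end

theorem theorem6p6 (q : ℕ∞) :
    QuatCycle.Bpos q =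
        {W | (∃ g ∈ QuatCycle.G q, W = g • QuatCycle.Vpos q) ∧ QuatCycle.PosDef W} ∧
    QuatCycle.Bneg q =
        {W | (∃ g ∈ QuatCycle.G q, W = g • QuatCycle.Vneg q) ∧ QuatCycle.NegDef W} ∧
    QuatCycle.Diffeomorphic (QuatCycle.BposDiffeology q) (QuatCycle.BnegDiffeology q) ∧
    ∀ (C : QuatCycle.Chain q), QuatCycle.IsGenFlag C → QuatCycle.WeaklyCompatible C →
      (∃ F ∈ C, F ≠ ⊥ ∧ F ≠ ⊤) →
      ∀ D : Set (QuatCycle.Chain q), QuatCycle.IsFlagDomain C D →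
        (∃ Y, QuatCycle.IsBaseCycle D Y) ∧
        ∀ Y, QuatCycle.IsBaseCycle D Y → ∀ C₁ ∈ D,
          ((∀ F ∈ C₁, F ≠ ⊤ → QuatCycle.PosDef F) →
            QuatCycle.Diffeomorphic (QuatCycle.cycleSpaceDiffeology D Y)
              (QuatCycle.BposDiffeology q)) ∧
          ((∀ F ∈ C₁, F ≠ ⊤ → QuatCycle.NegDef F) →
            QuatCycle.Diffeomorphic (QuatCycle.cycleSpaceDiffeology D Y)
              (QuatCycle.BnegDiffeology q)) ∧
          ((∃ F ∈ C₁, F ≠ ⊤ ∧ QuatCycle.Indef F) →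
            QuatCycle.Diffeomorphic (QuatCycle.cycleSpaceDiffeology D Y)
              (QuatCycle.prodDiffeology (QuatCycle.BposDiffeology q)
                (QuatCycle.BnegDiffeology q))) := by
  have h1 := QuatCycle.bs_one_diffeomorphic_bs_neg_one (q := q)
  have hp := QuatCycle.bpos_diffeomorphic (q := q)
  have hm := QuatCycle.bneg_diffeomorphic (q := q)
  have hprod := QuatCycle.bs_prod_diffeomorphic (q := q)
  refine ⟨?_, ?_, hp.trans (h1.trans hm.symm), ?_⟩
  · rw [QuatCycle.Bpos_eq]
    ext W
    simp only [QuatCycle.Bs, Set.mem_ofPred_eq, QuatCycle.Vpos_eq, QuatCycle.def_one]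
  · rw [QuatCycle.Bneg_eq]
    ext W
    simp only [QuatCycle.Bs, Set.mem_ofPred_eq, QuatCycle.Vneg_eq, QuatCycle.def_neg_one]
  · intro C hC _ hn D hD
    refine ⟨QuatCycle.exists_isBaseCycle hD, fun Y hY C₁ _ => ?_⟩
    -- Whichever of the three models occurs, it is diffeomorphic to the positive domain.
    have hM : QuatCycle.Diffeomorphic (QuatCycle.cycleSpaceDiffeology D Y)
        (QuatCycle.bsDiffeology q 1) := by
      rcases QuatCycle.cycleSpace_diffeomorphic hC hn hD hY with h | h | h
      · exact h
      · exact h.trans h1.symm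
      · exact h.trans hprod
    exact ⟨fun _ => hM.trans hp.symm, fun _ => (hM.trans h1).trans hm.symm,
      fun _ => hM.trans (hprod.symm.trans (hp.symm.prod hm.symm))⟩
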